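/- Let $n\ge 1$, $[n]=\{1<\dots<n\}$, and let $[n]^\ast$ be the set of words over $[n]$; the weight of a word counts the occurrences of each letter. A *column* is a nonempty, strictly increasing (from top to bottom) sequence of letters, $|c|$ denotes the length of the column $c$, and a *string of columns* $c_1|_{p_1}c_2|_{p_2}\cdots|_{p_{m-1}}c_m$ is a finite sequence of columns in which the bottom box of $c_{k+1}$ is put in the row of the $p_k$-th box of $c_k$. Its *reading* $R$ is the word obtained by reading the columns from left to right, each from bottom to top; its weight is the weight of its reading. A *diagonal skew tableau* is a string of columns with all $p_k=1$ and weakly increasing rows; $R$ is a bijection from the set $\mathrm{dSk}_n$ of diagonal skew tableaux onto $[n]^\ast$, with inverse $w\mapsto[w]_s$. A *Young tableau* is a (semistandard) string of columns with $p_k=|c_{k+1}|\le|c_k|$ for all $k$ and weakly increasing rows; $\mathrm{Yt}_n$ is the set of Young tableaux. The *rectification* $\mathrm{rect}(d)$ of $d\in \mathrm{dSk}_n$ is the Young tableau obtained by applying Schützenberger's forward slidings (jeu de taquin) to inner corners of the skew diagram until none is left. Let $\mathrm{dSk}^r_n$ (resp. $\mathrm{dSk}^c_n$) be $\mathrm{dSk}_n$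 with the right (resp. left) insertion of a letter $x$ that corresponds to the readings $w\mapsto wx$ (resp. $w\mapsto xw$), i.e. concatenation of $x$ on top of the last column (resp. at the bottom of the first column) if this gives a column, and as a new last (resp. first) column otherwise. Let $\mathrm{Yt}^r_n$ (resp. $\mathrm{Yt}^c_n$) be $\mathrm{Yt}_n$ with Schensted's row (resp. column) insertion. Each is an associative right (resp. left) string data structure with reading map $R$: $R$ is injective, $R(\emptyset)$ is the empty word, inserting $x$ in $\emptyset$ gives an element with reading $x$, inserting the word $R(d)$ in $\emptyset$ (letter by letter, from left to right, resp. from right to left) gives $d$, and the product in which $d'$ is multiplied to $d$ by inserting $R(d')$ in $d$ is associative. A *morphism* $f$ of right (resp. left) string data structures is a map that preserves $\emptyset$, commutes with the insertion of letters, and is such that $R(d)$ and $R(f(d))$ give the same element when inserted in $\emptyset$ in the target. For $1\le i\le n-1$ the Kashiwara operators $e_i,f_i$ on words (values in words or $0$) are defined thus: replace each letter $i$ by $+$, each $i+1$ by $-$, delete the other letters, and delete subwords $-+$ until a word $+^r-^l$ remains; $f_i$ changes the letter $i$ of the rightmost remaining $+$ into $i+1$ (it is $0$ if $r=0$), and $e_i$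 changes the letter $i+1$ of the leftmost remaining $-$ into $i$ (it is $0$ if $l=0$). On strings of columns, $e_i$ and $f_i$ are defined in the same way, with each column that contains $i$ but not $i+1$ replaced by $+$, each column that contains $i+1$ but not $i$ replaced by $-$, and the other columns deleted; the gluing positions are kept. Let $\Gamma(\mathcal K,u)$ be the connected component of $u$ in the graph with an arrow $v\xrightarrow{i}v'$ whenever $f_i(v)=v'$. A *crystal isomorphism* $\Gamma(\mathcal K,u)\to\Gamma(\mathcal K,u')$ is a weight-preserving bijection that sends every arrow $v\xrightarrow{i}v'$ to an arrow $\psi(v)\xrightarrow{i}\psi(v')$. **Corollary.** The rectification $\mathrm{rect}:\mathrm{dSk}_n\to\mathrm{Yt}_n$ is well defined (it exists and does not depend on the choice of the inner corners) and is a morphism of right string data structures $\mathrm{rect}^r:\mathrm{dSk}^r_n\to\mathrm{Yt}^r_n$ and a morphism of left string data structures $\mathrm{rect}^c:\mathrm{dSk}^c_n\to\mathrm{Yt}^c_n$. For every $d\in\mathrm{dSk}_n$ it induces a crystal isomorphism from $\Gamma(\mathcal K,d)$ to $\Gamma(\mathcal K,\mathrm{rect}(d))$: on strings of columns, $\Gamma(\mathcal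 K,d)\subseteq\mathrm{dSk}_n$ and $v\mapsto\mathrm{rect}(v)$ is such an isomorphism; on words, $w\mapsto R(\mathrm{rect}([w]_s))$ is a crystal isomorphism from $\Gamma(\mathcal K,R(d))$ to $\Gamma(\mathcal K,R(\mathrm{rect}(d)))$. -/

import Mathlib

namespace JeuDeTaquin

/-! ## Strings of columns -/

/-- Raw data of a string of columns over the alphabet `[n]` (represented by `Fin n`):
the list of its columns from left to right, each listed from top to bottom, and its gluing
sequence. -/
@[ext]
structure ColString (n : ℕ) where
  cols : List (List (Fin n))
  glue : List ℤ

namespace ColString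

variable {n : ℕ}

/-- The `k`-th column (`k = 0, 1, …`); the empty list when there is no such column. -/
def col (w : ColString n) (k : ℕ) : List (Fin n) := w.cols.getD k []

/-- The position at which the columns `k` and `k + 1` are glued. Gluing `c` and `c'` at position
`p` puts the bottom box of `c'` in the row of the `p`-th box of `c`. -/
def pos (w : ColString n) (k : ℕ) : ℤ := w.glue.getD k 0

/-- The string of columns with given columns, glued by means of a gluing map `g`. -/
def ofCols (g : List (Fin n) → List (Fin n) → ℤ) (cs : List (List (Fin n))) : ColString n :=
  ⟨cs, List.zipWith g cs cs.tail⟩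

/-- The empty string of columns. -/
def empty : ColString n := ⟨[], []⟩

/-- The south-west reading: columns from left to right, each column from bottom to top. -/
def read (w : ColString n) : List (Fin n) := (w.cols.map List.reverse).flatten

/-- The number of boxes between the top of column `k` and the top of the last column. For skew
tableaux this is the number of empty boxes above column `k`, below the top row. -/
def height (w : ColString n) (k : ℕ) : ℕ :=
  (∑ l ∈ Finset.Ico k (w.cols.length - 1), (((w.col (l + 1)).length : ℤ) - w.pos l)).toNat

/-- The content of the box in row `i` and column `k` (rows numbered downwards from the top row,
columns from the left, both starting with `0`), `none` if the box is empty. -/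
def box (w : ColString n) (i k : ℕ) : Option (Fin n) :=
  if i < w.height k then none else (w.col k)[i - w.height k]?

/-- The set of empty boxes above the columns, i.e. the diagram `μ` of the skew shape `λ / μ`. -/
def inner (w : ColString n) : Set (ℕ × ℕ) := {b | b.1 < w.height b.2}

end ColString

open ColString

/-- Strings of columns: columns are nonempty and strictly increase from top to bottom. -/
def Scol (n : ℕ) : Set (ColString n) :=
  {w | (∀ c ∈ w.cols, c ≠ [] ∧ c.Pairwise (· < ·)) ∧ w.glue.length = w.cols.length - 1}

/-- (Connected) skew tableaux: any two consecutive columns share a row, tops and bottoms of the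
columns weakly go up from left to right, and rows weakly increase. The `j`-th box of column `k`
and the `l`-th box of column `k + 1` are in the same row iff `j = l + (p - |c_{k+1}|)`. -/
def Skew (n : ℕ) : Set (ColString n) :=
  {w | w ∈ Scol n ∧ ∀ k, k + 1 < w.cols.length →
    1 ≤ w.pos k ∧ w.pos k ≤ (w.col k).length ∧ w.pos k ≤ (w.col (k + 1)).length ∧
    ∀ (j l : ℕ) (x y : Fin n), (j : ℤ) = l + (w.pos k - (w.col (k + 1)).length) →
      (w.col k)[j]? = some x → (w.col (k + 1))[l]? = some y → x ≤ y}

/-- Diagonal skew tableaux. -/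
def DSkew (n : ℕ) : Set (ColString n) := {w | w ∈ Skew n ∧ ∀ p ∈ w.glue, p = 1}

/-- (Semistandard) Young tableaux. -/
def Young (n : ℕ) : Set (ColString n) :=
  {w | w ∈ Skew n ∧ ∀ k, k + 1 < w.cols.length → w.pos k = (w.col (k + 1)).length}

/-- The gluing map of diagonal skew tableaux. -/
def glueS {n : ℕ} : List (Fin n) → List (Fin n) → ℤ := fun _ _ => 1

/-- The gluing map of Young tableaux. -/
def glueY {n : ℕ} : List (Fin n) → List (Fin n) → ℤ := fun _ c' => c'.length

/-- The string of columns `[w]_s`: the word `w` is cut into its maximal strictly decreasing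
factors, which become the columns (read from bottom to top), glued at positions `1`. -/
def diag {n : ℕ} (w : List (Fin n)) : ColString n :=
  ofCols glueS ((w.splitBy (fun x y => decide (y < x))).map List.reverse)

/-! ## Jeu de taquin -/

/-- A filling of the quadrant: `T i j` is the content of the box in row `i` and column `j`. -/
abbrev Filling (n : ℕ) := ℕ → ℕ → Option (Fin n)

/-- Move the content of the box `b` into the box `a`, leaving `b` empty. -/
def Filling.move {n : ℕ} (T : Filling n) (b a : ℕ × ℕ) : Filling n := fun i j =>
  if (i, j) = a then T b.1 b.2 else if (i, j) = b then none else T i j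

/-- One elementary sliding; the state consists of the filling and the position of the moving empty
box. The neighbour below moves up, or the neighbour on the right moves left. -/
inductive Sliding {n : ℕ} : Filling n × (ℕ × ℕ) → Filling n × (ℕ × ℕ) → Prop
  | up (T : Filling n) (i j : ℕ) (x : Fin n) (hx : T (i + 1) j = some x)
      (h : ∀ y, T i (j + 1) = some y → x ≤ y) :
      Sliding (T, (i, j)) (T.move (i + 1, j) (i, j), (i + 1, j))
  | left (T : Filling n) (i j : ℕ) (x : Fin n) (hx : T i (j + 1) = some x)
      (h : ∀ y, T (i + 1) j = some y → x < y) :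
      Sliding (T, (i, j)) (T.move (i, j + 1) (i, j), (i, j + 1))

/-- `b` is an inner corner of a skew diagram `λ / μ`, i.e. a removable box of `μ`. -/
def IsInnerCorner (μ : Set (ℕ × ℕ)) (b : ℕ × ℕ) : Prop :=
  b ∈ μ ∧ (b.1 + 1, b.2) ∉ μ ∧ (b.1, b.2 + 1) ∉ μ

/-- A forward sliding of a skew tableau `(μ, T)`: an inner corner `b` is moved by elementary
slidings until it becomes an outer corner `c`. -/
def ForwardSlide {n : ℕ} (P Q : Set (ℕ × ℕ) × Filling n) : Prop :=
  ∃ b c : ℕ × ℕ, IsInnerCorner P.1 b ∧ Q.1 = P.1 \ {b} ∧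
    Relation.ReflTransGen Sliding (P.2, b) (Q.2, c) ∧
    Q.2 (c.1 + 1) c.2 = none ∧ Q.2 c.1 (c.2 + 1) = none

/-- `t` is a Young tableau obtained from `w` by successive forward slidings, for some choice of
inner corners, until there is no inner corner left. -/
def IsRectification {n : ℕ} (w t : ColString n) : Prop :=
  t ∈ Young n ∧ Relation.ReflTransGen ForwardSlide (w.inner, w.box) (∅, t.box)

open Classical in
/-- The rectification by the jeu de taquin. (The value `w` is used if there is no rectification,
which does not happen for skew tableaux.) -/
noncomputable def rect {n : ℕ} (w : ColString n) : ColString n :=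
  if h : ∃ t, IsRectification w t then h.choose else w

/-! ## String data structures -/

/-- Data of a string data structure, whose underlying set is a subset `carrier` of a type `X`. -/
structure StringData (n : ℕ) (X : Type*) where
  carrier : Set X
  empty : X
  ins : X → Fin n → X
  read : X → List (Fin n)

namespace StringData

variable {n : ℕ} {X Y : Type*}

/-- Right insertion of a word, letter by letter from left to right. -/
def insR (S : StringData n X) (d : X) (u : List (Fin n)) : X := u.foldl S.ins d

/-- Left insertion of a word, letter by letter from right to left. -/
def insL (S : StringData n X) (u : List (Fin n)) (d : X) : X := u.foldr (fun x e => S.ins e x) d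

/-- Right constructor. -/
def consR (S : StringData n X) (u : List (Fin n)) : X := S.insR S.empty u

/-- Left constructor. -/
def consL (S : StringData n X) (u : List (Fin n)) : X := S.insL u S.empty

/-- The conditions common to right and left string data structures. -/
structure IsBase (S : StringData n X) : Prop where
  empty_mem : S.empty ∈ S.carrier
  ins_mem : ∀ d ∈ S.carrier, ∀ x, S.ins d x ∈ S.carrier
  read_ins_empty : ∀ x, S.read (S.ins S.empty x) = [x]
  read_inj : Set.InjOn S.read S.carrier
  read_empty : S.read S.empty = []

/-- (Associative) right string data structures. -/
structure IsRight (S : StringData n X) : Prop extends IsBase S where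
  cons_read : ∀ d ∈ S.carrier, S.consR (S.read d) = d
  assoc : ∀ d ∈ S.carrier, ∀ d' ∈ S.carrier, ∀ d'' ∈ S.carrier,
    S.insR (S.insR d (S.read d')) (S.read d'') = S.insR d (S.read (S.insR d' (S.read d'')))

/-- (Associative) left string data structures. -/
structure IsLeft (S : StringData n X) : Prop extends IsBase S where
  cons_read : ∀ d ∈ S.carrier, S.consL (S.read d) = d
  assoc : ∀ d ∈ S.carrier, ∀ d' ∈ S.carrier, ∀ d'' ∈ S.carrier,
    S.insL (S.read d'') (S.insL (S.read d') d) = S.insL (S.read (S.insL (S.read d'') d')) d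

/-- `f` is a morphism of right string data structures from `S` to `S'`. -/
structure IsRightMorphism (S : StringData n X) (S' : StringData n Y) (f : X → Y) : Prop where
  source : S.IsRight
  target : S'.IsRight
  mapsTo : Set.MapsTo f S.carrier S'.carrier
  map_empty : f S.empty = S'.empty
  map_ins : ∀ d ∈ S.carrier, ∀ x, f (S.ins d x) = S'.ins (f d) x
  cons_read : ∀ d ∈ S.carrier, S'.consR (S.read d) = S'.consR (S'.read (f d))

/-- `f` is a morphism of left string data structures from `S` to `S'`. -/
structure IsLeftMorphism (S : StringData n X) (S' : StringData n Y) (f : X → Y) : Prop where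
  source : S.IsLeft
  target : S'.IsLeft
  mapsTo : Set.MapsTo f S.carrier S'.carrier
  map_empty : f S.empty = S'.empty
  map_ins : ∀ d ∈ S.carrier, ∀ x, f (S.ins d x) = S'.ins (f d) x
  cons_read : ∀ d ∈ S.carrier, S'.consL (S.read d) = S'.consL (S'.read (f d))

end StringData

/-! ## Diagonal skew tableaux and Young tableaux as string data structures -/

section Insertions

variable {n : ℕ}

/-- Top concatenation of `x` to the last of the columns `cs`. -/
def topConcat (cs : List (List (Fin n))) (x : Fin n) : List (List (Fin n)) :=
  match cs with
  | [] => [[x]]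
  | [c] => if ∀ y ∈ c.head?, y ≤ x then [c, [x]] else [x :: c]
  | c :: c' :: cs => c :: topConcat (c' :: cs) x

/-- Bottom concatenation of `x` to the first of the columns `cs`. -/
def bottomConcat (cs : List (List (Fin n))) (x : Fin n) : List (List (Fin n)) :=
  match cs with
  | [] => [[x]]
  | c :: cs => if ∀ y ∈ c.getLast?, y < x then (c ++ [x]) :: cs else [x] :: c :: cs

/-- Insertion of `x` in a line (a row or a column): `x` replaces the first `y` with `r x y`, and `y`
is bumped; if there is no such `y`, then `x` is added at the end. For a row take `r` to be `<`, for a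
column take `r` to be `≤`. -/
def lineInsert (r : Fin n → Fin n → Prop) [DecidableRel r] :
    List (Fin n) → Fin n → List (Fin n) × Option (Fin n)
  | [], x => ([x], none)
  | y :: l, x => if r x y then (x :: l, some y) else
      (y :: (lineInsert r l x).1, (lineInsert r l x).2)

/-- Schensted's insertion in a tableau given by its lines: the bumped element is inserted in the next
line. -/
def schensted (r : Fin n → Fin n → Prop) [DecidableRel r] :
    List (List (Fin n)) → Fin n → List (List (Fin n))
  | [], x => [[x]]
  | l :: ls, x => (lineInsert r l x).1 ::
      (match (lineInsert r l x).2 with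
        | none => ls
        | some y => schensted r ls y)

/-- Passage between the list of columns and the list of rows of a Young tableau. -/
def transpose (ls : List (List (Fin n))) : List (List (Fin n)) :=
  (List.range ((ls.map List.length).foldr max 0)).map (fun i => ls.filterMap (fun l => l[i]?))

end Insertions

/-- Right string data structure of diagonal skew tableaux, by top concatenation. -/
def DSKrow (n : ℕ) : StringData n (ColString n) where
  carrier := DSkew n
  empty := ColString.empty
  ins w x := ofCols glueS (topConcat w.cols x)
  read := ColString.read

/-- Left string data structure of diagonal skew tableaux, by bottom concatenation. -/
def DSKcol (n : ℕ) : StringData n (ColString n) where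
  carrier := DSkew n
  empty := ColString.empty
  ins w x := ofCols glueS (bottomConcat w.cols x)
  read := ColString.read

/-- Right string data structure of Young tableaux, by Schensted's right (row) insertion. -/
def Yrow (n : ℕ) : StringData n (ColString n) where
  carrier := Young n
  empty := ColString.empty
  ins t x := ofCols glueY (transpose (schensted (· < ·) (transpose t.cols) x))
  read := ColString.read

/-- Left string data structure of Young tableaux, by Schensted's left (column) insertion. -/
def Ycol (n : ℕ) : StringData n (ColString n) where
  carrier := Young n
  empty := ColString.empty
  ins t x := ofCols glueY (schensted (· ≤ ·) t.cols x)
  read := ColString.read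

/-! ## Crystals -/

/-- Operators `e_i`, `f_i` (the value `none` stands for `0`) and the weight map of a crystal. The
index set `[n - 1]` is represented by `Fin (n - 1)`. -/
structure Crystal (n : ℕ) (X : Type*) where
  e : Fin (n - 1) → X → Option X
  f : Fin (n - 1) → X → Option X
  wt : X → Fin n → ℕ

namespace Crystal

variable {n : ℕ} {X : Type*}

/-- The vertex set of the connected component of `u` in the crystal graph, which has an arrow
labelled `i` from `v` to `v'` iff `f_i v = v'`. -/
def component (C : Crystal n X) (u : X) : Set X :=
  {v | Relation.EqvGen (fun a b => ∃ i, C.f i a = some b) u v}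

/-- `ψ` is (on the component of `u`) a crystal isomorphism from the component of `u` onto the
component of `u'`. -/
structure IsIso (C : Crystal n X) (u u' : X) (ψ : X → X) : Prop where
  bijOn : Set.BijOn ψ (C.component u) (C.component u')
  wt_eq : ∀ v ∈ C.component u, C.wt (ψ v) = C.wt v
  arrow : ∀ v ∈ C.component u, ∀ v' ∈ C.component u, ∀ i,
    C.f i v = some v' → C.f i (ψ v) = some (ψ v')

end Crystal

/-- Delete the symbols `0` and then the subwords `-+` from a word in `+`, `-`, `0`, whose symbols carry
their original positions, until a word of the form `+ ⋯ + - ⋯ -` is obtained. -/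
def cancel : List (SignType × ℕ) → List (SignType × ℕ)
  | [] => []
  | (SignType.zero, _) :: l => cancel l
  | (SignType.pos, p) :: l => (SignType.pos, p) :: cancel l
  | (SignType.neg, p) :: l =>
      match cancel l with
      | (SignType.pos, _) :: l' => l'
      | l' => (SignType.neg, p) :: l'

/-- Original position of the rightmost `+` that is left after the cancellation. -/
def rightmostPlus (s : List SignType) : Option ℕ :=
  (((cancel s.zipIdx).filter (fun a => decide (a.1 = SignType.pos))).getLast?).map Prod.snd

/-- Original position of the leftmost `-` that is left after the cancellation. -/
def leftmostMinus (s : List SignType) : Option ℕ :=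
  (((cancel s.zipIdx).filter (fun a => decide (a.1 = SignType.neg))).head?).map Prod.snd

section Kashiwara

variable {n : ℕ}

/-- The letter `i` of `[n]`, for `i ∈ [n - 1]`. -/
def lo (i : Fin (n - 1)) : Fin n := ⟨i.1, by omega⟩

/-- The letter `i + 1` of `[n]`, for `i ∈ [n - 1]`. -/
def hi (i : Fin (n - 1)) : Fin n := ⟨i.1 + 1, by omega⟩

/-- The symbol of a letter. -/
def letterSign (i : Fin (n - 1)) (x : Fin n) : SignType :=
  if x = lo i then SignType.pos else if x = hi i then SignType.neg else SignType.zero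

/-- The symbol of a column. -/
def colSign (i : Fin (n - 1)) (c : List (Fin n)) : SignType :=
  if lo i ∈ c ∧ hi i ∉ c then SignType.pos
  else if hi i ∈ c ∧ lo i ∉ c then SignType.neg else SignType.zero

end Kashiwara

/-- The Kashiwara crystal structure of type A on words. -/
def wordCrystal (n : ℕ) : Crystal n (List (Fin n)) where
  e i w := (leftmostMinus (w.map (letterSign i))).map (fun p => w.set p (lo i))
  f i w := (rightmostPlus (w.map (letterSign i))).map (fun p => w.set p (hi i))
  wt w x := w.count x

/-- The Kashiwara crystal structure of type A on strings of columns. -/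
def colCrystal (n : ℕ) : Crystal n (ColString n) where
  e i w := (leftmostMinus (w.cols.map (colSign i))).map (fun p =>
    ⟨w.cols.modify p (List.map (fun x => if x = hi i then lo i else x)), w.glue⟩)
  f i w := (rightmostPlus (w.cols.map (colSign i))).map (fun p =>
    ⟨w.cols.modify p (List.map (fun x => if x = lo i then hi i else x)), w.glue⟩)
  wt w x := w.read.count x

end JeuDeTaquin

open JeuDeTaquin

/-!
The statement reduces to one fact: every Knuth class of words contains the reading of exactly one
Young tableau. Everything is therefore computed in the plactic monoid, where `pl w` denotes the
class of the word `w` (Knuth equivalence is defined here by its generating relations).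

*Existence.* An elementary slide of the jeu de taquin does not change the class of the column
reading. This is clear for a vertical slide; for a horizontal slide only two adjacent columns matter,
and the claim becomes the identity `pl_horizontal`: the part of the left column above the slide can
be moved across the right column, and then the sliding box can be moved past the part of its own
column below it. Slides terminate, so a skew tableau has a rectification (`exists_isRectification`),
and each rectification is Knuth equivalent to it (`IsRectification.pl_read`). Cutting a word into a diagonal skew tableau shows that
its class contains the reading of a Young tableau.

*Uniqueness.* The Kashiwara operators respect Knuth equivalence (`Knuth.sameCrystal`): this holds for
the generating relations by inspection, and for products by the tensor product rule. The reading map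
commutes with the operators (`CArrow.read`), and the operators preserve Young tableaux
(`CArrow.young_iff`). Applying operators `e_i` to two Knuth equivalent Young tableaux makes them of
highest weight. Then row `k` consists of letters `k` only (`isInitial_of_highest`), so the two
tableaux are determined by their common weight (`young_unique`).

*String data structures.* Row and column insertion of a letter `x` multiply the class of the reading
by `x` on the right and on the left. For the row insertion this requires that the row reading and the
column reading of a Young tableau are Knuth equivalent (`pl_rowRead_transpose`). By uniqueness, the
axioms of string data structures and the compatibility of the rectification with insertions follow
from the corresponding identities in the plactic monoid.

*Crystals.* The rectification commutes with the Kashiwara operators, and arrows lift along it. What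
remains is its injectivity on a connected component, that is, that two Knuth equivalent words of one
component are equal (`SameComponent.eq_of_knuth`). Operators `e_i` reduce this to words of highest
weight, of which a component contains only one (`SameComponent.eq_of_highest`), by induction on the
length of the words.
-/

namespace JeuDeTaquin

/-! ### The plactic monoid -/

section Plactic

variable {α : Type*} [LinearOrder α]

/-- Knuth equivalence of words: the congruence generated by `xzy ∼ zxy` for `x ≤ y < z` and
`yxz ∼ yzx` for `x < y ≤ z`. -/
inductive Knuth : List α → List α → Prop
  | left {x y z : α} : x ≤ y → y < z → Knuth [x, z, y] [z, x, y]
  | right {x y z : α} : x < y → y ≤ z → Knuth [y, x, z] [y, z, x]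
  | refl (u : List α) : Knuth u u
  | symm {u v : List α} : Knuth u v → Knuth v u
  | trans {u v w : List α} : Knuth u v → Knuth v w → Knuth u w
  | append {u u' v v' : List α} : Knuth u u' → Knuth v v' → Knuth (u ++ v) (u' ++ v')

/-- Knuth equivalence as a congruence on the free monoid. -/
def placticCon (α : Type*) [LinearOrder α] : Con (FreeMonoid α) where
  r u v := Knuth u.toList v.toList
  iseqv := ⟨fun _ => .refl _, fun h => h.symm, fun h h' => h.trans h'⟩
  mul' h h' := by simpa only [FreeMonoid.toList_mul] using h.append h'

/-- The class of a word in the plactic monoid. -/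
def pl (w : List α) : (placticCon α).Quotient := ((FreeMonoid.ofList w : FreeMonoid α) : _)

theorem pl_eq_iff {u v : List α} : pl u = pl v ↔ Knuth u v :=
  Con.eq (placticCon α)

@[simp] theorem pl_nil : pl ([] : List α) = 1 := rfl

@[simp] theorem pl_append (u v : List α) : pl (u ++ v) = pl u * pl v := rfl

/-- The class of a one-letter word is the generator `lt x` of the plactic monoid. -/
def lt (x : α) : (placticCon α).Quotient := pl [x]

theorem pl_cons (x : α) (v : List α) : pl (x :: v) = lt x * pl v := rfl

theorem lt_left {x y z : α} (h : x ≤ y) (h' : y < z) :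
    lt x * (lt z * lt y) = lt z * (lt x * lt y) :=
  pl_eq_iff.2 (Knuth.left h h')

theorem lt_right {x y z : α} (h : x < y) (h' : y ≤ z) :
    lt y * (lt x * lt z) = lt y * (lt z * lt x) :=
  pl_eq_iff.2 (Knuth.right h h')

theorem Knuth.perm {u v : List α} (h : Knuth u v) : u.Perm v := by
  induction h with
  | left => exact .swap _ _ _
  | right => exact .cons _ (.swap _ _ _)
  | refl => exact .refl _
  | symm _ ih => exact ih.symm
  | trans _ _ ih ih' => exact ih.trans ih'
  | append _ _ ih ih' => exact ih.append ih'

/-- A small letter moves to the left through a weakly increasing row, up to its first box. -/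
theorem pl_row_lt {b c : α} {r : List α} (hr : (b :: r).Pairwise (· ≤ ·)) (hc : c < b) :
    lt b * (pl r * lt c) = lt b * (lt c * pl r) := by
  induction r generalizing b with
  | nil => simp
  | cons a r ih =>
    simp only [List.pairwise_cons, List.mem_cons] at hr
    have hba : b ≤ a := hr.1 a (.inl rfl)
    have h1 := ih (b := a) (by simpa using hr.2) (hc.trans_le hba)
    have h2 := lt_right hc hba
    simp only [pl_cons, mul_assoc, h1]
    rw [← mul_assoc (lt a), ← mul_assoc (lt b), ← h2]
    simp only [mul_assoc]

/-- A decreasing word moves to the left through a row. -/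
theorem pl_row_column {b : α} {r u : List α} (hr : (b :: r).Pairwise (· ≤ ·))
    (hu : (b :: u).Pairwise (· > ·)) : lt b * (pl r * pl u) = lt b * (pl u * pl r) := by
  induction u generalizing b with
  | nil => simp
  | cons c u ih =>
    simp only [List.pairwise_cons, List.mem_cons] at hr hu
    have hcb : c < b := hu.1 c (.inl rfl)
    have h1 := pl_row_lt (b := b) (c := c) (by simpa using hr) hcb
    have h2 := ih (b := c) (List.pairwise_cons.2 ⟨fun a ha => hcb.le.trans (hr.1 a ha), hr.2⟩)
      (List.pairwise_cons.2 hu.2)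
    simp only [pl_cons]
    grind

/-- A letter `x` on the left of a column with top box `g ≥ x` moves up through the column until it
stands just before `g`; the boxes of the column are read from bottom to top. -/
theorem pl_column_lt {x g : α} {r : List α} (hr : (r ++ [g]).Pairwise (· > ·)) (hx : x ≤ g) :
    lt x * (pl r * lt g) = pl r * (lt x * lt g) := by
  induction r with
  | nil => simp
  | cons a r ih =>
    simp only [List.cons_append, List.pairwise_cons, List.mem_append, List.mem_singleton] at hr
    have h1 := ih hr.2
    simp only [pl_cons]
    cases r with
    | nil => simpa using lt_left hx (hr.1 g (.inr rfl))
    | cons c r =>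
      have hc : g < c := by
        have := hr.2
        simp only [List.cons_append, List.pairwise_cons] at this
        exact this.1 g (by simp)
      have h2 := lt_left (x := x) (y := c) (z := a) (hx.trans hc.le) (hr.1 c (by simp))
      simp only [pl_cons] at h1 ⊢
      grind

end Plactic

/-! ### Comparison of adjacent lines -/

section Dominance

variable {α : Type*}

/-- `Dom r l l'`: the line `l'` is at most as long as `l`, and its entries are related to the
entries of `l` at the same positions. -/
def Dom (r : α → α → Prop) : List α → List α → Prop
  | _, [] => True
  | [], _ :: _ => False
  | a :: l, b :: l' => r a b ∧ Dom r l l'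

@[simp] theorem dom_nil (r : α → α → Prop) (l : List α) : Dom r l [] := by
  cases l <;> trivial

@[simp] theorem not_dom_nil_cons (r : α → α → Prop) (b : α) (l' : List α) :
    ¬ Dom r [] (b :: l') := id

@[simp] theorem dom_cons (r : α → α → Prop) (a b : α) (l l' : List α) :
    Dom r (a :: l) (b :: l') ↔ r a b ∧ Dom r l l' := Iff.rfl

theorem dom_iff {r : α → α → Prop} {l l' : List α} :
    Dom r l l' ↔
      l'.length ≤ l.length ∧ ∀ (i : ℕ) (a b : α), l[i]? = some a → l'[i]? = some b → r a b := by
  induction l' generalizing l with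
  | nil => simp
  | cons b l' ih =>
    cases l with
    | nil => simp
    | cons a l =>
      rw [dom_cons, ih]
      constructor
      · rintro ⟨h1, h2, h3⟩
        refine ⟨by simpa using h2, fun i => ?_⟩
        cases i with
        | zero => simpa using h1
        | succ i => simpa using h3 i
      · rintro ⟨h1, h2⟩
        exact ⟨h2 0 a b rfl rfl, by simpa using h1, fun i a b h h' =>
          h2 (i + 1) a b (by simpa using h) (by simpa using h')⟩

theorem Dom.length_le {r : α → α → Prop} {l l' : List α} (h : Dom r l l') :
    l'.length ≤ l.length := (dom_iff.1 h).1

/-- Dominance persists when the dominating line is shifted by one new entry. -/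
theorem Dom.cons_left {r s : α → α → Prop} (hrs : ∀ a b c, s a b → r b c → r a c) {g : α}
    {l l' : List α} (h : Dom r l l') (hg : (g :: l).Pairwise s) : Dom r (g :: l) l' := by
  induction l' generalizing g l with
  | nil => simp
  | cons b l' ih =>
    cases l with
    | nil => simp at h
    | cons a l =>
      rw [List.pairwise_cons] at hg
      exact ⟨hrs g a b (hg.1 a (by simp)) h.1, ih h.2 hg.2⟩

theorem Dom.append_right {r s : α → α → Prop} (hrs : ∀ a b c, s a b → r b c → r a c)
    {m l l' : List α} (h : Dom r l l') (hg : (m ++ l).Pairwise s) : Dom r (m ++ l) l' := by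
  induction m with
  | nil => simpa
  | cons a m ih => exact (ih (List.pairwise_cons.1 hg).2).cons_left hrs hg

end Dominance

/-! ### Two adjacent columns in the plactic monoid -/

section Columns

variable {α : Type*} [LinearOrder α]

/-- A large letter moves to the left through a column, up to its bottom box. -/
theorem pl_column_le {b x : α} {u : List α} (hu : (b :: u).Pairwise (· > ·)) (hx : b ≤ x) :
    lt b * (pl u * lt x) = lt b * (lt x * pl u) := by
  induction u generalizing b with
  | nil => simp
  | cons c u ih =>
    simp only [List.pairwise_cons, List.mem_cons] at hu
    have hcb : c < b := hu.1 c (.inl rfl)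
    have h1 := ih (b := c) (by simpa using hu.2) (hcb.le.trans hx)
    have h2 := lt_right hcb hx
    simp only [pl_cons]
    grind

/-- Let `u`, `x :: v` be two columns, read from bottom to top, such that `u` is dominated by `v`.
Then the bottom box `x` of the second column can be moved to the bottom of the first one. -/
theorem pl_upper_cons {x : α} {u v : List α} (hu : u.Pairwise (· > ·))
    (hv : (x :: v).Pairwise (· > ·)) (h : Dom (· ≥ ·) v u) :
    pl u * (lt x * pl v) = lt x * (pl u * pl v) := by
  induction u generalizing x v with
  | nil => simp
  | cons b u ih =>
    cases v with
    | nil => simp at h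
    | cons d v =>
      have hbd : b ≤ d := h.1
      have hv' := List.pairwise_cons.1 hv
      have hdx : d < x := hv'.1 d (by simp)
      have h1 := pl_column_le hu (hbd.trans hdx.le)
      have h2 := ih (List.pairwise_cons.1 hu).2 hv'.2 h.2
      have h3 := lt_left hbd hdx
      simp only [pl_cons]
      grind

theorem pl_upper_append {u w v : List α} (hu : u.Pairwise (· > ·))
    (hv : (w ++ v).Pairwise (· > ·)) (h : Dom (· ≥ ·) v u) :
    pl u * (pl w * pl v) = pl w * (pl u * pl v) := by
  induction w with
  | nil => simp
  | cons g w ih =>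
    have hv' : (w ++ v).Pairwise (· > ·) := (List.pairwise_cons.1 hv).2
    have h1 := pl_upper_cons (v := w ++ v) hu hv
      (h.append_right (fun a b c (hab : b < a) (hbc : c ≤ b) => hbc.trans hab.le) hv')
    have h2 := ih hv'
    simp only [pl_append, pl_cons] at h1 ⊢
    grind

/-- Let `A`, `x :: G` be two columns, read from top to bottom, such that `G` dominates an initial
part of `A`. Then the top box `x` of the second column can be moved to the top of the first one. -/
theorem pl_lower_cons {x : α} {A G : List α} (hA : (x :: A).Pairwise (· < ·))
    (hG : G.Pairwise (· < ·)) (h : Dom (· ≤ ·) A G) :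
    pl A.reverse * (pl G.reverse * lt x) = pl A.reverse * (lt x * pl G.reverse) := by
  induction A generalizing x G with
  | nil => cases G with
    | nil => simp
    | cons => simp at h
  | cons a A ih =>
    cases G with
    | nil => simp
    | cons g G =>
      have hA' := List.pairwise_cons.1 hA
      have hG' := List.pairwise_cons.1 hG
      have hxa : x < a := hA'.1 a (by simp)
      have hag : a ≤ g := h.1
      have h1 := ih hA'.2 hG'.2 h.2
      have h2 := lt_right hxa hag
      have h3 := pl_column_lt (x := x) (g := g) (r := G.reverse)
        (by rw [← List.reverse_cons, List.pairwise_reverse]; exact hG) (hxa.le.trans hag)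
      simp only [List.reverse_cons, pl_append]
      change _ * lt a * (_ * lt g * _) = _ * lt a * (_ * (_ * lt g))
      grind

/-- A horizontal elementary sliding preserves the class of the column reading: `A` and `G` are the
parts of the two columns below the row of the slide, `u` and `v` those above it. -/
theorem pl_horizontal {x : α} {A G u v : List α} (hA : (x :: A).Pairwise (· < ·))
    (hu : u.Pairwise (· > ·)) (hG : (G.reverse ++ x :: v).Pairwise (· > ·))
    (h : Dom (· ≤ ·) A G) (h' : Dom (· ≥ ·) v u) :
    pl (A.reverse ++ u ++ (G.reverse ++ x :: v)) = pl (A.reverse ++ x :: u ++ (G.reverse ++ v)) := by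
  have hG' := List.pairwise_append.1 hG
  have h1 := pl_upper_append (w := G.reverse ++ [x]) hu (by simpa using hG) h'
  have h2 := pl_lower_cons hA (List.pairwise_reverse.1 hG'.1) h
  have h3 := pl_upper_append (w := G.reverse) hu (hG.sublist (by simp)) h'
  simp only [pl_append, pl_cons, pl_nil, mul_one] at h1 ⊢
  grind

end Columns

/-! ### Schensted's insertion in the plactic monoid -/

section Insertion

variable {n : ℕ}

theorem lineInsert_mem {r : Fin n → Fin n → Prop} [DecidableRel r] {l : List (Fin n)} {x y : Fin n}
    (h : (lineInsert r l x).2 = some y) : y ∈ l ∧ r x y := by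
  induction l with
  | nil => simp [lineInsert] at h
  | cons a l ih =>
    by_cases hxa : r x a
    · simp_all [lineInsert]
    · simp only [lineInsert, hxa, if_false] at h
      have := ih h
      simp [this]

theorem mem_lineInsert {r : Fin n → Fin n → Prop} [DecidableRel r] {l : List (Fin n)} {x y : Fin n}
    (h : y ∈ (lineInsert r l x).1) : y = x ∨ y ∈ l := by
  induction l with
  | nil => simpa [lineInsert] using h
  | cons a l ih =>
    by_cases hxa : r x a
    · simp only [lineInsert, hxa, if_true, List.mem_cons] at h ⊢
      tauto
    · simp only [lineInsert, hxa, if_false, List.mem_cons] at h ⊢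
      tauto

theorem lineInsert_ne_nil {r : Fin n → Fin n → Prop} [DecidableRel r] {l : List (Fin n)}
    {x : Fin n} : (lineInsert r l x).1 ≠ [] := by
  cases l with
  | nil => simp [lineInsert]
  | cons a l => by_cases hxa : r x a <;> simp [lineInsert, hxa]

/-- Schensted insertion of a letter in a row, in the plactic monoid. -/
theorem pl_rowInsert {l : List (Fin n)} (hl : l.Pairwise (· ≤ ·)) (x : Fin n) :
    pl l * lt x = pl (lineInsert (· < ·) l x).2.toList * pl (lineInsert (· < ·) l x).1 := by
  induction l with
  | nil => simp [lineInsert, lt]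
  | cons a l ih =>
    by_cases hxa : x < a
    · have := pl_row_lt hl hxa
      simp [lineInsert, hxa, pl_cons, mul_assoc, this]
    · have hl' := List.pairwise_cons.1 hl
      have h1 := ih hl'.2
      rw [pl_cons, mul_assoc, h1]
      simp only [lineInsert, hxa, if_false]
      cases ho : (lineInsert (· < ·) l x).2 with
      | none => simp [pl_cons]
      | some y =>
        obtain ⟨hy, hxy⟩ := lineInsert_mem ho
        cases hl2 : (lineInsert (· < ·) l x).1 with
        | nil => exact absurd hl2 lineInsert_ne_nil
        | cons h t =>
          have hay : a ≤ h := by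
            rcases mem_lineInsert (r := (· < ·)) (l := l) (x := x) (y := h) (by simp [hl2])
              with rfl | hm
            · exact not_lt.1 hxa
            · exact hl'.1 h hm
          have hhy : h < y := by
            cases l with
            | nil => simp at hy
            | cons b l =>
              by_cases hxb : x < b
              · simp [lineInsert, hxb] at hl2 ho
                rw [← hl2.1, ← ho]; exact hxb
              · simp [lineInsert, hxb] at hl2
                rw [← hl2.1]; exact (not_lt.1 hxb).trans_lt hxy
          have := lt_left hay hhy
          simp only [Option.toList, pl_cons, pl_nil, mul_one]
          grind

/-- Schensted insertion of a letter in a column, in the plactic monoid. -/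
theorem pl_colInsert {l : List (Fin n)} (hl : l.Pairwise (· < ·)) (x : Fin n) :
    lt x * pl l.reverse =
      pl (lineInsert (· ≤ ·) l x).1.reverse * pl (lineInsert (· ≤ ·) l x).2.toList := by
  induction l with
  | nil => simp [lineInsert, lt]
  | cons a l ih =>
    by_cases hxa : x ≤ a
    · have := pl_column_lt (x := x) (g := a) (r := l.reverse)
        (by rw [← List.reverse_cons, List.pairwise_reverse]; exact hl) hxa
      simp only [lineInsert, hxa, if_true, List.reverse_cons, pl_append, Option.toList, mul_assoc]
      exact this
    · have hl' := List.pairwise_cons.1 hl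
      have h1 := ih hl'.2
      rw [List.reverse_cons, pl_append, ← mul_assoc, h1]
      simp only [lineInsert, hxa, if_false]
      cases ho : (lineInsert (· ≤ ·) l x).2 with
      | none => simp
      | some y =>
        obtain ⟨hy, hxy⟩ := lineInsert_mem ho
        cases hl2 : (lineInsert (· ≤ ·) l x).1 with
        | nil => exact absurd hl2 lineInsert_ne_nil
        | cons h t =>
          have hay : a < h := by
            rcases mem_lineInsert (r := (· ≤ ·)) (l := l) (x := x) (y := h) (by simp [hl2])
              with rfl | hm
            · exact not_le.1 hxa
            · exact hl'.1 h hm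
          have hhy : h ≤ y := by
            cases l with
            | nil => simp at hy
            | cons b l =>
              by_cases hxb : x ≤ b
              · simp [lineInsert, hxb] at hl2 ho
                rw [← hl2.1, ← ho]; exact hxb
              · simp [lineInsert, hxb] at hl2
                rw [← hl2.1]; exact (not_le.1 hxb).le.trans hxy
          have := lt_right hay hhy
          simp only [Option.toList, List.reverse_cons, pl_append]
          change _ * lt h * lt y * lt a = _ * lt h * lt a * lt y
          grind

/-- Tableaux given by their lines: for `r = (≤)` the lines are the columns, which strictly increase,
and for `r = (<)` they are the rows, which weakly increase. Consecutive lines are compared entry by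
entry by means of `r`. -/
def Tab (r : Fin n → Fin n → Prop) (ls : List (List (Fin n))) : Prop :=
  (∀ l ∈ ls, l ≠ [] ∧ l.Pairwise (fun a b => ¬ r b a)) ∧ ls.IsChain (Dom r)

variable {r : Fin n → Fin n → Prop}

@[simp] theorem tab_nil : Tab r [] := by simp [Tab]

theorem tab_cons {l : List (Fin n)} {ls : List (List (Fin n))} :
    Tab r (l :: ls) ↔
      (l ≠ [] ∧ l.Pairwise (fun a b => ¬ r b a)) ∧ (∀ l' ∈ ls.head?, Dom r l l') ∧ Tab r ls := by
  simp only [Tab, List.isChain_cons, List.mem_cons, forall_eq_or_imp]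
  tauto

/-- The properties shared by the strict and the weak order which make Schensted's insertion work. -/
structure Comparison (r : Fin n → Fin n → Prop) : Prop where
  trans : ∀ a b c, r a b → r b c → r a c
  cotrans : ∀ a b c, r a c → r a b ∨ r b c

theorem comparison_lt : Comparison (n := n) (· < ·) :=
  ⟨fun _ _ _ h h' => h.trans h', fun a b c h => by
    rcases lt_or_ge a b with h1 | h1
    · exact .inl h1
    · exact .inr (h1.trans_lt h)⟩

theorem comparison_le : Comparison (n := n) (· ≤ ·) :=
  ⟨fun _ _ _ h h' => h.trans h', fun a b c h => by
    rcases le_or_gt a b with h1 | h1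
    · exact .inl h1
    · exact .inr (h1.le.trans h)⟩

theorem Dom.lineInsert_left [DecidableRel r] (hr : Comparison r)
    {l l' : List (Fin n)} (h : Dom r l l') (x : Fin n) :
    Dom r (lineInsert r l x).1 l' := by
  induction l generalizing l' with
  | nil => cases l' with
    | nil => simp
    | cons => simp at h
  | cons a l ih =>
    cases l' with
    | nil => simp
    | cons b l' =>
      by_cases hxa : r x a
      · simpa [lineInsert, hxa, h.2] using hr.trans _ _ _ hxa h.1
      · simpa [lineInsert, hxa, h.1] using ih h.2

/-- The bumped letter is inserted in the next line weakly before the place that it left. -/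
theorem Dom.lineInsert_bump [DecidableRel r] (hr : Comparison r)
    {l l' : List (Fin n)} (h : Dom r l l') {x y : Fin n}
    (hy : (lineInsert r l x).2 = some y) :
    Dom r (lineInsert r l x).1 (lineInsert r l' y).1 := by
  induction l generalizing l' with
  | nil => simp [lineInsert] at hy
  | cons a l ih =>
    by_cases hxa : r x a
    · simp only [lineInsert, hxa, if_true, Option.some.injEq] at hy ⊢
      subst hy
      cases l' with
      | nil => simpa [lineInsert] using hxa
      | cons b l' => simpa [lineInsert, h.1, hxa] using h.2
    · simp only [lineInsert, hxa, if_false] at hy ⊢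
      have hay : r a y := ((hr.cotrans x a y (lineInsert_mem hy).2).resolve_left hxa)
      cases l' with
      | nil => simpa [lineInsert] using hay
      | cons b l' =>
        by_cases hyb : r y b
        · simpa [lineInsert, hyb, hay] using h.2.lineInsert_left hr x
        · simpa [lineInsert, hyb, h.1] using ih h.2 hy

theorem lineInsert_pairwise [DecidableRel r] (hr : Comparison r)
    {l : List (Fin n)} (h : l.Pairwise (fun a b => ¬ r b a)) (x : Fin n) :
    (lineInsert r l x).1.Pairwise (fun a b => ¬ r b a) := by
  induction l with
  | nil => simp [lineInsert]
  | cons a l ih =>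
    rw [List.pairwise_cons] at h
    by_cases hxa : r x a
    · simp only [lineInsert, hxa, if_true, List.pairwise_cons]
      exact ⟨fun b hb hbx => h.1 b hb (hr.trans _ _ _ hbx hxa), h.2⟩
    · simp only [lineInsert, hxa, if_false, List.pairwise_cons]
      refine ⟨fun b hb => ?_, ih h.2⟩
      rcases mem_lineInsert hb with rfl | hb
      · exact hxa
      · exact h.1 b hb

theorem Tab.schensted [DecidableRel r] (hr : Comparison r)
    {ls : List (List (Fin n))} (h : Tab r ls) (x : Fin n) :
    Tab r (schensted r ls x) := by
  induction ls generalizing x with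
  | nil => simp [JeuDeTaquin.schensted, Tab]
  | cons l ls ih =>
    rw [tab_cons] at h
    obtain ⟨⟨h1, h2⟩, h3, h4⟩ := h
    rw [JeuDeTaquin.schensted, tab_cons]
    refine ⟨⟨lineInsert_ne_nil, lineInsert_pairwise hr h2 x⟩, ?_⟩
    cases ho : (lineInsert r l x).2 with
    | none => exact ⟨fun l' hl' => (h3 l' hl').lineInsert_left hr x, h4⟩
    | some y =>
      refine ⟨fun l' hl' => ?_, ih h4 y⟩
      cases ls with
      | nil =>
        have := (dom_nil r l).lineInsert_bump hr ho
        simp only [JeuDeTaquin.schensted, List.head?_cons, Option.mem_some_iff] at hl'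
        subst hl'
        simpa [lineInsert] using this
      | cons l2 ls =>
        simp only [JeuDeTaquin.schensted, List.head?_cons, Option.mem_some_iff] at hl'
        subst hl'
        exact (h3 l2 rfl).lineInsert_bump hr ho

/-- The reading of a list of columns, from left to right and each from bottom to top. -/
def colRead (cs : List (List (Fin n))) : List (Fin n) := (cs.map List.reverse).flatten

/-- The reading of a list of rows, from bottom to top and each from left to right. -/
def rowRead (rs : List (List (Fin n))) : List (Fin n) := rs.reverse.flatten

@[simp] theorem colRead_nil : colRead ([] : List (List (Fin n))) = [] := rfl

@[simp] theorem colRead_cons (c : List (Fin n)) (cs : List (List (Fin n))) :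
    colRead (c :: cs) = c.reverse ++ colRead cs := rfl

@[simp] theorem rowRead_nil : rowRead ([] : List (List (Fin n))) = [] := rfl

@[simp] theorem rowRead_cons (c : List (Fin n)) (cs : List (List (Fin n))) :
    rowRead (c :: cs) = rowRead cs ++ c := by simp [rowRead]

theorem pl_colRead_schensted {cs : List (List (Fin n))} (h : Tab (· ≤ ·) cs) (x : Fin n) :
    pl (colRead (schensted (· ≤ ·) cs x)) = lt x * pl (colRead cs) := by
  induction cs generalizing x with
  | nil => rfl
  | cons c cs ih =>
    rw [tab_cons] at h
    have h1 := pl_colInsert (h.1.2.imp (fun hab => not_le.1 hab)) x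
    rw [schensted, colRead_cons, colRead_cons, pl_append, pl_append, ← mul_assoc (lt x), h1]
    cases ho : (lineInsert (· ≤ ·) c x).2 with
    | none => simp
    | some y => simp only [ih h.2.2 y, mul_assoc]; rfl

theorem pl_rowRead_schensted {rs : List (List (Fin n))} (h : Tab (· < ·) rs) (x : Fin n) :
    pl (rowRead (schensted (· < ·) rs x)) = pl (rowRead rs) * lt x := by
  induction rs generalizing x with
  | nil => simp [schensted, lt]
  | cons c cs ih =>
    rw [tab_cons] at h
    have h1 := pl_rowInsert (h.1.2.imp (fun hab => not_lt.1 hab)) x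
    rw [schensted, rowRead_cons, rowRead_cons, pl_append, pl_append, mul_assoc _ _ (lt x), h1]
    cases ho : (lineInsert (· < ·) c x).2 with
    | none => simp
    | some y => simp only [ih h.2.2 y, mul_assoc]; rfl

/-! ### Transposition of tableaux -/

/-- Adds a new first column `c` to the tableau with rows `rs`. -/
def addCol : List (Fin n) → List (List (Fin n)) → List (List (Fin n))
  | [], _ => []
  | a :: c, [] => [a] :: addCol c []
  | a :: c, l :: rs => (a :: l) :: addCol c rs

theorem addCol_getElem? (l : List (Fin n)) (rs : List (List (Fin n))) (i : ℕ) :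
    (addCol l rs)[i]? = l[i]?.map (fun a => a :: rs.getD i []) := by
  induction l generalizing rs i with
  | nil => simp [addCol]
  | cons a l ih => cases rs <;> cases i <;> simp [addCol, ih]

/-- The length of the longest line. -/
def maxLength (ls : List (List (Fin n))) : ℕ := (ls.map List.length).foldr max 0

theorem transpose_getElem? (ls : List (List (Fin n))) (i : ℕ) :
    (transpose ls)[i]? =
      if i < maxLength ls then some (ls.filterMap (fun l => l[i]?)) else none := by
  by_cases h : i < maxLength ls
  · rw [if_pos h, transpose, List.getElem?_map]
    exact congrArg _ (List.getElem?_range h)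
  · rw [if_neg h, transpose, List.getElem?_eq_none]; simpa [maxLength] using h

theorem le_maxLength {ls : List (List (Fin n))} {l : List (Fin n)} (h : l ∈ ls) :
    l.length ≤ maxLength ls := by
  induction ls with
  | nil => simp at h
  | cons a ls ih =>
    simp only [maxLength, List.map_cons, List.foldr_cons, le_sup_iff]
    rcases List.mem_cons.1 h with rfl | h
    · exact .inl le_rfl
    · exact .inr (ih h)

theorem transpose_cons {l : List (Fin n)} {ls : List (List (Fin n))}
    (h : maxLength ls ≤ l.length) : transpose (l :: ls) = addCol l (transpose ls) := by
  have hm : maxLength (l :: ls) = l.length := by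
    simpa [maxLength] using h
  refine List.ext_getElem? fun i => ?_
  rw [transpose_getElem?, addCol_getElem?, hm]
  by_cases hi : i < l.length
  · simp only [hi, if_true, List.getElem?_eq_getElem hi, List.filterMap_cons, Option.map_some,
      Option.some.injEq, List.cons.injEq, true_and, List.getD_eq_getElem?_getD, transpose_getElem?]
    split_ifs with h2
    · rfl
    · rw [Option.getD_none, List.filterMap_eq_nil_iff]
      intro l' hl'
      exact List.getElem?_eq_none (by have := le_maxLength hl'; omega)
  · simp [hi]

theorem filterMap_addCol_zero (c : List (Fin n)) (rs : List (List (Fin n))) :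
    (addCol c rs).filterMap (fun l => l[0]?) = c := by
  induction c generalizing rs with
  | nil => rfl
  | cons a c ih => cases rs <;> simp [addCol, ih]

theorem filterMap_addCol_succ {c : List (Fin n)} {rs : List (List (Fin n))} (i : ℕ)
    (h : rs.length ≤ c.length) :
    (addCol c rs).filterMap (fun l => l[i + 1]?) = rs.filterMap (fun l => l[i]?) := by
  induction c generalizing rs with
  | nil => cases rs with
    | nil => rfl
    | cons => simp at h
  | cons a c ih => cases rs with
    | nil => simpa [addCol] using ih (rs := []) (by simp)
    | cons l rs =>
      simp only [addCol, List.filterMap_cons, List.getElem?_cons_succ,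
        ih (rs := rs) (by simpa using h)]

theorem maxLength_addCol {c : List (Fin n)} {rs : List (List (Fin n))} (hc : c ≠ [])
    (h : rs.length ≤ c.length) : maxLength (addCol c rs) = maxLength rs + 1 := by
  induction c generalizing rs with
  | nil => simp at hc
  | cons a c ih =>
    by_cases hc' : c = []
    · subst hc'
      rcases rs with _ | ⟨l, _ | ⟨l', rs⟩⟩
      · simp [addCol, maxLength]
      · simp [addCol, maxLength]
      · simp at h
    · cases rs with
      | nil =>
        have := ih (rs := []) hc' (by simp)
        simp only [maxLength, addCol, List.map_cons, List.foldr_cons] at this ⊢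
        rw [this]; simp
      | cons l rs =>
        have := ih (rs := rs) hc' (by simpa using h)
        simp only [maxLength, addCol, List.map_cons, List.foldr_cons] at this ⊢
        rw [this]; simp [Nat.add_max_add_right]

theorem transpose_addCol {c : List (Fin n)} {rs : List (List (Fin n))} (hc : c ≠ [])
    (h : rs.length ≤ c.length) : transpose (addCol c rs) = c :: transpose rs := by
  refine List.ext_getElem? fun i => ?_
  rw [transpose_getElem?, maxLength_addCol hc h]
  cases i with
  | zero => simp [filterMap_addCol_zero]
  | succ i => simp [filterMap_addCol_succ i h, transpose_getElem?]

theorem transpose_length (ls : List (List (Fin n))) : (transpose ls).length = maxLength ls := by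
  simp [transpose, maxLength]

theorem Tab.maxLength_le {l : List (Fin n)} {ls : List (List (Fin n))} (h : Tab r (l :: ls)) :
    maxLength ls ≤ l.length := by
  induction ls generalizing l with
  | nil => simp [maxLength]
  | cons l' ls ih =>
    have h1 := tab_cons.1 h
    have h2 := (h1.2.1 l' rfl).length_le
    have h3 := ih h1.2.2
    simp only [maxLength, List.map_cons, List.foldr_cons, sup_le_iff] at h3 ⊢
    exact ⟨h2, h3.trans h2⟩

theorem Tab.transpose_cons {l : List (Fin n)} {ls : List (List (Fin n))} (h : Tab r (l :: ls)) :
    transpose (l :: ls) = addCol l (transpose ls) :=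
  JeuDeTaquin.transpose_cons h.maxLength_le

theorem Tab.transpose_transpose {ls : List (List (Fin n))} (h : Tab r ls) :
    transpose (transpose ls) = ls := by
  induction ls with
  | nil => rfl
  | cons l ls ih =>
    have h1 := tab_cons.1 h
    rw [h.transpose_cons, transpose_addCol h1.1.1 (by rw [transpose_length]; exact h.maxLength_le),
      ih h1.2.2]

/-- Adding a column `c` that fits to the left of a tableau with rows `rs` gives a tableau. Here `s`,
which is `<` for rows if `r` is `≤` for columns and conversely, compares the lines after the
transposition. -/
theorem Tab.addCol {s : Fin n → Fin n → Prop} (hr : Comparison r) (hs : ∀ a b, s a b ↔ ¬ r b a)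
    {c : List (Fin n)} {rs : List (List (Fin n))} (hc : c.Pairwise s) (h : Tab s rs)
    (hcr : Dom r c (rs.filterMap (fun l => l[0]?))) : Tab s (addCol c rs) := by
  induction c generalizing rs with
  | nil => simp [JeuDeTaquin.addCol]
  | cons a c ih =>
    rw [List.pairwise_cons] at hc
    cases rs with
    | nil =>
      rw [JeuDeTaquin.addCol, tab_cons]
      refine ⟨by simp, fun l' hl' => ?_, ih hc.2 h (by simp)⟩
      cases c with
      | nil => simp [JeuDeTaquin.addCol] at hl'
      | cons b c =>
        simp only [JeuDeTaquin.addCol, List.head?_cons, Option.mem_some_iff] at hl'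
        subst hl'
        simpa using hc.1 b (by simp)
    | cons l rs =>
      rw [tab_cons] at h
      obtain ⟨⟨h1, h2⟩, h3, h4⟩ := h
      obtain ⟨b, l, rfl⟩ := List.exists_cons_of_ne_nil h1
      simp only [List.filterMap_cons, List.getElem?_cons_zero, dom_cons] at hcr
      rw [JeuDeTaquin.addCol, tab_cons]
      refine ⟨⟨by simp, ?_⟩, fun l' hl' => ?_, ih hc.2 h4 hcr.2⟩
      · refine List.pairwise_cons.2 ⟨fun d hd => ?_, h2⟩
        rw [hs, not_not]
        rcases List.mem_cons.1 hd with rfl | hd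
        · exact hcr.1
        · have := (List.pairwise_cons.1 h2).1 d hd
          rw [hs, not_not] at this
          exact hr.trans _ _ _ hcr.1 this
      · cases c with
        | nil => simp [JeuDeTaquin.addCol] at hl'
        | cons a' c =>
          have haa : s a a' := hc.1 a' (by simp)
          cases rs with
          | nil =>
            simp only [JeuDeTaquin.addCol, List.head?_cons, Option.mem_some_iff] at hl'
            subst hl'
            simpa using haa
          | cons l2 rs =>
            simp only [JeuDeTaquin.addCol, List.head?_cons, Option.mem_some_iff] at hl'
            subst hl'
            exact ⟨haa, h3 l2 rfl⟩

theorem Tab.transpose {s : Fin n → Fin n → Prop} (hr : Comparison r) (hs : ∀ a b, s a b ↔ ¬ r b a)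
    {ls : List (List (Fin n))} (h : Tab r ls) : Tab s (transpose ls) := by
  induction ls with
  | nil => exact tab_nil
  | cons l ls ih =>
    have h1 := tab_cons.1 h
    rw [h.transpose_cons]
    refine Tab.addCol hr hs (h1.1.2.imp (fun hab => (hs _ _).2 hab)) (ih h1.2.2) ?_
    cases ls with
    | nil => exact dom_nil r l
    | cons l' ls =>
      rw [h1.2.2.transpose_cons, filterMap_addCol_zero]
      exact h1.2.1 l' rfl

/-- A decreasing word moves to the left through the rows of a tableau, if the tableau is preceded by
a column that fits to its left. -/
theorem pl_column_rowRead {c u : List (Fin n)} {rs : List (List (Fin n))}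
    (h : Tab (· < ·) (addCol c rs)) (hl : rs.length ≤ c.length)
    (hu : (c.reverse ++ u).Pairwise (· > ·)) :
    pl c.reverse * (pl (rowRead rs) * pl u) = pl c.reverse * (pl u * pl (rowRead rs)) := by
  induction c generalizing rs u with
  | nil => cases rs with
    | nil => simp
    | cons => simp at hl
  | cons b c ih =>
    cases rs with
    | nil => simp
    | cons l rs =>
      rw [addCol, tab_cons] at h
      have hl' : rs.length ≤ c.length := by simpa using hl
      have hu' : (c.reverse ++ b :: u).Pairwise (· > ·) := by simpa using hu
      have h1 := ih h.2.2 hl' (u := [b]) (hu'.sublist (by simp))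
      have h2 := ih h.2.2 hl' hu'
      have h3 := pl_row_column (h.1.2.imp (fun hab => not_lt.1 hab))
        (List.pairwise_append.1 hu').2.1
      simp only [pl_cons, pl_nil, mul_one, List.reverse_cons, pl_append, rowRead_cons]
        at h1 h2 h3 ⊢
      grind

/-- The boxes of the first column `c` of a tableau can be moved in front of the row reading of the
other columns. -/
theorem pl_rowRead_addCol {c : List (Fin n)} {rs : List (List (Fin n))}
    (h : Tab (· < ·) (addCol c rs)) (hl : rs.length ≤ c.length) (hc : c.Pairwise (· < ·)) :
    pl (rowRead (addCol c rs)) = pl c.reverse * pl (rowRead rs) := by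
  induction c generalizing rs with
  | nil => cases rs with
    | nil => simp [addCol]
    | cons => simp at hl
  | cons b c ih =>
    have hc' := List.pairwise_cons.1 hc
    cases rs with
    | nil =>
      rw [addCol, tab_cons] at h
      have h1 := ih h.2.2 (by simp) hc'.2
      simp [addCol, pl_cons, h1]
    | cons l rs =>
      rw [addCol, tab_cons] at h
      have hl' : rs.length ≤ c.length := by simpa using hl
      have h1 := ih h.2.2 hl' hc'.2
      have h2 := pl_column_rowRead h.2.2 hl' (u := [b])
        (by rw [← List.reverse_cons, List.pairwise_reverse]; exact hc)
      simp only [addCol, pl_cons, pl_nil, mul_one, List.reverse_cons, pl_append, rowRead_cons, h1]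
        at h2 ⊢
      grind

/-- The row reading and the column reading of a Young tableau are Knuth equivalent. -/
theorem pl_rowRead_transpose {cs : List (List (Fin n))} (h : Tab (· ≤ ·) cs) :
    pl (rowRead (transpose cs)) = pl (colRead cs) := by
  induction cs with
  | nil => rfl
  | cons c cs ih =>
    have h1 := tab_cons.1 h
    have h2 : Tab (· < ·) (transpose (c :: cs)) :=
      h.transpose comparison_le (fun _ _ => not_le.symm)
    rw [h.transpose_cons] at h2 ⊢
    rw [pl_rowRead_addCol h2 (by rw [transpose_length]; exact h.maxLength_le)
      (h1.1.2.imp fun hab => not_le.1 hab), ih h1.2.2, colRead_cons, pl_append]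

end Insertion

/-! ### Criteria for string data structures -/

section Criteria

variable {n : ℕ} {X Y M : Type*} [Monoid M]

namespace StringData

/-- Insertion of a word is right multiplication, if insertion of a letter is so. -/
theorem map_insR {S : StringData n X} {φ : List (Fin n) → M} (h1 : φ [] = 1)
    (h2 : ∀ u v, φ (u ++ v) = φ u * φ v) (hmem : ∀ d ∈ S.carrier, ∀ x, S.ins d x ∈ S.carrier)
    (hins : ∀ d ∈ S.carrier, ∀ x, φ (S.read (S.ins d x)) = φ (S.read d) * φ [x])
    {d : X} (hd : d ∈ S.carrier) (u : List (Fin n)) :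
    S.insR d u ∈ S.carrier ∧ φ (S.read (S.insR d u)) = φ (S.read d) * φ u := by
  induction u generalizing d with
  | nil => simp [insR, hd, h1]
  | cons x u ih =>
    obtain ⟨h3, h4⟩ := ih (hmem d hd x)
    refine ⟨h3, h4.trans ?_⟩
    rw [hins d hd, mul_assoc, ← h2, List.singleton_append]

/-- Insertion of a word is left multiplication, if insertion of a letter is so. -/
theorem map_insL {S : StringData n X} {φ : List (Fin n) → M} (h1 : φ [] = 1)
    (h2 : ∀ u v, φ (u ++ v) = φ u * φ v) (hmem : ∀ d ∈ S.carrier, ∀ x, S.ins d x ∈ S.carrier)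
    (hins : ∀ d ∈ S.carrier, ∀ x, φ (S.read (S.ins d x)) = φ [x] * φ (S.read d))
    {d : X} (hd : d ∈ S.carrier) (u : List (Fin n)) :
    S.insL u d ∈ S.carrier ∧ φ (S.read (S.insL u d)) = φ u * φ (S.read d) := by
  induction u with
  | nil => simp [insL, hd, h1]
  | cons x u ih =>
    refine ⟨hmem _ ih.1 x, (hins _ ih.1 x).trans ?_⟩
    rw [ih.2, ← mul_assoc, ← h2, List.singleton_append]

/-- A data structure in which insertion of a letter is multiplication in a monoid `M`, and whose
elements are determined by the values of their readings in `M`, is an associative right string data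
structure. -/
theorem isRight_of_monoid {S : StringData n X} (φ : List (Fin n) → M) (h1 : φ [] = 1)
    (h2 : ∀ u v, φ (u ++ v) = φ u * φ v) (h0 : S.empty ∈ S.carrier) (hr : S.read S.empty = [])
    (hx : ∀ x, S.read (S.ins S.empty x) = [x])
    (hmem : ∀ d ∈ S.carrier, ∀ x, S.ins d x ∈ S.carrier)
    (hins : ∀ d ∈ S.carrier, ∀ x, φ (S.read (S.ins d x)) = φ (S.read d) * φ [x])
    (hinj : ∀ d ∈ S.carrier, ∀ d' ∈ S.carrier, φ (S.read d) = φ (S.read d') → d = d') :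
    S.IsRight where
  empty_mem := h0
  ins_mem := hmem
  read_ins_empty := hx
  read_inj d hd d' hd' h := hinj d hd d' hd' (congrArg φ h)
  read_empty := hr
  cons_read d hd := by
    obtain ⟨h3, h4⟩ := map_insR h1 h2 hmem hins h0 (S.read d)
    exact hinj _ h3 _ hd (h4.trans (by rw [hr, h1, one_mul]))
  assoc d hd d' hd' d'' hd'' := by
    have key : ∀ {d}, d ∈ S.carrier → ∀ u, _ := fun hd u => map_insR h1 h2 hmem hins hd u
    have h3 := key hd (S.read d')
    have h4 := key h3.1 (S.read d'')
    have h5 := key hd' (S.read d'')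
    have h6 := key hd (S.read (S.insR d' (S.read d'')))
    exact hinj _ h4.1 _ h6.1 (by rw [h4.2, h3.2, h6.2, h5.2, mul_assoc])

/-- The analogue of `isRight_of_monoid` for left string data structures. -/
theorem isLeft_of_monoid {S : StringData n X} (φ : List (Fin n) → M) (h1 : φ [] = 1)
    (h2 : ∀ u v, φ (u ++ v) = φ u * φ v) (h0 : S.empty ∈ S.carrier) (hr : S.read S.empty = [])
    (hx : ∀ x, S.read (S.ins S.empty x) = [x])
    (hmem : ∀ d ∈ S.carrier, ∀ x, S.ins d x ∈ S.carrier)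
    (hins : ∀ d ∈ S.carrier, ∀ x, φ (S.read (S.ins d x)) = φ [x] * φ (S.read d))
    (hinj : ∀ d ∈ S.carrier, ∀ d' ∈ S.carrier, φ (S.read d) = φ (S.read d') → d = d') :
    S.IsLeft where
  empty_mem := h0
  ins_mem := hmem
  read_ins_empty := hx
  read_inj d hd d' hd' h := hinj d hd d' hd' (congrArg φ h)
  read_empty := hr
  cons_read d hd := by
    obtain ⟨h3, h4⟩ := map_insL h1 h2 hmem hins h0 (S.read d)
    exact hinj _ h3 _ hd (h4.trans (by rw [hr, h1, mul_one]))
  assoc d hd d' hd' d'' hd'' := by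
    have key : ∀ {d}, d ∈ S.carrier → ∀ u, _ := fun hd u => map_insL h1 h2 hmem hins hd u
    have h3 := key hd (S.read d')
    have h4 := key h3.1 (S.read d'')
    have h5 := key hd' (S.read d'')
    have h6 := key hd (S.read (S.insL (S.read d'') d'))
    exact hinj _ h4.1 _ h6.1 (by rw [h4.2, h3.2, h6.2, h5.2, mul_assoc])

end StringData

end Criteria

/-! ### Strings of columns determined by their columns -/

section Carriers

variable {n : ℕ}

open ColString

theorem ofCols_length (g : List (Fin n) → List (Fin n) → ℤ) (cs : List (List (Fin n))) :
    (ofCols g cs).glue.length = cs.length - 1 := by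
  simp [ofCols]

theorem ofCols_pos (g : List (Fin n) → List (Fin n) → ℤ) (cs : List (List (Fin n))) {k : ℕ}
    (hk : k + 1 < cs.length) :
    (ofCols g cs).pos k = g ((ofCols g cs).col k) ((ofCols g cs).col (k + 1)) := by
  have hk' : k < cs.length := by omega
  simp [ofCols, pos, col, List.getD_eq_getElem?_getD, List.getElem?_zipWith, hk, hk']

theorem eq_ofCols {g : List (Fin n) → List (Fin n) → ℤ} {w : ColString n}
    (h : w.glue.length = w.cols.length - 1)
    (h' : ∀ k, k + 1 < w.cols.length → w.pos k = g (w.col k) (w.col (k + 1))) :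
    w = ofCols g w.cols := by
  refine ColString.ext rfl (List.ext_getElem (by rw [h, ofCols_length]) fun k h1 h2 => ?_)
  have hk : k + 1 < w.cols.length := by omega
  have h3 := (h' k hk).trans (ofCols_pos g w.cols hk).symm
  simpa [pos, List.getD_eq_getElem?_getD, h1, h2] using h3

theorem col_eq_getElem (w : ColString n) {k : ℕ} (hk : k < w.cols.length) :
    w.col k = w.cols[k] := by
  simp [col, List.getD_eq_getElem?_getD, hk]

theorem read_eq_colRead (w : ColString n) : w.read = colRead w.cols := rfl

theorem young_iff {w : ColString n} :
    w ∈ Young n ↔ w = ofCols glueY w.cols ∧ Tab (· ≤ ·) w.cols := by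
  simp only [Young, Skew, Scol, Set.mem_ofPred_eq, Tab, not_le, List.isChain_iff_getElem]
  constructor
  · rintro ⟨⟨⟨h1, h2⟩, h3⟩, h4⟩
    refine ⟨eq_ofCols h2 h4, h1, fun k hk => ?_⟩
    obtain ⟨-, h5, -, h6⟩ := h3 k hk
    rw [h4 k hk] at h5 h6
    rw [col_eq_getElem _ hk, col_eq_getElem _ (by omega)] at h5 h6
    exact dom_iff.2 ⟨by exact_mod_cast h5, fun i a b => h6 i i a b (by simp)⟩
  · rintro ⟨h1, h2, h3⟩
    have h4 : ∀ k, k + 1 < w.cols.length → w.pos k = (w.col (k + 1)).length := by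
      intro k hk
      rw [h1]
      exact ofCols_pos glueY w.cols hk
    refine ⟨⟨⟨h2, by rw [h1]; exact ofCols_length _ _⟩, fun k hk => ?_⟩, h4⟩
    rw [h4 k hk, col_eq_getElem _ hk, col_eq_getElem _ (by omega)]
    obtain ⟨h5, h6⟩ := dom_iff.1 (h3 k hk)
    have h7 := List.length_pos_iff.2 (h2 _ (List.getElem_mem hk)).1
    refine ⟨by omega, by exact_mod_cast h5, le_rfl, fun j l x y hjl => ?_⟩
    obtain rfl : j = l := by omega
    exact h6 j x y

/-- The lists of columns of diagonal skew tableaux: the top box of each column is at most the bottom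
box of the next one, and these two boxes are the only ones that share a row. -/
def DiagCols (cs : List (List (Fin n))) : Prop :=
  (∀ c ∈ cs, c ≠ [] ∧ c.Pairwise (· < ·)) ∧
    cs.IsChain (fun c c' => ∀ x ∈ c.head?, ∀ y ∈ c'.getLast?, x ≤ y)

theorem diagCols_cons {c : List (Fin n)} {cs : List (List (Fin n))} :
    DiagCols (c :: cs) ↔ (c ≠ [] ∧ c.Pairwise (· < ·)) ∧
      (∀ c' ∈ cs.head?, ∀ x ∈ c.head?, ∀ y ∈ c'.getLast?, x ≤ y) ∧ DiagCols cs := by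
  simp only [DiagCols, List.isChain_cons, List.mem_cons, forall_eq_or_imp]
  tauto

theorem dskew_iff {w : ColString n} :
    w ∈ DSkew n ↔ w = ofCols glueS w.cols ∧ DiagCols w.cols := by
  simp only [DSkew, Skew, Scol, Set.mem_ofPred_eq, DiagCols, List.isChain_iff_getElem]
  constructor
  · rintro ⟨⟨⟨h1, h2⟩, h3⟩, h4⟩
    have h5 : ∀ k, k + 1 < w.cols.length → w.pos k = 1 := by
      intro k hk
      have hk' : k < w.glue.length := by omega
      rw [pos, List.getD_eq_getElem?_getD, List.getElem?_eq_getElem hk']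
      exact h4 _ (List.getElem_mem hk')
    refine ⟨eq_ofCols h2 h5, h1, fun k hk x hx y hy => ?_⟩
    obtain ⟨-, -, -, h6⟩ := h3 k hk
    have h7 := List.length_pos_iff.2 (h1 _ (List.getElem_mem hk)).1
    rw [h5 k hk, col_eq_getElem _ hk, col_eq_getElem _ (by omega)] at h6
    refine h6 0 (w.cols[k + 1].length - 1) x y (by omega) ?_ ?_
    · simpa [List.head?_eq_getElem?] using hx
    · simpa [List.getLast?_eq_getElem?] using hy
  · rintro ⟨h1, h2, h3⟩
    have h4 : ∀ k, k + 1 < w.cols.length → w.pos k = 1 := by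
      intro k hk
      rw [h1]
      exact ofCols_pos glueS w.cols hk
    refine ⟨⟨⟨h2, by rw [h1]; exact ofCols_length _ _⟩, fun k hk => ?_⟩, fun p hp => ?_⟩
    · rw [h4 k hk, col_eq_getElem _ hk, col_eq_getElem _ (by omega)]
      have h6 := List.length_pos_iff.2 (h2 _ (List.getElem_mem hk)).1
      have h7 := List.length_pos_iff.2 (h2 _ (List.getElem_mem (Nat.lt_of_succ_lt hk))).1
      refine ⟨le_rfl, by omega, by omega, fun j l x y hjl hx hy => ?_⟩
      have h8 := (List.getElem?_eq_some_iff.1 hy).1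
      obtain rfl : j = 0 := by omega
      obtain rfl : l = w.cols[k + 1].length - 1 := by omega
      exact h3 k hk x (by simpa [List.head?_eq_getElem?] using hx) y
        (by simpa [List.getLast?_eq_getElem?] using hy)
    · obtain ⟨k, hk, rfl⟩ := List.getElem_of_mem hp
      have hk' : k + 1 < w.cols.length := by
        have := ofCols_length glueS w.cols
        rw [← h1] at this
        omega
      rw [← h4 k hk']
      simp [pos, List.getD_eq_getElem?_getD, hk]

theorem ofCols_glueY_mem {cs : List (List (Fin n))} (h : Tab (· ≤ ·) cs) :
    ofCols glueY cs ∈ Young n := young_iff.2 ⟨rfl, h⟩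

theorem ofCols_glueS_mem {cs : List (List (Fin n))} (h : DiagCols cs) :
    ofCols glueS cs ∈ DSkew n := dskew_iff.2 ⟨rfl, h⟩

/-! ### Diagonal skew tableaux -/

/-- The columns of a diagonal skew tableau, read from bottom to top, are the maximal decreasing factors
of its reading. -/
theorem splitBy_colRead {cs : List (List (Fin n))} (h : DiagCols cs) :
    (colRead cs).splitBy (fun x y => decide (y < x)) = cs.map List.reverse := by
  refine List.splitBy_flatten ?_ ?_ ?_
  · intro hm
    obtain ⟨c, hc, hc'⟩ := List.mem_map.1 hm
    exact (h.1 c hc).1 (List.reverse_eq_nil_iff.1 hc')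
  · intro m hm
    obtain ⟨c, hc, rfl⟩ := List.mem_map.1 hm
    have := List.pairwise_reverse.2 (h.1 c hc).2
    simpa using this.isChain
  · have h2 := h.2
    rw [List.isChain_iff_getElem] at h2 ⊢
    intro k hk
    simp only [List.length_map] at hk
    have h3 := (h.1 _ (List.getElem_mem (Nat.lt_of_succ_lt hk))).1
    have h4 := (h.1 _ (List.getElem_mem hk)).1
    simp only [List.getElem_map, List.getLast_reverse, List.head_reverse, decide_eq_false_iff_not,
      not_lt]
    refine ⟨by simpa using h3, by simpa using h4, ?_⟩
    exact h2 k hk _ (List.head?_eq_some_head h3) _ (List.getLast?_eq_some_getLast h4)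

theorem diag_read {d : ColString n} (hd : d ∈ DSkew n) : diag d.read = d := by
  have h := dskew_iff.1 hd
  rw [diag, read_eq_colRead, splitBy_colRead h.2]
  simpa using h.1.symm

theorem read_diag (w : List (Fin n)) : (diag w).read = w := by
  simp [diag, ColString.read, ofCols]

theorem diag_mem (w : List (Fin n)) : diag w ∈ DSkew n := by
  refine ofCols_glueS_mem ⟨fun c hc => ?_, ?_⟩
  · obtain ⟨m, hm, rfl⟩ := List.mem_map.1 hc
    refine ⟨by simpa using List.ne_nil_of_mem_splitBy hm, List.pairwise_reverse.2 ?_⟩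
    have := List.isChain_of_mem_splitBy hm
    simp only [decide_eq_true_eq] at this
    exact List.isChain_iff_pairwise (R := fun a b : Fin n => b < a) |>.1 this
  · have h2 := List.isChain_getLast_head_splitBy (fun x y => decide (y < x)) w
    rw [List.isChain_iff_getElem] at h2 ⊢
    intro k hk x hx y hy
    simp only [List.length_map] at hk
    obtain ⟨h3, h4, h5⟩ := h2 k hk
    simp only [List.getElem_map, List.head?_reverse, List.getLast?_reverse] at hx hy
    rw [List.getLast?_eq_some_getLast h3] at hx
    rw [List.head?_eq_some_head h4] at hy
    simp only [Option.mem_some_iff] at hx hy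
    subst hx hy
    simpa using h5

theorem dskew_read_injOn : Set.InjOn ColString.read (DSkew n) := fun d hd d' hd' h => by
  rw [← diag_read hd, ← diag_read hd', h]

theorem colRead_topConcat (cs : List (List (Fin n))) (x : Fin n) :
    colRead (topConcat cs x) = colRead cs ++ [x] := by
  induction cs with
  | nil => rfl
  | cons c cs ih =>
    cases cs with
    | nil => rw [topConcat]; split_ifs <;> simp
    | cons c' cs => rw [topConcat, colRead_cons, ih, colRead_cons c, List.append_assoc]

theorem colRead_bottomConcat (cs : List (List (Fin n))) (x : Fin n) :
    colRead (bottomConcat cs x) = [x] ++ colRead cs := by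
  cases cs with
  | nil => rfl
  | cons c cs => rw [bottomConcat]; split_ifs <;> simp

/-- The first column of `topConcat` has the same bottom box as before. -/
theorem getLast?_head?_topConcat (c : List (Fin n)) (cs : List (List (Fin n))) (hc : c ≠ [])
    (x : Fin n) : ∀ c' ∈ (topConcat (c :: cs) x).head?, c'.getLast? = c.getLast? := by
  intro c' hc'
  cases cs with
  | nil =>
    rw [topConcat] at hc'
    split_ifs at hc' with h
    · simp only [List.head?_cons, Option.mem_some_iff] at hc'
      rw [hc']
    · simp only [List.head?_cons, Option.mem_some_iff] at hc'
      obtain ⟨y, c, rfl⟩ := List.exists_cons_of_ne_nil hc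
      rw [← hc', List.getLast?_cons_cons]
  | cons c2 cs =>
    rw [topConcat] at hc'
    simp only [List.head?_cons, Option.mem_some_iff] at hc'
    rw [hc']

theorem DiagCols.topConcat {cs : List (List (Fin n))} (h : DiagCols cs) (x : Fin n) :
    DiagCols (topConcat cs x) := by
  induction cs with
  | nil => simp [JeuDeTaquin.topConcat, DiagCols]
  | cons c cs ih =>
    have h1 := diagCols_cons.1 h
    cases cs with
    | nil =>
      rw [JeuDeTaquin.topConcat]
      split_ifs with hc
      · simp only [diagCols_cons]
        refine ⟨h1.1, fun c' hc' z hz y hy => ?_, by simp [DiagCols]⟩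
        simp only [List.head?_cons, Option.mem_some_iff] at hc'
        subst hc'
        simp only [List.getLast?_singleton, Option.mem_some_iff] at hy
        subst hy
        exact hc z hz
      · obtain ⟨y, c, rfl⟩ := List.exists_cons_of_ne_nil h1.1.1
        simp only [List.head?_cons, Option.mem_some_iff, forall_eq', not_le] at hc
        have h2 := List.pairwise_cons.1 h1.1.2
        rw [diagCols_cons]
        refine ⟨⟨by simp, List.pairwise_cons.2 ⟨fun z hz => ?_, h1.1.2⟩⟩, by simp,
          by simp [DiagCols]⟩
        rcases List.mem_cons.1 hz with rfl | hz
        · exact hc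
        · exact hc.trans (h2.1 z hz)
    | cons c2 cs =>
      rw [JeuDeTaquin.topConcat, diagCols_cons]
      refine ⟨h1.1, fun c' hc' z hz y hy => ?_, ih h1.2.2⟩
      rw [getLast?_head?_topConcat c2 cs (diagCols_cons.1 h1.2.2).1.1 x c' hc'] at hy
      exact h1.2.1 c2 rfl z hz y hy

theorem DiagCols.bottomConcat {cs : List (List (Fin n))} (h : DiagCols cs) (x : Fin n) :
    DiagCols (bottomConcat cs x) := by
  cases cs with
  | nil => simp [JeuDeTaquin.bottomConcat, DiagCols]
  | cons c cs =>
    have h1 := diagCols_cons.1 h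
    rw [JeuDeTaquin.bottomConcat]
    split_ifs with hc
    · rw [diagCols_cons]
      refine ⟨⟨by simp, ?_⟩, fun c' hc' z hz y hy => ?_, h1.2.2⟩
      · rw [List.pairwise_append]
        refine ⟨h1.1.2, by simp, fun a ha b hb => ?_⟩
        obtain rfl := List.mem_singleton.1 hb
        have h2 := hc _ (List.getLast?_eq_some_getLast h1.1.1)
        exact ((h1.1.2.imp le_of_lt).rel_getLast ha).trans_lt h2
      · rw [List.head?_append_of_ne_nil _ h1.1.1] at hz
        exact h1.2.1 c' hc' z hz y hy
    · rw [diagCols_cons]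
      refine ⟨by simp, fun c' hc' z hz y hy => ?_, h⟩
      simp only [List.head?_cons, Option.mem_some_iff] at hc' hz
      subst hc' hz
      push Not at hc
      obtain ⟨y', hy', hle⟩ := hc
      rw [Option.mem_def] at hy hy'
      rw [hy] at hy'
      exact (Option.some_injective _ hy') ▸ hle

theorem dskew_empty_mem : ColString.empty ∈ DSkew n :=
  ofCols_glueS_mem (cs := []) (by simp [DiagCols])

theorem young_empty_mem : ColString.empty ∈ Young n :=
  ofCols_glueY_mem (cs := []) tab_nil

theorem DSKrow_isRight : (DSKrow n).IsRight := by
  refine StringData.isRight_of_monoid (M := FreeMonoid (Fin n)) FreeMonoid.ofList rfl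
    (fun _ _ => rfl) dskew_empty_mem rfl (fun _ => rfl) (fun d hd x => ?_) (fun d hd x => ?_)
    (fun d hd d' hd' h => dskew_read_injOn hd hd' h)
  · exact ofCols_glueS_mem ((dskew_iff.1 hd).2.topConcat x)
  · exact congrArg FreeMonoid.ofList (colRead_topConcat d.cols x)

theorem DSKcol_isLeft : (DSKcol n).IsLeft := by
  refine StringData.isLeft_of_monoid (M := FreeMonoid (Fin n)) FreeMonoid.ofList rfl
    (fun _ _ => rfl) dskew_empty_mem rfl (fun _ => rfl) (fun d hd x => ?_) (fun d hd x => ?_)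
    (fun d hd d' hd' h => dskew_read_injOn hd hd' h)
  · exact ofCols_glueS_mem ((dskew_iff.1 hd).2.bottomConcat x)
  · exact congrArg FreeMonoid.ofList (colRead_bottomConcat d.cols x)

/-! ### Schensted's insertions -/

/-- Row insertion is right multiplication in the plactic monoid. -/
theorem Yrow_ins_mem {t : ColString n} (ht : t ∈ Young n) (x : Fin n) :
    (Yrow n).ins t x ∈ Young n ∧ pl ((Yrow n).ins t x).read = pl t.read * lt x := by
  have h := (young_iff.1 ht).2
  have h1 : Tab (· < ·) (transpose t.cols) := h.transpose comparison_le (fun _ _ => not_le.symm)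
  have h2 := h1.schensted comparison_lt x
  have h3 : Tab (· ≤ ·) (transpose (schensted (· < ·) (transpose t.cols) x)) :=
    h2.transpose comparison_lt (fun _ _ => not_lt.symm)
  refine ⟨ofCols_glueY_mem h3, ?_⟩
  have h4 := pl_rowRead_transpose h3
  rw [h2.transpose_transpose, pl_rowRead_schensted h1, pl_rowRead_transpose h] at h4
  exact h4.symm

/-- Column insertion is left multiplication in the plactic monoid. -/
theorem Ycol_ins_mem {t : ColString n} (ht : t ∈ Young n) (x : Fin n) :
    (Ycol n).ins t x ∈ Young n ∧ pl ((Ycol n).ins t x).read = lt x * pl t.read := by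
  have h := (young_iff.1 ht).2
  exact ⟨ofCols_glueY_mem (h.schensted comparison_le x), pl_colRead_schensted h x⟩

end Carriers

section Slides

variable {n : ℕ}

/-! ### Columns of fillings -/

section Lists

variable {α : Type*}

theorem range_eq_append {i M : ℕ} (h : i < M) :
    List.range M = List.range i ++ i :: List.range' (i + 1) (M - i - 1) := by
  obtain ⟨k, rfl⟩ := Nat.exists_eq_add_of_lt h
  rw [List.range_eq_range', List.range_eq_range', add_assoc, ← List.range'_append_1 (m := i),
    List.range'_succ]
  simp

theorem filterMap_range {f : ℕ → Option α} {i M : ℕ} (h : i < M) :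
    (List.range M).filterMap f = (List.range i).filterMap f ++
      ((f i).toList ++ (List.range' (i + 1) (M - i - 1)).filterMap f) := by
  rw [range_eq_append h, List.filterMap_append, List.filterMap_cons]
  cases f i <;> rfl

theorem filterMap_ifHeight (l : List α) {h M : ℕ} (hM : h + l.length ≤ M) :
    (List.range M).filterMap (fun i => if i < h then none else l[i - h]?) = l := by
  induction h generalizing M with
  | zero =>
    simp only [Nat.not_lt_zero, if_false, Nat.sub_zero]
    induction l generalizing M with
    | nil => simp
    | cons a l ih =>
      obtain ⟨M, rfl⟩ : ∃ m, M = m + 1 := ⟨M - 1, by simp at hM; omega⟩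
      have := ih (M := M) (by simp at hM; omega)
      rw [List.range_succ_eq_map, List.filterMap_cons, List.filterMap_map]
      simpa [Function.comp_def] using this
  | succ h ih =>
    obtain ⟨M, rfl⟩ : ∃ m, M = m + 1 := ⟨M - 1, by omega⟩
    have := ih (M := M) (by omega)
    rw [List.range_succ_eq_map, List.filterMap_cons, List.filterMap_map]
    simpa [Function.comp_def] using this

theorem filterMap_range_getElem? {f : ℕ → Option α} {m : ℕ} (h : ∀ i < m, (f i).isSome) :
    ((List.range m).filterMap f).length = m ∧
      ∀ i, ((List.range m).filterMap f)[i]? = if i < m then f i else none := by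
  induction m with
  | zero => simp
  | succ m ih =>
    obtain ⟨h1, h2⟩ := ih (fun i hi => h i (by omega))
    obtain ⟨x, hx⟩ := Option.isSome_iff_exists.1 (h m (by omega))
    rw [List.range_succ, List.filterMap_append]
    refine ⟨by simp [h1, hx], fun i => ?_⟩
    rcases lt_trichotomy i m with hi | rfl | hi
    · rw [List.getElem?_append_left (by omega), h2, if_pos hi, if_pos (by omega)]
    · rw [List.getElem?_append_right (by omega)]
      simp [h1, hx]
    · rw [List.getElem?_append_right (by omega), if_neg (by omega), List.getElem?_eq_none]
      simp [hx]
      omega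

variable [LinearOrder α]

theorem pairwise_filterMap_of_lt {f : ℕ → Option α}
    (hf : ∀ i i' x y, i < i' → f i = some x → f i' = some y → x < y) {l : List ℕ}
    (hl : l.Pairwise (· < ·)) : (l.filterMap f).Pairwise (· < ·) := by
  rw [List.pairwise_filterMap]
  exact hl.imp fun {i i'} hii x hx y hy => hf i i' x y hii hx hy

/-- Dominance of the parts of two adjacent columns from row `a` downwards, if each box of the right
column `g` has a left neighbour; `g` may begin below `f` or end above it. -/
theorem dom_filterMap_range' {f g : ℕ → Option α}
    (hf : ∀ i i' x y, i < i' → f i = some x → f i' = some y → x < y) {a : ℕ}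
    (h : ∀ i y, a ≤ i → g i = some y → ∃ x, f i = some x ∧ x ≤ y) (k : ℕ) :
    Dom (· ≤ ·) ((List.range' a k).filterMap f) ((List.range' a k).filterMap g) := by
  induction k generalizing a with
  | zero => simp
  | succ k ih =>
    have h1 := ih (a := a + 1) fun i y hi => h i y (by omega)
    have h2 := pairwise_filterMap_of_lt hf (List.pairwise_lt_range' (s := a) (n := k + 1))
    rw [List.range'_succ] at h2 ⊢
    rw [List.filterMap_cons] at h2
    rw [List.filterMap_cons, List.filterMap_cons]
    cases hg : g a with
    | none =>
      cases hfa : f a with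
      | none => exact h1
      | some x =>
        rw [hfa] at h2
        exact h1.cons_left (s := (· < ·))
          (fun a b c (hab : a < b) (hbc : b ≤ c) => hab.le.trans hbc) h2
    | some y =>
      obtain ⟨x, hx, hxy⟩ := h a y le_rfl hg
      rw [hx]
      exact ⟨hxy, h1⟩

/-- Dominance of the parts of two adjacent columns above row `m`, read from bottom to top, if each box
of the left column `f` has a right neighbour. -/
theorem dom_reverse_filterMap_range {f g : ℕ → Option α}
    (hg : ∀ i i' x y, i < i' → g i = some x → g i' = some y → x < y) {m : ℕ}
    (h : ∀ i x, i < m → f i = some x → ∃ y, g i = some y ∧ x ≤ y) :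
    Dom (· ≥ ·) ((List.range m).filterMap g).reverse ((List.range m).filterMap f).reverse := by
  induction m with
  | zero => simp
  | succ m ih =>
    have h1 := ih fun i x hi => h i x (by omega)
    have h2 := pairwise_filterMap_of_lt hg (List.pairwise_lt_range (n := m + 1))
    rw [← List.pairwise_reverse, List.range_succ, List.filterMap_append, List.reverse_append] at h2
    rw [List.range_succ, List.filterMap_append, List.filterMap_append, List.reverse_append,
      List.reverse_append]
    cases hf : f m with
    | none =>
      simpa [hf] using h1.append_right (s := (· > ·))
        (fun a b c (hab : b < a) (hbc : c ≤ b) => hbc.trans hab.le) h2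
    | some x =>
      obtain ⟨y, hy, hxy⟩ := h m x (by omega) hf
      simpa [hf, hy, hxy] using h1

end Lists

/-! ### Semistandard skew fillings with a hole -/

/-- `T` is a semistandard filling of the skew diagram whose boxes in column `j` are in the rows
`h j, …, g j - 1`, except that the boxes in `E` are empty. -/
structure SkewFill (h g : ℕ → ℕ) (E : Set (ℕ × ℕ)) (T : Filling n) : Prop where
  top : Antitone h
  bot : Antitone g
  top_le : ∀ j, h j ≤ g j
  zero : ∃ N, g N = 0
  isSome : ∀ i j, (T i j).isSome ↔ h j ≤ i ∧ i < g j ∧ (i, j) ∉ E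
  row : ∀ i j j' x y, j < j' → T i j = some x → T i j' = some y → x ≤ y
  col : ∀ i i' j x y, i < i' → T i j = some x → T i' j = some y → x < y

/-- `T` is a semistandard filling of a skew diagram with exactly one empty box `b`, the hole, which
lies in the diagram. -/
structure HoleFill (h g : ℕ → ℕ) (b : ℕ × ℕ) (T : Filling n) : Prop
    extends SkewFill h g {b} T where
  top_hole : h b.2 ≤ b.1
  hole_bot : b.1 < g b.2

variable {h g : ℕ → ℕ} {E : Set (ℕ × ℕ)} {T : Filling n}

theorem SkewFill.bounds (H : SkewFill h g E T) {i j : ℕ} {x : Fin n} (hx : T i j = some x) :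
    h j ≤ i ∧ i < g j ∧ (i, j) ∉ E := (H.isSome i j).1 (by simp [hx])

theorem SkewFill.exists_some (H : SkewFill h g E T) {i j : ℕ} (h1 : h j ≤ i) (h2 : i < g j)
    (h3 : (i, j) ∉ E) : ∃ x, T i j = some x :=
  Option.isSome_iff_exists.1 ((H.isSome i j).2 ⟨h1, h2, h3⟩)

theorem Filling.move_target (T : Filling n) (b a : ℕ × ℕ) : T.move b a a.1 a.2 = T b.1 b.2 := by
  simp [Filling.move]

theorem Filling.move_source (T : Filling n) {b a : ℕ × ℕ} (hab : b ≠ a) :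
    T.move b a b.1 b.2 = none := by
  simp [Filling.move, hab]

theorem Filling.move_of_ne (T : Filling n) {b a : ℕ × ℕ} {i j : ℕ} (ha : (i, j) ≠ a)
    (hb : (i, j) ≠ b) : T.move b a i j = T i j := by
  simp [Filling.move, ha, hb]

theorem SkewFill.move_isSome {b c : ℕ × ℕ} (H : SkewFill h g {b} T) (hb : h b.2 ≤ b.1)
    (hb' : b.1 < g b.2) {x : Fin n} (hc : T c.1 c.2 = some x) (i j : ℕ) :
    (T.move c b i j).isSome ↔ h j ≤ i ∧ i < g j ∧ (i, j) ∉ ({c} : Set (ℕ × ℕ)) := by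
  have hbc := (H.bounds hc).2.2
  by_cases h1 : (i, j) = b
  · subst h1
    rw [Filling.move_target T c (i, j), hc]
    simpa [hb, hb'] using fun h => hbc h.symm
  · by_cases h2 : (i, j) = c
    · subst h2
      rw [Filling.move_source T h1]
      simp
    · rw [Filling.move_of_ne T h1 h2, H.isSome]
      simp [h1, h2]

/-- A vertical elementary slide preserves semistandardness. -/
theorem HoleFill.move_up {i j : ℕ} (H : HoleFill h g (i, j) T) {x : Fin n}
    (hx : T (i + 1) j = some x) (hxy : ∀ y, T i (j + 1) = some y → x ≤ y) :
    HoleFill h g (i + 1, j) (T.move (i + 1, j) (i, j)) := by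
  have hb := H.top_hole
  have hb' := H.hole_bot
  obtain ⟨hc, hc', -⟩ := H.bounds hx
  simp only at hb hb'
  have key : ∀ i' j' y, T.move (i + 1, j) (i, j) i' j' = some y →
      (i' = i ∧ j' = j ∧ y = x) ∨ ((i', j') ≠ (i, j) ∧ (i', j') ≠ (i + 1, j) ∧ T i' j' = some y) := by
    intro i' j' y hy
    simp only [Filling.move] at hy
    split_ifs at hy with h1 h2
    · rw [hx] at hy
      simp only [Prod.mk.injEq] at h1
      exact .inl ⟨h1.1, h1.2, (Option.some_injective _ hy).symm⟩
    · exact .inr ⟨h1, h2, hy⟩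
  refine ⟨⟨H.top, H.bot, H.top_le, H.zero, H.move_isSome hb hb' hx, ?_, ?_⟩, hc, hc'⟩
  · intro i' j1 j2 y z hj hy hz
    rcases key _ _ _ hy with ⟨rfl, rfl, rfl⟩ | ⟨h1, h2, hy'⟩ <;>
      rcases key _ _ _ hz with ⟨h3, h4, rfl⟩ | ⟨h3, h4, hz'⟩
    · omega
    · -- the entry to the right of the hole exists
      obtain ⟨h5, h6, -⟩ := H.bounds hz'
      obtain ⟨w, hw⟩ := H.exists_some (i := i') (j := j1 + 1) ((H.top (by omega)).trans hb)
        (h6.trans_le (H.bot (by omega))) (by simp)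
      refine (hxy w hw).trans ?_
      rcases (show j1 + 1 = j2 ∨ j1 + 1 < j2 by omega) with rfl | h7
      · rw [hw] at hz'
        exact (Option.some_injective _ hz').le
      · exact H.row _ _ _ _ _ h7 hw hz'
    · -- the entry to the left of the hole is smaller than the one below it
      subst h3 h4
      obtain ⟨h5, h6, -⟩ := H.bounds hy'
      obtain ⟨w, hw⟩ := H.exists_some (i := i' + 1) (j := j1) (by omega)
        (hc'.trans_le (H.bot hj.le)) (by simp)
      exact (H.col _ _ _ _ _ (by omega) hy' hw).le.trans (H.row _ _ _ _ _ hj hw hx)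
    · exact H.row _ _ _ _ _ hj hy' hz'
  · intro i1 i2 j' y z hi hy hz
    rcases key _ _ _ hy with ⟨rfl, rfl, rfl⟩ | ⟨h1, h2, hy'⟩ <;>
      rcases key _ _ _ hz with ⟨h3, h4, rfl⟩ | ⟨h3, h4, hz'⟩
    · omega
    · have h5 : i2 ≠ i1 + 1 := fun h => h4 (by rw [h])
      exact H.col _ _ _ _ _ (by omega) hx hz'
    · subst h3 h4
      exact H.col _ _ _ _ _ (by omega) hy' hx
    · exact H.col _ _ _ _ _ hi hy' hz'

/-- A horizontal elementary slide preserves semistandardness. -/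
theorem HoleFill.move_left {i j : ℕ} (H : HoleFill h g (i, j) T) {x : Fin n}
    (hx : T i (j + 1) = some x) (hxy : ∀ y, T (i + 1) j = some y → x < y) :
    HoleFill h g (i, j + 1) (T.move (i, j + 1) (i, j)) := by
  have hb := H.top_hole
  have hb' := H.hole_bot
  obtain ⟨hc, hc', -⟩ := H.bounds hx
  simp only at hb hb'
  have key : ∀ i' j' y, T.move (i, j + 1) (i, j) i' j' = some y →
      (i' = i ∧ j' = j ∧ y = x) ∨ ((i', j') ≠ (i, j) ∧ (i', j') ≠ (i, j + 1) ∧ T i' j' = some y) := by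
    intro i' j' y hy
    simp only [Filling.move] at hy
    split_ifs at hy with h1 h2
    · rw [hx] at hy
      simp only [Prod.mk.injEq] at h1
      exact .inl ⟨h1.1, h1.2, (Option.some_injective _ hy).symm⟩
    · exact .inr ⟨h1, h2, hy⟩
  refine ⟨⟨H.top, H.bot, H.top_le, H.zero, H.move_isSome hb hb' hx, ?_, ?_⟩, hc, hc'⟩
  · intro i' j1 j2 y z hj hy hz
    rcases key _ _ _ hy with ⟨rfl, rfl, rfl⟩ | ⟨h1, h2, hy'⟩ <;>
      rcases key _ _ _ hz with ⟨h3, h4, rfl⟩ | ⟨h3, h4, hz'⟩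
    · omega
    · have h5 : j2 ≠ j1 + 1 := fun h => h4 (by rw [h])
      exact H.row _ _ _ _ _ (by omega) hx hz'
    · subst h3 h4
      exact H.row _ _ _ _ _ (by omega) hy' hx
    · exact H.row _ _ _ _ _ hj hy' hz'
  · intro i1 i2 j' y z hi hy hz
    rcases key _ _ _ hy with ⟨rfl, rfl, rfl⟩ | ⟨h1, h2, hy'⟩ <;>
      rcases key _ _ _ hz with ⟨h3, h4, rfl⟩ | ⟨h3, h4, hz'⟩
    · omega
    · -- the entry below the hole exists
      obtain ⟨h5, h6, -⟩ := H.bounds hz'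
      obtain ⟨w, hw⟩ := H.exists_some (i := i1 + 1) (j := j') (by omega) (by omega) (by simp)
      refine (hxy w hw).trans_le ?_
      rcases (show i1 + 1 = i2 ∨ i1 + 1 < i2 by omega) with rfl | h7
      · rw [hw] at hz'
        exact (Option.some_injective _ hz').le
      · exact (H.col _ _ _ _ _ h7 hw hz').le
    · -- the entry above the hole is at most the one to its right
      subst h3 h4
      obtain ⟨h5, h6, -⟩ := H.bounds hy'
      obtain ⟨w, hw⟩ := H.exists_some (i := i1) (j := j' + 1) ((H.top (by omega)).trans h5)
        (by omega) (by simp)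
      exact (H.row _ _ _ _ _ (by omega) hy' hw).trans_lt (H.col _ _ _ _ _ hi hw hx)
    · exact H.col _ _ _ _ _ hi hy' hz'

/-- The column reading of a filling whose boxes lie in the first `M` rows and `N` columns. -/
def fillRead (T : Filling n) (M N : ℕ) : List (Fin n) :=
  (List.range N).flatMap fun j => ((List.range M).filterMap fun i => T i j).reverse

theorem fillRead_move_up {i j M N : ℕ} (hM : i + 1 < M) (h0 : T i j = none) :
    fillRead (T.move (i + 1, j) (i, j)) M N = fillRead T M N := by
  have key : ∀ j', (List.range M).filterMap (fun i' => T.move (i + 1, j) (i, j) i' j') =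
      (List.range M).filterMap fun i' => T i' j' := by
    intro j'
    by_cases hj : j' = j
    · subst hj
      obtain ⟨k, hk⟩ : ∃ k, M - i - 1 = k + 1 := ⟨M - i - 2, by omega⟩
      rw [filterMap_range (f := fun i' => T i' j') (i := i) (by omega),
        filterMap_range (f := fun i' => T.move (i + 1, j') (i, j') i' j') (i := i) (by omega), hk,
        List.range'_succ, List.filterMap_cons, List.filterMap_cons,
        Filling.move_target T (i + 1, j') (i, j'),
        Filling.move_source T (a := (i, j')) (b := (i + 1, j')) (by simp), h0]
      have h1 : (List.range i).filterMap (fun i' => T.move (i + 1, j') (i, j') i' j') =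
          (List.range i).filterMap fun i' => T i' j' :=
        List.filterMap_congr fun i' hi' => by
          have := List.mem_range.1 hi'
          exact Filling.move_of_ne T (by simp; omega) (by simp; omega)
      have h2 : (List.range' (i + 1 + 1) k).filterMap
          (fun i' => T.move (i + 1, j') (i, j') i' j') =
          (List.range' (i + 1 + 1) k).filterMap fun i' => T i' j' :=
        List.filterMap_congr fun i' hi' => by
          have := (List.mem_range'_1.1 hi').1
          exact Filling.move_of_ne T (by simp; omega) (by simp; omega)
      rw [h1, h2]
      cases hT : T (i + 1) j' <;> simp
    · exact List.filterMap_congr fun i' _ => Filling.move_of_ne T (by simp [hj]) (by simp [hj])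
  simp only [fillRead, key]

/-- A horizontal elementary slide preserves the class of the column reading: only the columns `j` and
`j + 1` change, to which `pl_horizontal` applies. -/
theorem HoleFill.pl_fillRead_move_left {i j M N : ℕ} (H : HoleFill h g (i, j) T) {x : Fin n}
    (hx : T i (j + 1) = some x) (hxy : ∀ y, T (i + 1) j = some y → x < y) (hM : i < M)
    (hN : j + 1 < N) :
    pl (fillRead (T.move (i, j + 1) (i, j)) M N) = pl (fillRead T M N) := by
  have H' := H.move_left hx hxy
  set S := T.move (i, j + 1) (i, j) with hS
  have hSx : S i j = some x := by rw [hS, ← hx]; exact Filling.move_target T (i, j + 1) (i, j)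
  have hS0 : S i (j + 1) = none := Filling.move_source T (b := (i, j + 1)) (a := (i, j)) (by simp)
  have hT0 : T i j = none := by
    rw [← Option.not_isSome_iff_eq_none, H.isSome]; simp
  have hST : ∀ i' j', i' ≠ i ∨ (j' ≠ j ∧ j' ≠ j + 1) → S i' j' = T i' j' := by
    intro i' j' h'
    exact Filling.move_of_ne T (by simp; omega) (by simp; omega)
  have hlt : ∀ j', (List.range i).filterMap (fun i' => S i' j') =
      (List.range i).filterMap fun i' => T i' j' := fun j' =>
    List.filterMap_congr fun i' hi' => hST _ _ (.inl (by have := List.mem_range.1 hi'; omega))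
  have hgt : ∀ j', (List.range' (i + 1) (M - i - 1)).filterMap (fun i' => S i' j') =
      (List.range' (i + 1) (M - i - 1)).filterMap fun i' => T i' j' := fun j' =>
    List.filterMap_congr fun i' hi' =>
      hST _ _ (.inl (by have := (List.mem_range'_1.1 hi').1; omega))
  have hne : ∀ j', j' ≠ j → j' ≠ j + 1 → (List.range M).filterMap (fun i' => S i' j') =
      (List.range M).filterMap fun i' => T i' j' := fun j' h1 h2 =>
    List.filterMap_congr fun i' hi' => hST _ _ (.inr ⟨h1, h2⟩)
  obtain ⟨k, hk⟩ : ∃ k, N - j - 1 = k + 1 := ⟨N - j - 2, by omega⟩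
  rw [fillRead, fillRead, range_eq_append (i := j) (M := N) (by omega), hk, List.range'_succ]
  simp only [List.flatMap_append, List.flatMap_cons]
  have e1 : (List.range j).flatMap (fun j' => ((List.range M).filterMap fun i' => S i' j').reverse) =
      (List.range j).flatMap fun j' => ((List.range M).filterMap fun i' => T i' j').reverse :=
    List.flatMap_congr fun j' hj' => by
      have := List.mem_range.1 hj'
      rw [hne j' (by omega) (by omega)]
  have e2 : (List.range' (j + 1 + 1) k).flatMap
        (fun j' => ((List.range M).filterMap fun i' => S i' j').reverse) =
      (List.range' (j + 1 + 1) k).flatMap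
        fun j' => ((List.range M).filterMap fun i' => T i' j').reverse :=
    List.flatMap_congr fun j' hj' => by
      have := (List.mem_range'_1.1 hj').1
      rw [hne j' (by omega) (by omega)]
  have c1 := pairwise_filterMap_of_lt (fun i1 i2 y z => H'.col i1 i2 j y z)
    (List.pairwise_lt_range (n := M))
  have c2 := pairwise_filterMap_of_lt (fun i1 i2 y z => H.col i1 i2 (j + 1) y z)
    (List.pairwise_lt_range (n := M))
  rw [filterMap_range hM, hSx, hlt, hgt] at c1
  rw [filterMap_range hM, hx] at c2
  have c3 := List.pairwise_append.1 c1
  -- `u`, `v` are the parts of the columns `j`, `j + 1` above row `i`, and `A`, `G` those below it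
  have hor := pl_horizontal (x := x)
    (A := (List.range' (i + 1) (M - i - 1)).filterMap fun i' => T i' j)
    (G := (List.range' (i + 1) (M - i - 1)).filterMap fun i' => T i' (j + 1))
    (u := ((List.range i).filterMap fun i' => T i' j).reverse)
    (v := ((List.range i).filterMap fun i' => T i' (j + 1)).reverse)
    c3.2.1 (List.pairwise_reverse.2 c3.1)
    (by have := List.pairwise_reverse.2 c2; simpa using this)
    (dom_filterMap_range' (fun i1 i2 y z => H.col i1 i2 j y z) (fun i' y hi' hy => by
      obtain ⟨h1, h2, -⟩ := H.bounds hy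
      have htop := H.top_hole
      simp only at htop
      obtain ⟨w, hw⟩ := H.exists_some (i := i') (j := j) (by omega)
        (h2.trans_le (H.bot (by omega))) (by simp; omega)
      exact ⟨w, hw, H.row _ _ _ _ _ (by omega) hw hy⟩) _)
    (dom_reverse_filterMap_range (fun i1 i2 y z => H.col i1 i2 (j + 1) y z) (fun i' y hi' hy => by
      obtain ⟨h1, h2, -⟩ := H.bounds hy
      obtain ⟨-, h4, -⟩ := H.bounds hx
      obtain ⟨w, hw⟩ := H.exists_some (i := i') (j := j + 1) ((H.top (by omega)).trans h1)
        (by omega) (by simp)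
      exact ⟨w, hw, H.row _ _ _ _ _ (by omega) hy hw⟩))
  have hcol : pl (((List.range M).filterMap fun i' => S i' j).reverse ++
        ((List.range M).filterMap fun i' => S i' (j + 1)).reverse) =
      pl (((List.range M).filterMap fun i' => T i' j).reverse ++
        ((List.range M).filterMap fun i' => T i' (j + 1)).reverse) := by
    rw [filterMap_range (f := fun i' => S i' j) hM,
      filterMap_range (f := fun i' => S i' (j + 1)) hM,
      filterMap_range (f := fun i' => T i' j) hM,
      filterMap_range (f := fun i' => T i' (j + 1)) hM, hSx, hS0, hT0, hx, hlt, hlt, hgt, hgt]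
    simpa using hor.symm
  rw [e1, e2]
  simp only [pl_append] at hcol ⊢
  grind

end Slides

section Rectification

variable {n : ℕ} {h g : ℕ → ℕ} {T : Filling n}

/-! ### Forward slidings -/

theorem Sliding.holeFill {b c : ℕ × ℕ} {T' : Filling n} (s : Sliding (T, b) (T', c))
    (H : HoleFill h g b T) {M N : ℕ} (hM : g 0 ≤ M) (hN : g N = 0) :
    HoleFill h g c T' ∧ pl (fillRead T' M N) = pl (fillRead T M N) := by
  have hlt : ∀ {i j : ℕ}, i < g j → i < M ∧ j < N := fun {i j} hij =>
    ⟨(hij.trans_le (H.bot (Nat.zero_le j))).trans_le hM, by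
      by_contra hj
      have := H.bot (not_lt.1 hj)
      omega⟩
  cases s with
  | up _ i j x hx hxy =>
    have H' := H.move_up hx hxy
    refine ⟨H', congrArg pl (fillRead_move_up (hlt H'.hole_bot).1 ?_)⟩
    rw [← Option.not_isSome_iff_eq_none, H.isSome]
    simp
  | left _ i j x hx hxy =>
    have H' := H.move_left hx hxy
    exact ⟨H', H.pl_fillRead_move_left hx hxy (hlt H'.hole_bot).1 (hlt H'.hole_bot).2⟩

theorem holeFill_of_reflTransGen {b c : ℕ × ℕ} {T' : Filling n}
    (s : Relation.ReflTransGen Sliding (T, b) (T', c)) (H : HoleFill h g b T) {M N : ℕ}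
    (hM : g 0 ≤ M) (hN : g N = 0) :
    HoleFill h g c T' ∧ pl (fillRead T' M N) = pl (fillRead T M N) := by
  generalize hP : (T', c) = P at s
  induction s generalizing T' c with
  | refl => cases hP; exact ⟨H, rfl⟩
  | @tail Q _ _ s2 ih =>
    subst hP
    obtain ⟨H1, h1⟩ := ih (T' := Q.1) (c := Q.2) rfl
    obtain ⟨H2, h2⟩ := s2.holeFill H1 hM hN
    exact ⟨H2, h2.trans h1⟩

/-- The elementary slidings of a hole terminate at an outer corner, because each of them increases
the sum of the coordinates of the hole. -/
theorem HoleFill.exists_reflTransGen {b : ℕ × ℕ} (H : HoleFill h g b T) :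
    ∃ (T' : Filling n) (c : ℕ × ℕ), Relation.ReflTransGen Sliding (T, b) (T', c) ∧
      T' (c.1 + 1) c.2 = none ∧ T' c.1 (c.2 + 1) = none := by
  obtain ⟨N, hN⟩ := H.zero
  have hlt : ∀ {b : ℕ × ℕ}, b.1 < g b.2 → b.1 < g 0 ∧ b.2 < N := fun {b} hb =>
    ⟨hb.trans_le (H.bot (Nat.zero_le _)), by
      by_contra hj
      have := H.bot (not_lt.1 hj)
      omega⟩
  obtain ⟨m, hm⟩ : ∃ m, g 0 + N - (b.1 + b.2) = m := ⟨_, rfl⟩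
  induction m using Nat.strong_induction_on generalizing b T with
  | _ m ih =>
    obtain ⟨i, j⟩ := b
    have step : ∀ (T' : Filling n) (c : ℕ × ℕ), Sliding (T, (i, j)) (T', c) →
        i + j < c.1 + c.2 →
        ∃ (T' : Filling n) (c : ℕ × ℕ), Relation.ReflTransGen Sliding (T, (i, j)) (T', c) ∧
          T' (c.1 + 1) c.2 = none ∧ T' c.1 (c.2 + 1) = none := by
      intro T' c s hc
      have H' := (s.holeFill H le_rfl hN).1
      have h1 := hlt H.hole_bot
      simp only at h1 hm
      obtain ⟨T2, c2, h2, h3⟩ := ih (g 0 + N - (c.1 + c.2)) (by omega) H' rfl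
      exact ⟨T2, c2, .head s h2, h3⟩
    rcases hx : T (i + 1) j with _ | x <;> rcases hy : T i (j + 1) with _ | y
    · exact ⟨T, (i, j), .refl, hx, hy⟩
    · exact step _ _ (.left T i j y hy (by simp [hx])) (by simp only; omega)
    · exact step _ _ (.up T i j x hx (by simp [hy])) (by simp only; omega)
    · rcases le_or_gt x y with hxy | hxy
      · refine step _ _ (.up T i j x hx fun z hz => ?_) (by simp only; omega)
        rw [hy] at hz
        exact hxy.trans_eq (Option.some_injective _ hz)
      · refine step _ _ (.left T i j y hy fun z hz => ?_) (by simp only; omega)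
        rw [hx] at hz
        exact hxy.trans_eq (Option.some_injective _ hz)

theorem antitone_update {f : ℕ → ℕ} (hf : Antitone f) {j v : ℕ} (hv : v ≤ f j)
    (hv' : f (j + 1) ≤ v) : Antitone (Function.update f j v) := by
  intro a b hab
  by_cases ha : a = j <;> by_cases hb : b = j
  · rw [ha, hb]
  · subst ha
    rw [Function.update_self, Function.update_of_ne hb]
    exact (hf (by omega)).trans hv'
  · subst hb
    rw [Function.update_self, Function.update_of_ne ha]
    exact hv.trans (hf hab)
  · rw [Function.update_of_ne ha, Function.update_of_ne hb]
    exact hf hab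

/-- Adjoining an inner corner `b` to the skew diagram gives a filling with the hole `b`. -/
theorem SkewFill.holeFill (H : SkewFill h g ∅ T) {b : ℕ × ℕ}
    (hb : IsInnerCorner {b | b.1 < h b.2} b) : HoleFill (Function.update h b.2 b.1) g b T := by
  obtain ⟨i, j⟩ := b
  obtain ⟨h1, h2, h3⟩ := hb
  simp only [Set.mem_ofPred_eq, not_lt] at h1 h2 h3 ⊢
  have h4 := H.top_le j
  refine ⟨⟨antitone_update H.top h1.le h3, H.bot, fun k => ?_, H.zero, fun i' j' => ?_, H.row,
    H.col⟩, by simp, by simp only; omega⟩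
  · by_cases hk : k = j
    · subst hk
      rw [Function.update_self]
      omega
    · rw [Function.update_of_ne hk]
      exact H.top_le k
  · rw [H.isSome]
    by_cases hj : j' = j
    · subst hj
      rw [Function.update_self]
      simp
      omega
    · rw [Function.update_of_ne hj]
      simp [hj]

/-- A hole that has reached an outer corner can be removed from the diagram. -/
theorem HoleFill.skewFill {c : ℕ × ℕ} (H : HoleFill h g c T) (h1 : T (c.1 + 1) c.2 = none)
    (h2 : T c.1 (c.2 + 1) = none) : SkewFill h (Function.update g c.2 c.1) ∅ T := by
  obtain ⟨i, j⟩ := c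
  have hb := H.top_hole
  have hb' := H.hole_bot
  have h3 := (H.isSome (i + 1) j).not.1 (by simp [h1])
  have h4 := (H.isSome i (j + 1)).not.1 (by simp [h2])
  have h5 : h (j + 1) ≤ h j := H.top (Nat.le_succ j)
  simp only [Set.mem_singleton_iff, Prod.mk.injEq] at h3 h4 hb hb' ⊢
  refine ⟨H.top, antitone_update H.bot hb'.le (by simp at h4; omega), fun k => ?_, ?_,
    fun i' j' => ?_, H.row, H.col⟩
  · by_cases hk : k = j
    · subst hk
      rwa [Function.update_self]
    · rw [Function.update_of_ne hk]
      exact H.top_le k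
  · obtain ⟨N, hN⟩ := H.zero
    refine ⟨N, ?_⟩
    rw [Function.update_of_ne, hN]
    rintro rfl
    omega
  · rw [H.isSome]
    by_cases hj : j' = j
    · subst hj
      rw [Function.update_self]
      simp
      omega
    · rw [Function.update_of_ne hj]
      simp [hj]

/-- The skew diagram and the filling of a skew tableau whose boxes lie in the first `M` rows and `N`
columns. -/
def IsSkewState (M N : ℕ) (P : Set (ℕ × ℕ) × Filling n) : Prop :=
  ∃ h g : ℕ → ℕ, P.1 = {b | b.1 < h b.2} ∧ SkewFill h g ∅ P.2 ∧ g 0 ≤ M ∧ g N = 0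

theorem update_le_of_le {f : ℕ → ℕ} {j v : ℕ} (hv : v ≤ f j) (k : ℕ) :
    Function.update f j v k ≤ f k := by
  by_cases hk : k = j
  · subst hk
    rwa [Function.update_self]
  · rw [Function.update_of_ne hk]

theorem diff_innerCorner {b : ℕ × ℕ} (hb : IsInnerCorner {b | b.1 < h b.2} b) :
    {b | b.1 < h b.2} \ {b} = {c : ℕ × ℕ | c.1 < Function.update h b.2 b.1 c.2} := by
  obtain ⟨i, j⟩ := b
  obtain ⟨h1, h2, h3⟩ := hb
  simp only [Set.mem_ofPred_eq, not_lt] at h1 h2 h3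
  ext ⟨i', j'⟩
  by_cases hj : j' = j
  · subst hj
    simp
    omega
  · simp [hj]

theorem ForwardSlide.isSkewState {M N : ℕ} {P Q : Set (ℕ × ℕ) × Filling n} (s : ForwardSlide P Q)
    (hP : IsSkewState M N P) :
    IsSkewState M N Q ∧ pl (fillRead Q.2 M N) = pl (fillRead P.2 M N) := by
  obtain ⟨b, c, hb, hQ, hs, h1, h2⟩ := s
  obtain ⟨h, g, hPh, H, hM, hN⟩ := hP
  rw [hPh] at hb hQ
  obtain ⟨H', h3⟩ := holeFill_of_reflTransGen hs (H.holeFill hb) hM hN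
  refine ⟨⟨_, _, ?_, H'.skewFill h1 h2, (update_le_of_le H'.hole_bot.le 0).trans hM, ?_⟩, h3⟩
  · rw [hQ, diff_innerCorner hb]
  · have := update_le_of_le H'.hole_bot.le N
    omega

theorem isSkewState_of_reflTransGen {M N : ℕ} {P Q : Set (ℕ × ℕ) × Filling n}
    (s : Relation.ReflTransGen ForwardSlide P Q) (hP : IsSkewState M N P) :
    IsSkewState M N Q ∧ pl (fillRead Q.2 M N) = pl (fillRead P.2 M N) := by
  induction s with
  | refl => exact ⟨hP, rfl⟩
  | tail _ s ih =>
    obtain ⟨h1, h2⟩ := s.isSkewState ih.1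
    exact ⟨h1, h2.trans ih.2⟩

theorem IsSkewState.finite {M N : ℕ} {P : Set (ℕ × ℕ) × Filling n} (hP : IsSkewState M N P) :
    P.1.Finite := by
  obtain ⟨h, g, hPh, H, hM, hN⟩ := hP
  refine ((Set.finite_Iio M).prod (Set.finite_Iio N)).subset fun b hb => ?_
  rw [hPh] at hb
  have hb' := (show b.1 < h b.2 from hb).trans_le (H.top_le b.2)
  refine ⟨(hb'.trans_le (H.bot (Nat.zero_le _))).trans_le hM, ?_⟩
  by_contra hj
  have := H.bot (not_lt.1 hj)
  omega

theorem IsSkewState.exists_forwardSlide {M N : ℕ} {P : Set (ℕ × ℕ) × Filling n}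
    (hP : IsSkewState M N P) (hne : P.1.Nonempty) :
    ∃ Q, ForwardSlide P Q ∧ Q.1.ncard < P.1.ncard := by
  have hfin := hP.finite
  obtain ⟨h, g, hPh, H, hM, hN⟩ := hP
  obtain ⟨b, hb, hmax⟩ := Set.exists_max_image P.1 (fun b => b.1 + b.2) hfin hne
  -- a box with the largest sum of coordinates is an inner corner
  have hc : IsInnerCorner P.1 b := by
    refine ⟨hb, fun h' => ?_, fun h' => ?_⟩
    · have := hmax _ h'
      simp only at this
      omega
    · have := hmax _ h'
      simp only at this
      omega
  obtain ⟨T', c, h1, h2⟩ := (H.holeFill (hPh ▸ hc)).exists_reflTransGen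
  exact ⟨(P.1 \ {b}, T'), ⟨b, c, hc, rfl, h1, h2⟩, Set.ncard_sdiff_singleton_lt_of_mem hb hfin⟩

theorem IsSkewState.exists_rectification {M N : ℕ} {P : Set (ℕ × ℕ) × Filling n}
    (hP : IsSkewState M N P) : ∃ T, Relation.ReflTransGen ForwardSlide P (∅, T) := by
  obtain ⟨m, hm⟩ : ∃ m, P.1.ncard = m := ⟨_, rfl⟩
  induction m using Nat.strong_induction_on generalizing P with
  | _ m ih =>
    rcases P.1.eq_empty_or_nonempty with h0 | hne
    · obtain ⟨μ, T⟩ := P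
      obtain rfl : μ = ∅ := h0
      exact ⟨T, .refl⟩
    · obtain ⟨Q, s, hQ⟩ := hP.exists_forwardSlide hne
      obtain ⟨T, hT⟩ := ih _ (hm ▸ hQ) (s.isSkewState hP).1 rfl
      exact ⟨T, .head s hT⟩

/-! ### Skew tableaux as fillings -/

theorem cols_ne_nil {w : ColString n} (hw : w ∈ Skew n) {k : ℕ} (hk : k < w.cols.length) :
    w.col k ≠ [] := by
  rw [col_eq_getElem w hk]
  exact (hw.1.1 _ (List.getElem_mem hk)).1

theorem col_pairwise {w : ColString n} (hw : w ∈ Skew n) (k : ℕ) :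
    (w.col k).Pairwise (· < ·) := by
  by_cases hk : k < w.cols.length
  · rw [col_eq_getElem w hk]
    exact (hw.1.1 _ (List.getElem_mem hk)).2
  · simp [ColString.col, List.getD_eq_getElem?_getD, not_lt.1 hk]

theorem col_eq_nil (w : ColString n) {k : ℕ} (hk : w.cols.length ≤ k) : w.col k = [] := by
  simp [ColString.col, List.getD_eq_getElem?_getD, hk]

theorem height_eq_zero (w : ColString n) {k : ℕ} (hk : w.cols.length ≤ k + 1) :
    w.height k = 0 := by
  rw [ColString.height, Finset.Ico_eq_empty (by omega)]
  rfl

theorem height_succ {w : ColString n} (hw : w ∈ Skew n) {k : ℕ} (hk : k + 1 < w.cols.length) :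
    (w.height k : ℤ) = w.height (k + 1) + ((w.col (k + 1)).length - w.pos k) := by
  have hnn : ∀ k, 0 ≤ ∑ l ∈ Finset.Ico k (w.cols.length - 1),
      (((w.col (l + 1)).length : ℤ) - w.pos l) := fun k =>
    Finset.sum_nonneg fun l hl => by
      have := (Finset.mem_Ico.1 hl).2
      have := (hw.2 l (by omega)).2.2.1
      omega
  rw [ColString.height, ColString.height, Int.toNat_of_nonneg (hnn _), Int.toNat_of_nonneg (hnn _),
    Finset.sum_eq_sum_Ico_succ_bot (by omega)]
  ring

theorem box_eq_some {w : ColString n} {i k : ℕ} {x : Fin n} :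
    w.box i k = some x ↔ w.height k ≤ i ∧ (w.col k)[i - w.height k]? = some x := by
  rw [ColString.box]
  split_ifs with h
  · simp; omega
  · simp [not_lt.1 h]

/-- In a skew diagram it is enough to compare adjacent boxes of a row, as rows have no gaps. -/
theorem row_of_adjacent {S : Filling n} {h g : ℕ → ℕ} (hh : Antitone h) (hg : Antitone g)
    (hS : ∀ i j, (S i j).isSome ↔ h j ≤ i ∧ i < g j)
    (hadj : ∀ i j x y, S i j = some x → S i (j + 1) = some y → x ≤ y) (i j j' : ℕ) (x y : Fin n)
    (hj : j < j') (hx : S i j = some x) (hy : S i j' = some y) : x ≤ y := by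
  obtain ⟨k, rfl⟩ := Nat.exists_eq_add_of_lt hj
  induction k generalizing y with
  | zero => exact hadj _ _ _ _ hx hy
  | succ k ih =>
    have h1 := (hS i j).1 (by simp [hx])
    have h2 := (hS _ _).1 (Option.isSome_iff_exists.2 ⟨y, hy⟩)
    obtain ⟨z, hz⟩ := Option.isSome_iff_exists.1 ((hS i (j + k + 1)).2
      ⟨(hh (by omega)).trans h1.1, h2.2.trans_le (hg (by omega))⟩)
    exact (ih z (by omega) hz).trans (hadj _ _ _ _ hz hy)

theorem skewFill_box {w : ColString n} (hw : w ∈ Skew n) :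
    SkewFill w.height (fun k => w.height k + (w.col k).length) ∅ w.box := by
  have htop : Antitone w.height := antitone_nat_of_succ_le fun k => by
    by_cases hk : k + 1 < w.cols.length
    · have h1 := height_succ hw hk
      have h2 := (hw.2 k hk).2.2.1
      omega
    · rw [height_eq_zero w (by omega)]
      omega
  have hbot : Antitone fun k => w.height k + (w.col k).length := antitone_nat_of_succ_le fun k => by
    by_cases hk : k + 1 < w.cols.length
    · have h1 := height_succ hw hk
      have h2 := (hw.2 k hk).2.1
      omega
    · rw [height_eq_zero w (by omega), col_eq_nil w (not_lt.1 hk)]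
      simp
  have hsome : ∀ i k, (w.box i k).isSome ↔
      w.height k ≤ i ∧ i < w.height k + (w.col k).length := by
    intro i k
    rw [ColString.box]
    split_ifs with h
    · simp; omega
    · simp; omega
  refine ⟨htop, hbot, fun k => Nat.le_add_right _ _, ⟨w.cols.length, ?_⟩, by simpa using hsome,
    row_of_adjacent htop hbot hsome ?_, ?_⟩
  · rw [height_eq_zero w (by omega), col_eq_nil w le_rfl]
    rfl
  · intro i k x y hx hy
    obtain ⟨h1, h2⟩ := box_eq_some.1 hx
    obtain ⟨h3, h4⟩ := box_eq_some.1 hy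
    have hk : k + 1 < w.cols.length := by
      by_contra hk
      rw [col_eq_nil w (not_lt.1 hk)] at h4
      simp at h4
    have h5 := height_succ hw hk
    exact (hw.2 k hk).2.2.2 _ _ x y (by omega) h2 h4
  · intro i i' k x y hi hx hy
    obtain ⟨h1, h2⟩ := box_eq_some.1 hx
    obtain ⟨h3, h4⟩ := box_eq_some.1 hy
    obtain ⟨h5, h6⟩ := List.getElem?_eq_some_iff.1 h2
    obtain ⟨h7, h8⟩ := List.getElem?_eq_some_iff.1 h4
    rw [← h6, ← h8]
    exact List.pairwise_iff_getElem.1 (col_pairwise hw k) _ _ h5 h7 (by omega)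

theorem fillRead_box {w : ColString n} (hw : w ∈ Skew n) {M N : ℕ}
    (hbox : ∀ i k x, w.box i k = some x → i < M ∧ k < N) : fillRead w.box M N = w.read := by
  have hlt : ∀ k, k < w.cols.length → w.height k + (w.col k).length ≤ M ∧ k < N := by
    intro k hk
    have h0 := List.length_pos_iff.2 (cols_ne_nil hw hk)
    have h1 := hbox (w.height k + ((w.col k).length - 1)) k ((w.col k)[(w.col k).length - 1])
      (box_eq_some.2 ⟨by omega, by
        rw [Nat.add_sub_cancel_left, List.getElem?_eq_getElem]⟩)
    omega
  have hcol : ∀ k, (List.range M).filterMap (fun i => w.box i k) = w.col k := by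
    intro k
    by_cases hk : k < w.cols.length
    · exact filterMap_ifHeight _ (hlt k hk).1
    · rw [col_eq_nil w (not_lt.1 hk), List.filterMap_eq_nil_iff]
      intro i _
      rw [ColString.box, col_eq_nil w (not_lt.1 hk)]
      simp
  have hN : w.cols.length ≤ N := by
    by_contra h
    have := hlt (w.cols.length - 1) (by omega)
    omega
  obtain ⟨k, rfl⟩ := Nat.exists_eq_add_of_le hN
  have h1 : (List.range w.cols.length).map (fun k => (w.col k).reverse) =
      w.cols.map List.reverse := by
    refine List.ext_getElem (by simp) fun i h2 h3 => ?_
    rw [List.getElem_map, List.getElem_map, List.getElem_range, col_eq_getElem]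
  have h2 : (List.range' w.cols.length k).flatMap (fun k => (w.col k).reverse) = [] := by
    rw [List.flatMap_eq_nil_iff]
    intro j hj
    rw [col_eq_nil w (List.mem_range'_1.1 hj).1]
    rfl
  simp only [fillRead, hcol]
  rw [List.range_eq_range', ← List.range'_append_1, List.flatMap_append, Nat.zero_add, h2,
    List.append_nil]
  rw [← List.range_eq_range', List.flatMap_def, h1]
  rfl

theorem isSkewState_box {w : ColString n} (hw : w ∈ Skew n) :
    ∃ M N, IsSkewState M N (w.inner, w.box) := by
  have H := skewFill_box hw
  obtain ⟨N, hN⟩ := H.zero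
  exact ⟨_, N, _, _, rfl, H, le_rfl, hN⟩

theorem IsSkewState.box_lt {M N : ℕ} {P : Set (ℕ × ℕ) × Filling n} (hP : IsSkewState M N P)
    {i k : ℕ} {x : Fin n} (hx : P.2 i k = some x) : i < M ∧ k < N := by
  obtain ⟨h, g, -, H, hM, hN⟩ := hP
  have hb := (H.bounds hx).2.1
  refine ⟨(hb.trans_le (H.bot (Nat.zero_le _))).trans_le hM, ?_⟩
  by_contra hj
  have := H.bot (not_lt.1 hj)
  omega

/-- A rectification is Knuth equivalent to the original tableau. -/
theorem IsRectification.pl_read {w t : ColString n} (hw : w ∈ Skew n) (h : IsRectification w t) :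
    pl t.read = pl w.read := by
  obtain ⟨M, N, hs⟩ := isSkewState_box hw
  obtain ⟨h1, h2⟩ := isSkewState_of_reflTransGen h.2 hs
  rwa [fillRead_box h.1.1 fun _ _ _ => h1.box_lt, fillRead_box hw fun _ _ _ => hs.box_lt] at h2

theorem young_height {t : ColString n} (ht : t ∈ Young n) (k : ℕ) : t.height k = 0 := by
  rw [ColString.height, Finset.sum_eq_zero]
  · rfl
  · intro l hl
    have := (Finset.mem_Ico.1 hl).2
    rw [ht.2 l (by omega), sub_self]

/-- A semistandard filling of a straight shape is a Young tableau. -/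
theorem SkewFill.exists_young (H : SkewFill (fun _ => 0) g ∅ T) : ∃ t ∈ Young n, t.box = T := by
  classical
  have hN : ∀ j, j < Nat.find H.zero ↔ g j ≠ 0 := by
    intro j
    constructor
    · exact Nat.find_min H.zero
    · intro hj
      by_contra h
      have := H.bot (not_lt.1 h)
      rw [Nat.find_spec H.zero] at this
      omega
  have hC : ∀ j, ((List.range (g j)).filterMap fun i => T i j).length = g j ∧
      ∀ i, ((List.range (g j)).filterMap fun i => T i j)[i]? = T i j := by
    intro j
    obtain ⟨h1, h2⟩ := filterMap_range_getElem? (f := fun i => T i j) (m := g j)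
      fun i hi => (H.isSome i j).2 ⟨Nat.zero_le _, hi, by simp⟩
    refine ⟨h1, fun i => (h2 i).trans ?_⟩
    split_ifs with h
    · rfl
    · refine ((Option.not_isSome_iff_eq_none).1 ?_).symm
      rw [H.isSome]
      tauto
  set C := fun j => (List.range (g j)).filterMap fun i => T i j with hCdef
  have hT : Tab (· ≤ ·) ((List.range (Nat.find H.zero)).map C) := by
    refine ⟨fun l hl => ?_, ?_⟩
    · obtain ⟨j, hj, rfl⟩ := List.mem_map.1 hl
      refine ⟨?_, ?_⟩
      · rw [← List.length_pos_iff, (hC j).1]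
        exact Nat.pos_of_ne_zero ((hN j).1 (List.mem_range.1 hj))
      · simp only [not_le]
        exact pairwise_filterMap_of_lt (fun i i' => H.col i i' j) List.pairwise_lt_range
    · rw [List.isChain_iff_getElem]
      intro j hj
      simp only [List.getElem_map, List.getElem_range]
      refine dom_iff.2 ⟨?_, fun i x y hx hy => ?_⟩
      · rw [(hC j).1, (hC (j + 1)).1]
        exact H.bot (Nat.le_succ j)
      · rw [(hC j).2] at hx
        rw [(hC (j + 1)).2] at hy
        exact H.row _ _ _ _ _ (Nat.lt_succ_self j) hx hy
  refine ⟨_, ofCols_glueY_mem hT, ?_⟩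
  funext i k
  rw [ColString.box, young_height (ofCols_glueY_mem hT), if_neg (by omega), Nat.sub_zero]
  by_cases hk : k < Nat.find H.zero
  · have : (ColString.ofCols glueY ((List.range (Nat.find H.zero)).map C)).col k = C k := by
      rw [col_eq_getElem _ (by simpa [ColString.ofCols] using hk)]
      simp [ColString.ofCols]
    rw [this, (hC k).2]
  · rw [col_eq_nil _ (by simpa [ColString.ofCols] using hk)]
    have := (hN k).not.1 hk
    refine ((Option.not_isSome_iff_eq_none).1 ?_).symm
    rw [H.isSome]
    omega

theorem exists_isRectification {w : ColString n} (hw : w ∈ Skew n) :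
    ∃ t, IsRectification w t := by
  obtain ⟨M, N, hs⟩ := isSkewState_box hw
  obtain ⟨T, hT⟩ := hs.exists_rectification
  obtain ⟨h, g, h1, h2, -⟩ := (isSkewState_of_reflTransGen hT hs).1
  have h0 : h = fun _ => 0 := by
    funext j
    by_contra hj
    have : ((0, j) : ℕ × ℕ) ∈ {b : ℕ × ℕ | b.1 < h b.2} := Nat.pos_of_ne_zero hj
    rw [← h1] at this
    exact this
  subst h0
  obtain ⟨t, ht, rfl⟩ := h2.exists_young
  exact ⟨t, ht, hT⟩

end Rectification

/-! ### Cancellation of signs -/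

section Signs

/-- The symbols `+` that are left after the cancellation. -/
def plus (l : List (SignType × ℕ)) : List (SignType × ℕ) :=
  (cancel l).filter fun a => decide (a.1 = SignType.pos)

/-- The symbols `-` that are left after the cancellation. -/
def minus (l : List (SignType × ℕ)) : List (SignType × ℕ) :=
  (cancel l).filter fun a => decide (a.1 = SignType.neg)

@[simp] theorem plus_nil : plus [] = [] := rfl

@[simp] theorem minus_nil : minus [] = [] := rfl

@[simp] theorem plus_zero (p : ℕ) (l) : plus ((SignType.zero, p) :: l) = plus l := rfl

@[simp] theorem minus_zero (p : ℕ) (l) : minus ((SignType.zero, p) :: l) = minus l := rfl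

@[simp] theorem plus_pos (p : ℕ) (l) :
    plus ((SignType.pos, p) :: l) = (SignType.pos, p) :: plus l := by
  simp [plus, cancel]

@[simp] theorem minus_pos (p : ℕ) (l) : minus ((SignType.pos, p) :: l) = minus l := by
  simp [minus, cancel]

/-- A `-` in front of a word is cancelled by the leftmost `+` that is left, if there is one. -/
theorem plus_minus_neg (p : ℕ) (l : List (SignType × ℕ)) (h : cancel l = plus l ++ minus l) :
    plus ((SignType.neg, p) :: l) = (plus l).tail ∧
      minus ((SignType.neg, p) :: l) =
        (if plus l = [] then [(SignType.neg, p)] else []) ++ minus l ∧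
      cancel ((SignType.neg, p) :: l) =
        plus ((SignType.neg, p) :: l) ++ minus ((SignType.neg, p) :: l) := by
  have hp : ∀ a ∈ plus l, a.1 = SignType.pos := fun a ha => by
    simpa using (List.mem_filter.1 ha).2
  have hm : ∀ a ∈ minus l, a.1 = SignType.neg := fun a ha => by
    simpa using (List.mem_filter.1 ha).2
  have e1 : ∀ {t : List (SignType × ℕ)}, (∀ a ∈ t, a.1 = SignType.pos) →
      (t.filter fun a => decide (a.1 = SignType.pos)) = t ∧
      (t.filter fun a => decide (a.1 = SignType.neg)) = [] := by
    intro t ht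
    refine ⟨List.filter_eq_self.2 fun a ha => by simp [ht a ha],
      List.filter_eq_nil_iff.2 fun a ha => by simp [ht a ha]⟩
  have e2 : (minus l).filter (fun a => decide (a.1 = SignType.neg)) = minus l ∧
      (minus l).filter (fun a => decide (a.1 = SignType.pos)) = [] := by
    refine ⟨List.filter_eq_self.2 fun a ha => by simp [hm a ha],
      List.filter_eq_nil_iff.2 fun a ha => by simp [hm a ha]⟩
  cases hpl : plus l with
  | nil =>
    rw [hpl, List.nil_append] at h
    have hc : cancel ((SignType.neg, p) :: l) = (SignType.neg, p) :: minus l := by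
      cases hml : minus l with
      | nil => rw [hml] at h; simp [cancel, h]
      | cons q t =>
        obtain ⟨s, q⟩ := q
        obtain rfl : s = SignType.neg := hm (s, q) (by rw [hml]; simp)
        rw [hml] at h
        simp [cancel, h]
    have h1 : plus ((SignType.neg, p) :: l) = [] := by
      rw [plus, hc, List.filter_cons_of_neg (by simp), e2.2]
    have h2 : minus ((SignType.neg, p) :: l) = (SignType.neg, p) :: minus l := by
      rw [minus, hc, List.filter_cons_of_pos (by simp), e2.1]
    rw [hc, h1, h2]
    simp
  | cons q t =>
    have hq := hp q (by rw [hpl]; simp)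
    obtain ⟨s, q⟩ := q
    obtain rfl : s = SignType.pos := hq
    rw [hpl] at h
    have ht := e1 fun a ha => hp a (by rw [hpl]; exact List.mem_cons_of_mem _ ha)
    have hc : cancel ((SignType.neg, p) :: l) = t ++ minus l := by
      simp [cancel, h]
    have h1 : plus ((SignType.neg, p) :: l) = t := by
      rw [plus, hc, List.filter_append, e2.2, ht.1, List.append_nil]
    have h2 : minus ((SignType.neg, p) :: l) = minus l := by
      rw [minus, hc, List.filter_append, e2.1, ht.2, List.nil_append]
    rw [hc, h1, h2]
    simp

theorem cancel_eq (l : List (SignType × ℕ)) : cancel l = plus l ++ minus l := by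
  induction l with
  | nil => rfl
  | cons a l ih =>
    obtain ⟨s, p⟩ := a
    cases s with
    | zero => exact ih
    | pos => rw [plus_pos, minus_pos, List.cons_append, ← ih]; rfl
    | neg => exact (plus_minus_neg p l ih).2.2

@[simp] theorem plus_neg (p : ℕ) (l) : plus ((SignType.neg, p) :: l) = (plus l).tail :=
  (plus_minus_neg p l (cancel_eq l)).1

@[simp] theorem minus_neg (p : ℕ) (l) : minus ((SignType.neg, p) :: l) =
    (if plus l = [] then [(SignType.neg, p)] else []) ++ minus l :=
  (plus_minus_neg p l (cancel_eq l)).2.1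

/-- The rightmost `-` of the first word are cancelled by the leftmost `+` of the second word. -/
theorem plus_minus_append (l m : List (SignType × ℕ)) :
    plus (l ++ m) = plus l ++ (plus m).drop (minus l).length ∧
      minus (l ++ m) = (minus l).take ((minus l).length - (plus m).length) ++ minus m := by
  induction l with
  | nil => simp
  | cons a l ih =>
    obtain ⟨s, p⟩ := a
    cases s with
    | zero => exact ih
    | pos =>
      rw [List.cons_append, plus_pos, plus_pos, minus_pos, minus_pos, ih.1, ih.2]
      exact ⟨rfl, rfl⟩
    | neg =>
      rw [List.cons_append, plus_neg, plus_neg, minus_neg, minus_neg, ih.1, ih.2]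
      cases hpl : plus l with
      | cons q t => simp
      | nil =>
        simp only [List.nil_append, List.tail_nil, List.tail_drop, List.drop_eq_nil_iff, if_true,
          List.length_append, List.length_singleton]
        refine ⟨by rw [add_comm], ?_⟩
        split_ifs with h
        · rw [show 1 + (minus l).length - (plus m).length =
            ((minus l).length - (plus m).length) + 1 by omega]
          simp
        · rw [show 1 + (minus l).length - (plus m).length = 0 by omega,
            show (minus l).length - (plus m).length = 0 by omega]
          simp

theorem plus_minus_map (f : ℕ → ℕ) (l : List (SignType × ℕ)) :
    plus (l.map (Prod.map id f)) = (plus l).map (Prod.map id f) ∧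
      minus (l.map (Prod.map id f)) = (minus l).map (Prod.map id f) := by
  induction l with
  | nil => simp
  | cons a l ih =>
    obtain ⟨s, p⟩ := a
    cases s with
    | zero => exact ih
    | pos =>
      rw [List.map_cons, Prod.map_apply, id_eq, plus_pos, plus_pos, minus_pos, minus_pos, ih.1,
        ih.2]
      exact ⟨rfl, rfl⟩
    | neg =>
      simp only [List.map_cons, Prod.map_apply, id_eq, plus_neg, minus_neg, ih.1, ih.2,
        List.map_tail, List.map_eq_nil_iff, List.map_append, true_and]
      split_ifs <;> simp

/-- The number of symbols `+` that are left after the cancellation. -/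
def phi (s : List SignType) : ℕ := (plus s.zipIdx).length

/-- The number of symbols `-` that are left after the cancellation. -/
def eps (s : List SignType) : ℕ := (minus s.zipIdx).length

theorem zipIdx_eq_map (s : List SignType) (k : ℕ) :
    s.zipIdx k = s.zipIdx.map (Prod.map id (· + k)) := by
  rw [List.map_snd_add_zipIdx_eq_zipIdx]; simp

theorem phi_append (s t : List SignType) : phi (s ++ t) = phi s + (phi t - eps s) := by
  simp only [phi, eps, List.zipIdx_append, zipIdx_eq_map t (0 + s.length), plus_minus_append,
    plus_minus_map]
  simp

theorem eps_append (s t : List SignType) : eps (s ++ t) = eps t + (eps s - phi t) := by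
  simp only [phi, eps, List.zipIdx_append, zipIdx_eq_map t (0 + s.length), plus_minus_append,
    plus_minus_map]
  simp
  omega

theorem rightmostPlus_append (s t : List SignType) : rightmostPlus (s ++ t) =
    if eps s < phi t then (rightmostPlus t).map (· + s.length) else rightmostPlus s := by
  change ((plus (s ++ t).zipIdx).getLast?).map Prod.snd = _
  rw [List.zipIdx_append, (plus_minus_append _ _).1, zipIdx_eq_map t (0 + s.length),
    (plus_minus_map _ _).1]
  split_ifs with h
  · change _ = (((plus t.zipIdx).getLast?).map Prod.snd).map _
    rw [List.getLast?_append_of_ne_nil, List.getLast?_drop, if_neg, List.getLast?_map]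
    · simp [Function.comp_def]
    · simpa [phi, eps] using h
    · simpa [phi, eps] using h
  · rw [List.drop_eq_nil_of_le (by simpa [phi, eps] using h), List.append_nil]
    rfl

theorem leftmostMinus_append (s t : List SignType) : leftmostMinus (s ++ t) =
    if phi t < eps s then leftmostMinus s else (leftmostMinus t).map (· + s.length) := by
  change ((minus (s ++ t).zipIdx).head?).map Prod.snd = _
  rw [List.zipIdx_append, (plus_minus_append _ _).2, zipIdx_eq_map t (0 + s.length),
    (plus_minus_map _ _).1, (plus_minus_map _ _).2]
  split_ifs with h
  · change _ = ((minus s.zipIdx).head?).map Prod.snd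
    have h' : (plus t.zipIdx).length < (minus s.zipIdx).length := h
    rw [List.head?_append_of_ne_nil, List.head?_take, if_neg]
    · rw [List.length_map]; omega
    · rw [Ne, List.take_eq_nil_iff, List.length_map, ← List.length_eq_zero_iff]; omega
  · change _ = (((minus t.zipIdx).head?).map Prod.snd).map _
    have h' : ¬ (plus t.zipIdx).length < (minus s.zipIdx).length := h
    rw [List.length_map, Nat.sub_eq_zero_of_le (not_lt.1 h'), List.take_zero, List.nil_append,
      List.head?_map]
    simp [Function.comp_def]

@[simp] theorem phi_nil : phi [] = 0 := rfl

@[simp] theorem eps_nil : eps [] = 0 := rfl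

theorem phi_singleton (c : SignType) : phi [c] = if c = SignType.pos then 1 else 0 := by
  revert c; decide

theorem eps_singleton (c : SignType) : eps [c] = if c = SignType.neg then 1 else 0 := by
  revert c; decide

theorem phi_cons (c : SignType) (s : List SignType) : phi (c :: s) = phi [c] + (phi s - eps [c]) :=
  phi_append [c] s

theorem eps_cons (c : SignType) (s : List SignType) : eps (c :: s) = eps s + (eps [c] - phi s) :=
  eps_append [c] s

theorem rightmostPlus_eq_none {s : List SignType} : rightmostPlus s = none ↔ phi s = 0 := by
  change ((plus s.zipIdx).getLast?).map Prod.snd = none ↔ _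
  simp [phi]

theorem leftmostMinus_eq_none {s : List SignType} : leftmostMinus s = none ↔ eps s = 0 := by
  change ((minus s.zipIdx).head?).map Prod.snd = none ↔ _
  simp [eps]

theorem rightmostPlus_singleton (c : SignType) :
    rightmostPlus [c] = if c = SignType.pos then some 0 else none := by
  revert c; decide

theorem leftmostMinus_singleton (c : SignType) :
    leftmostMinus [c] = if c = SignType.neg then some 0 else none := by
  revert c; decide

/-- A `+` is the rightmost one after the cancellation if and only if the word on its left has no `-`
left and the word on its right has no `+` left. -/
theorem rightmostPlus_eq_some {s : List SignType} {p : ℕ} : rightmostPlus s = some p ↔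
    ∃ a b, s = a ++ SignType.pos :: b ∧ a.length = p ∧ eps a = 0 ∧ phi b = 0 := by
  constructor
  · intro h
    induction s generalizing p with
    | nil => simp [rightmostPlus, cancel] at h
    | cons c t ih =>
      rw [← List.singleton_append, rightmostPlus_append] at h
      split_ifs at h with h1
      · obtain ⟨q, hq, rfl⟩ := Option.map_eq_some_iff.1 h
        obtain ⟨a, b, rfl, rfl, h2, h3⟩ := ih hq
        refine ⟨c :: a, b, rfl, by simp, ?_, h3⟩
        rw [phi_append, phi_cons, h2, h3] at h1
        rw [eps_cons, h2]
        simp [phi_singleton] at h1 ⊢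
        omega
      · rw [rightmostPlus_singleton] at h
        split_ifs at h with h2
        · subst h2
          simp only [Option.some.injEq] at h
          refine ⟨[], t, rfl, h, rfl, ?_⟩
          simp [eps_singleton] at h1
          exact h1
  · rintro ⟨a, b, rfl, rfl, h1, h2⟩
    rw [← List.singleton_append, rightmostPlus_append, rightmostPlus_append, phi_append, h1, h2]
    simp [phi_singleton, eps_singleton, rightmostPlus_singleton]

/-- A `-` is the leftmost one after the cancellation if and only if the word on its left has no `-`
left and the word on its right has no `+` left. -/
theorem leftmostMinus_eq_some {s : List SignType} {p : ℕ} : leftmostMinus s = some p ↔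
    ∃ a b, s = a ++ SignType.neg :: b ∧ a.length = p ∧ eps a = 0 ∧ phi b = 0 := by
  constructor
  · intro h
    induction s generalizing p with
    | nil => simp [leftmostMinus, cancel] at h
    | cons c t ih =>
      rw [← List.singleton_append, leftmostMinus_append] at h
      split_ifs at h with h1
      · rw [leftmostMinus_singleton] at h
        split_ifs at h with h2
        · subst h2
          simp only [Option.some.injEq] at h
          refine ⟨[], t, rfl, h, rfl, ?_⟩
          simp [eps_singleton] at h1
          exact h1
      · obtain ⟨q, hq, rfl⟩ := Option.map_eq_some_iff.1 h
        obtain ⟨a, b, rfl, rfl, h2, h3⟩ := ih hq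
        refine ⟨c :: a, b, rfl, by simp, ?_, h3⟩
        rw [phi_append, phi_cons, h2, h3] at h1
        rw [eps_cons, h2]
        simp [phi_singleton, eps_singleton] at h1 ⊢
        omega
  · rintro ⟨a, b, rfl, rfl, h1, h2⟩
    rw [← List.singleton_append, leftmostMinus_append, leftmostMinus_append, phi_append, h1, h2]
    simp [eps_singleton, leftmostMinus_singleton]

variable {α β : Type*}

theorem map_rightmostPlus_eq_some {σ : α → SignType} {l : List α} {op : ℕ → β} {b : β} :
    (rightmostPlus (l.map σ)).map op = some b ↔ ∃ u x v, l = u ++ x :: v ∧ σ x = SignType.pos ∧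
      eps (u.map σ) = 0 ∧ phi (v.map σ) = 0 ∧ op u.length = b := by
  rw [Option.map_eq_some_iff]
  constructor
  · rintro ⟨p, hp, rfl⟩
    obtain ⟨s, t, h1, rfl, h2, h3⟩ := rightmostPlus_eq_some.1 hp
    obtain ⟨u, v', rfl, rfl, h4⟩ := List.map_eq_append_iff.1 h1
    obtain ⟨x, v, rfl, h5, rfl⟩ := List.map_eq_cons_iff.1 h4
    exact ⟨u, x, v, rfl, h5, h2, h3, by simp⟩
  · rintro ⟨u, x, v, rfl, h1, h2, h3, h4⟩
    exact ⟨u.length, rightmostPlus_eq_some.2 ⟨_, _, by simp [h1], by simp, h2, h3⟩, h4⟩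

theorem map_leftmostMinus_eq_some {σ : α → SignType} {l : List α} {op : ℕ → β} {b : β} :
    (leftmostMinus (l.map σ)).map op = some b ↔ ∃ u x v, l = u ++ x :: v ∧ σ x = SignType.neg ∧
      eps (u.map σ) = 0 ∧ phi (v.map σ) = 0 ∧ op u.length = b := by
  rw [Option.map_eq_some_iff]
  constructor
  · rintro ⟨p, hp, rfl⟩
    obtain ⟨s, t, h1, rfl, h2, h3⟩ := leftmostMinus_eq_some.1 hp
    obtain ⟨u, v', rfl, rfl, h4⟩ := List.map_eq_append_iff.1 h1
    obtain ⟨x, v, rfl, h5, rfl⟩ := List.map_eq_cons_iff.1 h4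
    exact ⟨u, x, v, rfl, h5, h2, h3, by simp⟩
  · rintro ⟨u, x, v, rfl, h1, h2, h3, h4⟩
    exact ⟨u.length, leftmostMinus_eq_some.2 ⟨_, _, by simp [h1], by simp, h2, h3⟩, h4⟩

end Signs

/-! ### Kashiwara operators on words -/

section Words

variable {n : ℕ}

theorem lo_ne_hi (i : Fin (n - 1)) : lo i ≠ hi i := by
  simp [lo, hi, Fin.ext_iff]

theorem lo_lt_hi (i : Fin (n - 1)) : lo i < hi i := by
  simp [lo, hi, Fin.lt_def]

theorem letterSign_eq_pos {i : Fin (n - 1)} {x : Fin n} :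
    letterSign i x = SignType.pos ↔ x = lo i := by
  unfold letterSign
  split_ifs <;> simp_all

theorem letterSign_eq_neg {i : Fin (n - 1)} {x : Fin n} :
    letterSign i x = SignType.neg ↔ x = hi i := by
  have := lo_ne_hi i
  unfold letterSign
  split_ifs <;> simp_all

/-- The number of letters `i` of a word that are left after the cancellation. -/
def wphi (i : Fin (n - 1)) (w : List (Fin n)) : ℕ := phi (w.map (letterSign i))

/-- The number of letters `i + 1` of a word that are left after the cancellation. -/
def weps (i : Fin (n - 1)) (w : List (Fin n)) : ℕ := eps (w.map (letterSign i))

theorem wphi_append (i : Fin (n - 1)) (u v : List (Fin n)) :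
    wphi i (u ++ v) = wphi i u + (wphi i v - weps i u) := by
  simp [wphi, weps, phi_append]

theorem weps_append (i : Fin (n - 1)) (u v : List (Fin n)) :
    weps i (u ++ v) = weps i v + (weps i u - wphi i v) := by
  simp [wphi, weps, eps_append]

/-- The arrows of the crystal graph of words: the letter `i` between `u` and `v` is both the
rightmost `+` that is left in `w` and, after it has become `i + 1`, the leftmost `-` that is left in
`w'`. -/
def WArrow (i : Fin (n - 1)) (w w' : List (Fin n)) : Prop :=
  ∃ u v, w = u ++ lo i :: v ∧ w' = u ++ hi i :: v ∧ weps i u = 0 ∧ wphi i v = 0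

theorem word_f_iff {i : Fin (n - 1)} {w w' : List (Fin n)} :
    (wordCrystal n).f i w = some w' ↔ WArrow i w w' := by
  refine map_rightmostPlus_eq_some.trans ?_
  constructor
  · rintro ⟨u, x, v, rfl, h1, h2, h3, rfl⟩
    rw [letterSign_eq_pos] at h1
    exact ⟨u, v, by rw [h1], by simp, h2, h3⟩
  · rintro ⟨u, v, rfl, rfl, h2, h3⟩
    exact ⟨u, _, v, rfl, letterSign_eq_pos.2 rfl, h2, h3, by simp⟩

theorem word_e_iff {i : Fin (n - 1)} {w w' : List (Fin n)} :
    (wordCrystal n).e i w' = some w ↔ WArrow i w w' := by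
  refine map_leftmostMinus_eq_some.trans ?_
  constructor
  · rintro ⟨u, x, v, rfl, h1, h2, h3, rfl⟩
    rw [letterSign_eq_neg] at h1
    exact ⟨u, v, by simp, by rw [h1], h2, h3⟩
  · rintro ⟨u, v, rfl, rfl, h2, h3⟩
    exact ⟨u, _, v, rfl, letterSign_eq_neg.2 rfl, h2, h3, by simp⟩

theorem word_f_eq_none {i : Fin (n - 1)} {w : List (Fin n)} :
    (wordCrystal n).f i w = none ↔ wphi i w = 0 :=
  Option.map_eq_none_iff.trans rightmostPlus_eq_none

theorem word_e_eq_none {i : Fin (n - 1)} {w : List (Fin n)} :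
    (wordCrystal n).e i w = none ↔ weps i w = 0 :=
  Option.map_eq_none_iff.trans leftmostMinus_eq_none

/-- The tensor product rule for `f_i`. -/
theorem word_f_append (i : Fin (n - 1)) (u v : List (Fin n)) : (wordCrystal n).f i (u ++ v) =
    if weps i u < wphi i v then ((wordCrystal n).f i v).map (u ++ ·)
    else ((wordCrystal n).f i u).map (· ++ v) := by
  unfold wphi weps
  change (rightmostPlus ((u ++ v).map _)).map _ = if _ then ((rightmostPlus (v.map _)).map _).map _
    else ((rightmostPlus (u.map _)).map _).map _
  rw [List.map_append, rightmostPlus_append]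
  split_ifs with h
  · rw [Option.map_map, Option.map_map]
    congr 1
    funext p
    simp
  · rw [Option.map_map]
    refine Option.map_congr fun p hp => ?_
    obtain ⟨a, b, h1, rfl, -⟩ := rightmostPlus_eq_some.1 hp
    have := congrArg List.length h1
    simp at this
    simp only [Function.comp_apply]
    rw [List.set_append_left _ _ (by omega)]

/-- The tensor product rule for `e_i`. -/
theorem word_e_append (i : Fin (n - 1)) (u v : List (Fin n)) : (wordCrystal n).e i (u ++ v) =
    if wphi i v < weps i u then ((wordCrystal n).e i u).map (· ++ v)
    else ((wordCrystal n).e i v).map (u ++ ·) := by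
  unfold wphi weps
  change (leftmostMinus ((u ++ v).map _)).map _ = if _ then ((leftmostMinus (u.map _)).map _).map _
    else ((leftmostMinus (v.map _)).map _).map _
  rw [List.map_append, leftmostMinus_append]
  split_ifs with h
  · rw [Option.map_map]
    refine Option.map_congr fun p hp => ?_
    obtain ⟨a, b, h1, rfl, -⟩ := leftmostMinus_eq_some.1 hp
    have := congrArg List.length h1
    simp at this
    simp only [Function.comp_apply]
    rw [List.set_append_left _ _ (by omega)]
  · rw [Option.map_map, Option.map_map]
    congr 1
    funext p
    simp

end Words

/-! ### Kashiwara operators and Knuth equivalence -/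

section KnuthCrystal

variable {n : ℕ}

theorem optionRel_symm {o o' : Option (List (Fin n))} (h : Option.Rel Knuth o o') :
    Option.Rel Knuth o' o := by
  cases h with
  | none => exact .none
  | some h => exact .some h.symm

theorem optionRel_trans {o o' o'' : Option (List (Fin n))} (h : Option.Rel Knuth o o')
    (h' : Option.Rel Knuth o' o'') : Option.Rel Knuth o o'' := by
  cases h with
  | none => exact h'
  | some h => cases h' with
    | some h' => exact .some (h.trans h')

/-- The words `u` and `v` have the same numbers of letters `i` and `i + 1` left after the cancellation,
and the operators `f_i` and `e_i` send them to Knuth equivalent words or both to `0`. -/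
def SameCrystal (i : Fin (n - 1)) (u v : List (Fin n)) : Prop :=
  wphi i u = wphi i v ∧ weps i u = weps i v ∧
    Option.Rel Knuth ((wordCrystal n).f i u) ((wordCrystal n).f i v) ∧
    Option.Rel Knuth ((wordCrystal n).e i u) ((wordCrystal n).e i v)

theorem letter_cases (i : Fin (n - 1)) (x : Fin n) :
    x = lo i ∨ x = hi i ∨ (letterSign i x = SignType.zero ∧ (x.1 < i.1 ∨ i.1 + 1 < x.1)) := by
  by_cases h1 : x = lo i
  · exact .inl h1
  · by_cases h2 : x = hi i
    · exact .inr (.inl h2)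
    · refine .inr (.inr ⟨by simp [letterSign, h1, h2], ?_⟩)
      simp only [lo, hi, Fin.ext_iff] at h1 h2
      omega

theorem letterSign_lo (i : Fin (n - 1)) : letterSign i (lo i) = SignType.pos :=
  letterSign_eq_pos.2 rfl

theorem letterSign_hi (i : Fin (n - 1)) : letterSign i (hi i) = SignType.neg :=
  letterSign_eq_neg.2 rfl

theorem lo_val (i : Fin (n - 1)) : (lo i).1 = i.1 := rfl

theorem hi_val (i : Fin (n - 1)) : (hi i).1 = i.1 + 1 := rfl

/-- The operators respect the relation `xzy ∼ zxy` for `x ≤ y < z`. Each letter is `i`, `i + 1` or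
irrelevant; in each case the resulting words are equal or differ by a relation of either kind. -/
theorem sameCrystal_left (i : Fin (n - 1)) {x y z : Fin n} (h1 : x ≤ y) (h2 : y < z) :
    SameCrystal i [x, z, y] [z, x, y] := by
  rw [Fin.le_def] at h1
  rw [Fin.lt_def] at h2
  rcases letter_cases i x with rfl | rfl | ⟨hx, hx'⟩ <;>
  rcases letter_cases i y with rfl | rfl | ⟨hy, hy'⟩ <;>
  rcases letter_cases i z with rfl | rfl | ⟨hz, hz'⟩ <;>
  (try simp only [lo_val, hi_val] at *) <;>
  first
  | omega
  | (simp only [SameCrystal, wphi, weps, wordCrystal, List.map_cons, List.map_nil, letterSign_lo,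
      letterSign_hi, *]
     refine ⟨by decide, by decide, ?_, ?_⟩ <;>
     first
     | exact .none
     | exact .some (.refl _)
     | (refine .some (.left ?_ ?_) <;>
         simp only [Fin.le_def, Fin.lt_def, lo_val, hi_val] <;> omega)
     | (refine .some (.right ?_ ?_) <;>
         simp only [Fin.le_def, Fin.lt_def, lo_val, hi_val] <;> omega)
     | (refine .some (.symm (.right ?_ ?_)) <;>
         simp only [Fin.le_def, Fin.lt_def, lo_val, hi_val] <;> omega))

/-- The operators respect the relation `yxz ∼ yzx` for `x < y ≤ z`. Each letter is `i`, `i + 1` or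
irrelevant; in each case the resulting words are equal or differ by a relation of either kind. -/
theorem sameCrystal_right (i : Fin (n - 1)) {x y z : Fin n} (h1 : x < y) (h2 : y ≤ z) :
    SameCrystal i [y, x, z] [y, z, x] := by
  rw [Fin.lt_def] at h1
  rw [Fin.le_def] at h2
  rcases letter_cases i x with rfl | rfl | ⟨hx, hx'⟩ <;>
  rcases letter_cases i y with rfl | rfl | ⟨hy, hy'⟩ <;>
  rcases letter_cases i z with rfl | rfl | ⟨hz, hz'⟩ <;>
  (try simp only [lo_val, hi_val] at *) <;>
  first
  | omega
  | (simp only [SameCrystal, wphi, weps, wordCrystal, List.map_cons, List.map_nil, letterSign_lo,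
      letterSign_hi, *]
     refine ⟨by decide, by decide, ?_, ?_⟩ <;>
     first
     | exact .none
     | exact .some (.refl _)
     | (refine .some (.left ?_ ?_) <;>
         simp only [Fin.le_def, Fin.lt_def, lo_val, hi_val] <;> omega)
     | (refine .some (.right ?_ ?_) <;>
         simp only [Fin.le_def, Fin.lt_def, lo_val, hi_val] <;> omega)
     | (refine .some (.symm (.left ?_ ?_)) <;>
         simp only [Fin.le_def, Fin.lt_def, lo_val, hi_val] <;> omega))

end KnuthCrystal

section ColumnCrystal

variable {n : ℕ}

/-- Knuth equivalence is compatible with the Kashiwara operators. -/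
theorem Knuth.sameCrystal {u v : List (Fin n)} (h : Knuth u v) (i : Fin (n - 1)) :
    SameCrystal i u v := by
  induction h with
  | left h1 h2 => exact sameCrystal_left i h1 h2
  | right h1 h2 => exact sameCrystal_right i h1 h2
  | refl u =>
    refine ⟨rfl, rfl, ?_, ?_⟩
    · cases (wordCrystal n).f i u with
      | none => exact .none
      | some w => exact .some (.refl w)
    · cases (wordCrystal n).e i u with
      | none => exact .none
      | some w => exact .some (.refl w)
  | symm _ ih =>
    exact ⟨ih.1.symm, ih.2.1.symm, optionRel_symm ih.2.2.1, optionRel_symm ih.2.2.2⟩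
  | trans _ _ ih ih' =>
    exact ⟨ih.1.trans ih'.1, ih.2.1.trans ih'.2.1, optionRel_trans ih.2.2.1 ih'.2.2.1,
      optionRel_trans ih.2.2.2 ih'.2.2.2⟩
  | @append u u' v v' hu hv ih ih' =>
    have left : ∀ {o o' : Option (List (Fin n))}, Option.Rel Knuth o o' →
        Option.Rel Knuth (o.map (u ++ ·)) (o'.map (u' ++ ·)) := by
      rintro _ _ (h | _)
      · exact .some (hu.append h)
      · exact .none
    have right : ∀ {o o' : Option (List (Fin n))}, Option.Rel Knuth o o' →
        Option.Rel Knuth (o.map (· ++ v)) (o'.map (· ++ v')) := by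
      rintro _ _ (h | _)
      · exact .some (h.append hv)
      · exact .none
    refine ⟨?_, ?_, ?_, ?_⟩
    · rw [wphi_append, wphi_append, ih.1, ih.2.1, ih'.1]
    · rw [weps_append, weps_append, ih.2.1, ih'.1, ih'.2.1]
    · rw [word_f_append, word_f_append, ih.2.1, ih'.1]
      split_ifs
      · exact left ih'.2.2.1
      · exact right ih.2.2.1
    · rw [word_e_append, word_e_append, ih.2.1, ih'.1]
      split_ifs
      · exact right ih.2.2.2
      · exact left ih'.2.2.2

theorem Knuth.exists_arrow {u v u' : List (Fin n)} (h : Knuth u v) {i : Fin (n - 1)}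
    (hu : WArrow i u u') : ∃ v', WArrow i v v' ∧ Knuth u' v' := by
  have h1 := (h.sameCrystal i).2.2.1
  rw [word_f_iff.2 hu] at h1
  generalize hv : (wordCrystal n).f i v = o at h1
  cases h1 with
  | some h1 => exact ⟨_, word_f_iff.1 hv, h1⟩

theorem Knuth.exists_arrow' {u v u' : List (Fin n)} (h : Knuth u v) {i : Fin (n - 1)}
    (hu : WArrow i u' u) : ∃ v', WArrow i v' v ∧ Knuth u' v' := by
  have h1 := (h.sameCrystal i).2.2.2
  rw [word_e_iff.2 hu] at h1
  generalize hv : (wordCrystal n).e i v = o at h1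
  cases h1 with
  | some h1 => exact ⟨_, word_e_iff.1 hv, h1⟩

theorem WArrow.right_unique {i : Fin (n - 1)} {u v v' : List (Fin n)} (h : WArrow i u v)
    (h' : WArrow i u v') : v = v' :=
  Option.some_injective _ ((word_f_iff.2 h).symm.trans (word_f_iff.2 h'))

theorem WArrow.left_unique {i : Fin (n - 1)} {u u' v : List (Fin n)} (h : WArrow i u v)
    (h' : WArrow i u' v) : u = u' :=
  Option.some_injective _ ((word_e_iff.2 h).symm.trans (word_e_iff.2 h'))

/-! ### Kashiwara operators on strings of columns -/

theorem colSign_eq_pos {i : Fin (n - 1)} {c : List (Fin n)} :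
    colSign i c = SignType.pos ↔ lo i ∈ c ∧ hi i ∉ c := by
  unfold colSign
  split_ifs <;> simp_all

theorem colSign_eq_neg {i : Fin (n - 1)} {c : List (Fin n)} :
    colSign i c = SignType.neg ↔ hi i ∈ c ∧ lo i ∉ c := by
  unfold colSign
  split_ifs <;> simp_all

theorem modify_append_cons {α : Type*} (a b : List α) (c : α) (f : α → α) :
    (a ++ c :: b).modify a.length f = a ++ f c :: b := by
  induction a with
  | nil => rfl
  | cons d a ih => simpa using ih

/-- Replaces the letter `i` by `i + 1`. -/
def raise (i : Fin (n - 1)) (x : Fin n) : Fin n := if x = lo i then hi i else x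

/-- Replaces the letter `i + 1` by `i`. -/
def lower (i : Fin (n - 1)) (x : Fin n) : Fin n := if x = hi i then lo i else x

/-- The arrows of the crystal graph of strings of columns, in analogy with `WArrow`: the column `c`
contains `i` but not `i + 1`, and it is left after the cancellation. -/
def CArrow (i : Fin (n - 1)) (w w' : ColString n) : Prop :=
  ∃ a c b, w.cols = a ++ c :: b ∧ w' = ⟨a ++ c.map (raise i) :: b, w.glue⟩ ∧
    lo i ∈ c ∧ hi i ∉ c ∧ eps (a.map (colSign i)) = 0 ∧ phi (b.map (colSign i)) = 0

theorem lower_raise {i : Fin (n - 1)} {c : List (Fin n)} (h : hi i ∉ c) :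
    (c.map (raise i)).map (lower i) = c := by
  rw [List.map_map]
  conv_rhs => rw [← List.map_id c]
  refine List.map_congr_left fun x hx => ?_
  have : x ≠ hi i := fun h' => h (h' ▸ hx)
  simp only [Function.comp_apply, raise, lower, id]
  split_ifs <;> simp_all

theorem raise_lower {i : Fin (n - 1)} {c : List (Fin n)} (h : lo i ∉ c) :
    (c.map (lower i)).map (raise i) = c := by
  rw [List.map_map]
  conv_rhs => rw [← List.map_id c]
  refine List.map_congr_left fun x hx => ?_
  have : x ≠ lo i := fun h' => h (h' ▸ hx)
  simp only [Function.comp_apply, raise, lower, id]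
  split_ifs <;> simp_all

theorem mem_raise {i : Fin (n - 1)} {c : List (Fin n)} (h : lo i ∈ c) :
    hi i ∈ c.map (raise i) ∧ lo i ∉ c.map (raise i) := by
  refine ⟨List.mem_map.2 ⟨lo i, h, by simp [raise]⟩, fun h' => ?_⟩
  obtain ⟨x, -, hx⟩ := List.mem_map.1 h'
  have := lo_ne_hi i
  unfold raise at hx
  split_ifs at hx <;> simp_all

theorem mem_lower {i : Fin (n - 1)} {c : List (Fin n)} (h : hi i ∈ c) :
    lo i ∈ c.map (lower i) ∧ hi i ∉ c.map (lower i) := by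
  refine ⟨List.mem_map.2 ⟨hi i, h, by simp [lower]⟩, fun h' => ?_⟩
  obtain ⟨x, -, hx⟩ := List.mem_map.1 h'
  have := lo_ne_hi i
  unfold lower at hx
  split_ifs at hx <;> simp_all

theorem col_f_iff {i : Fin (n - 1)} {w w' : ColString n} :
    (colCrystal n).f i w = some w' ↔ CArrow i w w' := by
  refine map_rightmostPlus_eq_some.trans ?_
  constructor
  · rintro ⟨a, c, b, h0, h1, h2, h3, rfl⟩
    rw [colSign_eq_pos] at h1
    exact ⟨a, c, b, h0, by rw [h0, modify_append_cons]; rfl, h1.1, h1.2, h2, h3⟩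
  · rintro ⟨a, c, b, h0, rfl, h1, h2, h3, h4⟩
    exact ⟨a, c, b, h0, colSign_eq_pos.2 ⟨h1, h2⟩, h3, h4, by rw [h0, modify_append_cons]; rfl⟩

theorem col_e_iff {i : Fin (n - 1)} {w w' : ColString n} :
    (colCrystal n).e i w' = some w ↔ CArrow i w w' := by
  refine map_leftmostMinus_eq_some.trans ?_
  constructor
  · rintro ⟨a, c, b, h0, h1, h2, h3, rfl⟩
    rw [colSign_eq_neg] at h1
    have h5 := mem_lower h1.1
    refine ⟨a, c.map (lower i), b, ?_, ?_, h5.1, h5.2, h2, h3⟩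
    · simp only [h0, modify_append_cons]; rfl
    · rw [raise_lower h1.2, ← h0]
  · rintro ⟨a, c, b, h0, rfl, h1, h2, h3, h4⟩
    have h5 := mem_raise h1
    refine ⟨a, _, b, rfl, colSign_eq_neg.2 h5, h3, h4, ?_⟩
    refine ColString.ext ?_ rfl
    rw [h0]
    simp only [modify_append_cons]
    exact congrArg (fun c => a ++ c :: b) (lower_raise h2)

theorem col_f_eq_none {i : Fin (n - 1)} {w : ColString n} :
    (colCrystal n).f i w = none ↔ phi (w.cols.map (colSign i)) = 0 :=
  Option.map_eq_none_iff.trans rightmostPlus_eq_none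

theorem col_e_eq_none {i : Fin (n - 1)} {w : ColString n} :
    (colCrystal n).e i w = none ↔ eps (w.cols.map (colSign i)) = 0 :=
  Option.map_eq_none_iff.trans leftmostMinus_eq_none

end ColumnCrystal

/-! ### Readings and Kashiwara operators -/

section Reading

variable {n : ℕ}

theorem colSign_cons_of_zero {i : Fin (n - 1)} {a : Fin n} {c : List (Fin n)} (h1 : a ≠ lo i)
    (h2 : a ≠ hi i) : colSign i (a :: c) = colSign i c := by
  simp [colSign, h1.symm, h2.symm]

/-- A column has the same signature as its reading. -/
theorem signature_reverse (i : Fin (n - 1)) {c : List (Fin n)} (hc : c.Pairwise (· < ·)) :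
    wphi i c.reverse = phi [colSign i c] ∧ weps i c.reverse = eps [colSign i c] := by
  induction c with
  | nil =>
    have : colSign i ([] : List (Fin n)) = SignType.zero := by simp [colSign]
    rw [this]
    exact ⟨rfl, rfl⟩
  | cons a c ih =>
    have hc' := List.pairwise_cons.1 hc
    obtain ⟨h1, h2⟩ := ih hc'.2
    have hlh := lo_lt_hi i
    have e1 : wphi i [a] = phi [letterSign i a] := rfl
    have e2 : weps i [a] = eps [letterSign i a] := rfl
    rw [List.reverse_cons, wphi_append, weps_append, h1, h2, e1, e2]
    rcases letter_cases i a with rfl | rfl | ⟨ha, ha'⟩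
    · have hlo : lo i ∉ c := fun h => lt_irrefl _ (hc'.1 _ h)
      by_cases hhi : hi i ∈ c
      · rw [colSign_eq_neg.2 ⟨hhi, hlo⟩, letterSign_lo,
          show colSign i (lo i :: c) = SignType.zero by simp [colSign, hhi]]
        decide
      · rw [colSign_eq_pos.2 ⟨List.mem_cons_self, fun h => ?_⟩, letterSign_lo,
          show colSign i c = SignType.zero by simp [colSign, hhi, hlo]]
        · decide
        · rcases List.mem_cons.1 h with h | h
          · exact lo_ne_hi i h.symm
          · exact hhi h
    · have hhi : hi i ∉ c := fun h => lt_irrefl _ (hc'.1 _ h)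
      have hlo : lo i ∉ c := fun h => lt_asymm hlh (hc'.1 _ h)
      rw [colSign_eq_neg.2 ⟨List.mem_cons_self, fun h => ?_⟩, letterSign_hi,
        show colSign i c = SignType.zero by simp [colSign, hhi, hlo]]
      · decide
      · rcases List.mem_cons.1 h with h | h
        · exact lo_ne_hi i h
        · exact hlo h
    · rw [ha, colSign_cons_of_zero]
      · generalize colSign i c = s
        revert s
        decide
      · rintro rfl; rw [letterSign_lo] at ha; simp at ha
      · rintro rfl; rw [letterSign_hi] at ha; simp at ha

theorem signature_colRead (i : Fin (n - 1)) {cs : List (List (Fin n))}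
    (h : ∀ c ∈ cs, c.Pairwise (· < ·)) :
    wphi i (colRead cs) = phi (cs.map (colSign i)) ∧
      weps i (colRead cs) = eps (cs.map (colSign i)) := by
  induction cs with
  | nil => exact ⟨rfl, rfl⟩
  | cons c cs ih =>
    obtain ⟨h1, h2⟩ := ih fun c hc => h c (List.mem_cons_of_mem _ hc)
    obtain ⟨h3, h4⟩ := signature_reverse i (h c List.mem_cons_self)
    rw [colRead_cons, wphi_append, weps_append, List.map_cons,
      phi_cons (colSign i c) (cs.map _), eps_cons (colSign i c) (cs.map _), h1, h2, h3, h4]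
    exact ⟨rfl, rfl⟩

theorem skew_pairwise {w : ColString n} (hw : w ∈ Skew n) : ∀ c ∈ w.cols, c.Pairwise (· < ·) :=
  fun c hc => (hw.1.1 c hc).2

theorem colRead_append (a b : List (List (Fin n))) : colRead (a ++ b) = colRead a ++ colRead b := by
  simp [colRead]

/-- The reading map commutes with the Kashiwara operators. -/
theorem CArrow.read {i : Fin (n - 1)} {w w' : ColString n} (h : CArrow i w w')
    (hw : ∀ c ∈ w.cols, c.Pairwise (· < ·)) : WArrow i w.read w'.read := by
  obtain ⟨a, c, b, h0, rfl, h1, h2, h3, h4⟩ := h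
  rw [h0] at hw
  have hc : c.Pairwise (· < ·) := hw c (by simp)
  obtain ⟨h5, h6⟩ := signature_colRead i fun d (hd : d ∈ a) => hw d (by simp [hd])
  obtain ⟨h7, h8⟩ := signature_colRead i fun d (hd : d ∈ b) => hw d (by simp [hd])
  obtain ⟨c1, c2, rfl⟩ := List.append_of_mem h1
  have hc1 := List.pairwise_append.1 hc
  have hc2 := List.pairwise_cons.1 hc1.2.1
  have l1 : ∀ x ∈ c1, x ≠ lo i := fun x hx => (hc1.2.2 x hx _ List.mem_cons_self).ne
  have l2 : ∀ x ∈ c2, x ≠ lo i := fun x hx => (hc2.1 x hx).ne'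
  have hr : ∀ {d : List (Fin n)}, (∀ x ∈ d, x ≠ lo i) → d.map (raise i) = d := by
    intro d hd
    conv_rhs => rw [← List.map_id d]
    exact List.map_congr_left fun x hx => by simp [raise, hd x hx]
  have hz : ∀ {d : List (Fin n)}, d.Pairwise (· < ·) → lo i ∉ d → hi i ∉ d →
      wphi i d.reverse = 0 ∧ weps i d.reverse = 0 := by
    intro d hd hlo hhi
    have h := signature_reverse i hd
    rw [show colSign i d = SignType.zero by simp [colSign, hlo, hhi]] at h
    exact h
  obtain ⟨z1, z2⟩ := hz hc1.1 (fun h => l1 _ h rfl) (fun h => h2 (by simp [h]))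
  obtain ⟨z3, z4⟩ := hz hc2.2 (fun h => l2 _ h rfl) (fun h => h2 (by simp [h]))
  refine ⟨colRead a ++ c2.reverse, c1.reverse ++ colRead b, ?_, ?_, ?_, ?_⟩
  · rw [read_eq_colRead, h0, colRead_append, colRead_cons]
    simp
  · rw [read_eq_colRead, colRead_append, colRead_cons, List.map_append, List.map_cons, hr l1, hr l2]
    simp [raise]
  · rw [weps_append, z4, h6, h3]
    simp
  · rw [wphi_append, z1, h7, h4]
    simp

/-! ### Skew tableaux are stable under the Kashiwara operators -/

theorem pairwise_map_raise {i : Fin (n - 1)} {c : List (Fin n)} (hc : c.Pairwise (· < ·))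
    (h : hi i ∉ c) : (c.map (raise i)).Pairwise (· < ·) := by
  rw [List.pairwise_map]
  refine hc.imp_of_mem fun {x y} hx hy hxy => ?_
  have hy' : y ≠ hi i := fun h' => h (h' ▸ hy)
  have e1 := lo_val i
  have e2 := hi_val i
  simp only [raise, Fin.lt_def, ne_eq, Fin.ext_iff] at *
  split_ifs <;> omega

theorem pairwise_map_lower {i : Fin (n - 1)} {c : List (Fin n)} (hc : c.Pairwise (· < ·))
    (h : lo i ∉ c) : (c.map (lower i)).Pairwise (· < ·) := by
  rw [List.pairwise_map]
  refine hc.imp_of_mem fun {x y} hx hy hxy => ?_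
  have hx' : x ≠ lo i := fun h' => h (h' ▸ hx)
  have e1 := lo_val i
  have e2 := hi_val i
  simp only [lower, Fin.lt_def, ne_eq, Fin.ext_iff] at *
  split_ifs <;> omega

theorem lt_of_getElem?_lt {s : List (Fin n)} (hs : s.Pairwise (· < ·)) {j k : ℕ} {x y : Fin n}
    (hx : s[j]? = some x) (hy : s[k]? = some y) (hxy : x < y) : j < k := by
  obtain ⟨h1, rfl⟩ := List.getElem?_eq_some_iff.1 hx
  obtain ⟨h2, rfl⟩ := List.getElem?_eq_some_iff.1 hy
  by_contra h
  rcases (not_lt.1 h).eq_or_lt with h | h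
  · subst h
    exact lt_irrefl _ hxy
  · exact lt_asymm hxy (List.pairwise_iff_getElem.1 hs _ _ h2 h1 h)

theorem getElem?_lt {s : List (Fin n)} (hs : s.Pairwise (· < ·)) {j k : ℕ} {x y : Fin n}
    (hx : s[j]? = some x) (hy : s[k]? = some y) (hjk : j < k) : x < y := by
  obtain ⟨h1, rfl⟩ := List.getElem?_eq_some_iff.1 hx
  obtain ⟨h2, rfl⟩ := List.getElem?_eq_some_iff.1 hy
  exact List.pairwise_iff_getElem.1 hs _ _ h1 h2 hjk

/-- An arrow changes one column `p`. The next column is not a `+`, and the previous one is not a `-`,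
since these would be left after the cancellation. -/
theorem CArrow.exists_col {i : Fin (n - 1)} {w w' : ColString n} (h : CArrow i w w') :
    w'.glue = w.glue ∧ w'.cols.length = w.cols.length ∧ ∃ p < w.cols.length,
      (∀ k, k ≠ p → w'.col k = w.col k) ∧ w'.col p = (w.col p).map (raise i) ∧ lo i ∈ w.col p ∧
      hi i ∉ w.col p ∧ (lo i ∈ w.col (p + 1) → hi i ∈ w.col (p + 1)) ∧
      ∀ k, k + 1 = p → hi i ∈ w.col k → lo i ∈ w.col k := by
  obtain ⟨a, c, b, h0, rfl, h1, h2, h3, h4⟩ := h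
  have hp : w.col a.length = c := by
    simp [ColString.col, h0, List.getD_eq_getElem?_getD]
  refine ⟨rfl, by simp [h0], a.length, by simp [h0], fun k hk => ?_, ?_, hp ▸ h1, hp ▸ h2, ?_, ?_⟩
  · simp only [ColString.col, h0, List.getD_eq_getElem?_getD]
    rcases lt_or_gt_of_ne hk with hk | hk
    · rw [List.getElem?_append_left hk, List.getElem?_append_left hk]
    · obtain ⟨m, rfl⟩ := Nat.exists_eq_add_of_lt hk
      rw [List.getElem?_append_right (by omega), List.getElem?_append_right (by omega),
        show a.length + m + 1 - a.length = m + 1 by omega]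
      rfl
  · rw [hp]
    simp [ColString.col, List.getD_eq_getElem?_getD]
  · intro hlo
    by_contra hhi
    have hb : w.col (a.length + 1) = b.getD 0 [] := by
      simp only [ColString.col, h0, List.getD_eq_getElem?_getD]
      rw [List.getElem?_append_right (by omega), Nat.add_sub_cancel_left]
      rfl
    cases b with
    | nil => simp [hb] at hlo
    | cons d b =>
      rw [hb, List.getD_cons_zero] at hlo hhi
      rw [List.map_cons, colSign_eq_pos.2 ⟨hlo, hhi⟩, phi_cons] at h4
      simp [phi_singleton] at h4
  · rintro k hk hhi
    by_contra hlo
    obtain ⟨a', d, rfl⟩ : ∃ a' d, a = a' ++ [d] :=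
      ⟨a.dropLast, a.getLast (by rintro rfl; simp at hk), (List.dropLast_append_getLast _).symm⟩
    have hka : k = a'.length := by simpa using hk
    have hd : w.col k = d := by
      rw [hka]
      simp [ColString.col, h0, List.getD_eq_getElem?_getD]
    rw [hd] at hhi hlo
    rw [List.map_append, List.map_singleton, colSign_eq_neg.2 ⟨hhi, hlo⟩, eps_append] at h3
    simp [eps_singleton] at h3

theorem skew_iff {w : ColString n} : w ∈ Skew n ↔ w.glue.length = w.cols.length - 1 ∧
    (∀ k < w.cols.length, w.col k ≠ [] ∧ (w.col k).Pairwise (· < ·)) ∧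
    ∀ k, k + 1 < w.cols.length →
    1 ≤ w.pos k ∧ w.pos k ≤ (w.col k).length ∧ w.pos k ≤ (w.col (k + 1)).length ∧
    ∀ (j l : ℕ) (x y : Fin n), (j : ℤ) = l + (w.pos k - (w.col (k + 1)).length) →
      (w.col k)[j]? = some x → (w.col (k + 1))[l]? = some y → x ≤ y := by
  constructor
  · rintro hw
    exact ⟨hw.1.2, fun k hk => ⟨cols_ne_nil hw hk, col_pairwise hw k⟩, hw.2⟩
  · rintro ⟨h1, h2, h3⟩
    refine ⟨⟨fun c hc => ?_, h1⟩, h3⟩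
    obtain ⟨k, hk, rfl⟩ := List.getElem_of_mem hc
    rw [← col_eq_getElem w hk]
    exact h2 k hk

theorem CArrow.skew {i : Fin (n - 1)} {w w' : ColString n} (h : CArrow i w w')
    (hw : w ∈ Skew n) : w' ∈ Skew n := by
  obtain ⟨hg, hlen, p, hp, hne, heq, hlo, hhi, hnext, -⟩ := h.exists_col
  have hpos : ∀ k, w'.pos k = w.pos k := fun k => by rw [ColString.pos, ColString.pos, hg]
  have hcl : ∀ k, (w'.col k).length = (w.col k).length := fun k => by
    by_cases hk : k = p
    · rw [hk, heq, List.length_map]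
    · rw [hne k hk]
  rw [skew_iff] at hw ⊢
  obtain ⟨h1, h2, h3⟩ := hw
  refine ⟨by rw [hg, hlen, h1], fun k hk => ?_, fun k hk => ?_⟩
  · rw [hlen] at hk
    by_cases hkp : k = p
    · subst hkp
      rw [heq]
      exact ⟨by simpa using (h2 k hk).1, pairwise_map_raise (h2 k hk).2 hhi⟩
    · rw [hne k hkp]
      exact h2 k hk
  · rw [hlen] at hk
    obtain ⟨h4, h5, h6, h7⟩ := h3 k hk
    rw [hpos, hcl, hcl]
    refine ⟨h4, h5, h6, fun j l x y hjl hx hy => ?_⟩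
    by_cases hkp : k = p
    · subst hkp
      rw [hne (k + 1) (by omega)] at hy
      rw [heq, List.getElem?_map, Option.map_eq_some_iff] at hx
      obtain ⟨x, hx, rfl⟩ := hx
      have hxy := h7 j l x y hjl hx hy
      unfold raise
      split_ifs with hxl
      · subst hxl
        rcases hxy.eq_or_lt with rfl | hxy
        · -- an entry `i` to the right would have an `i + 1` below it, hence so would the left one
          obtain ⟨l', hl'⟩ := List.mem_iff_getElem?.1 (hnext (List.mem_of_getElem? hy))
          have hll := lt_of_getElem?_lt (h2 _ hk).2 hy hl' (lo_lt_hi i)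
          have hl2 := (List.getElem?_eq_some_iff.1 hl').1
          obtain ⟨z, hz⟩ : ∃ z, (w.col k)[j + (l' - l)]? = some z := by
            rw [← Option.isSome_iff_exists, isSome_getElem?]
            omega
          have h8 := h7 _ l' z _ (by omega) hz hl'
          have h9 := getElem?_lt (h2 k hp).2 hx hz (by omega)
          refine absurd (List.mem_of_getElem? hz) ?_
          have : z = hi i := by
            have e1 := lo_val i
            have e2 := hi_val i
            rw [Fin.le_def] at h8
            rw [Fin.lt_def] at h9
            exact Fin.ext (by omega)
          rwa [this]
        · have e1 := lo_val i
          have e2 := hi_val i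
          rw [Fin.lt_def] at hxy
          rw [Fin.le_def]
          omega
      · exact hxy
    · rw [hne k hkp] at hx
      by_cases hkp' : k + 1 = p
      · rw [hkp', heq, List.getElem?_map, Option.map_eq_some_iff] at hy
        obtain ⟨y, hy, rfl⟩ := hy
        rw [← hkp'] at hy
        refine (h7 j l x y hjl hx hy).trans ?_
        unfold raise
        split_ifs with hyl
        · rw [hyl]; exact (lo_lt_hi i).le
        · exact le_rfl
      · rw [hne _ hkp'] at hy
        exact h7 j l x y hjl hx hy

theorem CArrow.skew' {i : Fin (n - 1)} {w w' : ColString n} (h : CArrow i w' w)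
    (hw : w ∈ Skew n) : w' ∈ Skew n := by
  obtain ⟨hg, hlen, p, hp, hne, heq, hlo, hhi, -, hprev⟩ := h.exists_col
  have hpos : ∀ k, w'.pos k = w.pos k := fun k => by rw [ColString.pos, ColString.pos, hg]
  have hcl : ∀ k, (w'.col k).length = (w.col k).length := fun k => by
    by_cases hk : k = p
    · rw [hk, heq, List.length_map]
    · rw [hne k hk]
  have hmem := mem_raise hlo
  have hlow := lower_raise hhi
  rw [← heq] at hmem hlow
  rw [skew_iff] at hw ⊢
  obtain ⟨h1, h2, h3⟩ := hw
  rw [hlen] at h1 h2 h3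
  refine ⟨by rw [← hg, h1], fun k hk => ?_, fun k hk => ?_⟩
  · by_cases hkp : k = p
    · subst hkp
      refine ⟨List.ne_nil_of_mem hlo, ?_⟩
      rw [← hlow]
      exact pairwise_map_lower (h2 k hk).2 hmem.2
    · rw [← hne k hkp]
      exact h2 k hk
  · obtain ⟨h4, h5, h6, h7⟩ := h3 k hk
    rw [hpos, hcl, hcl]
    refine ⟨h4, h5, h6, fun j l x y hjl hx hy => ?_⟩
    by_cases hkp : k = p
    · subst hkp
      rw [← hne (k + 1) (by omega)] at hy
      rw [← hlow, List.getElem?_map, Option.map_eq_some_iff] at hx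
      obtain ⟨x, hx, rfl⟩ := hx
      refine le_trans ?_ (h7 j l x y hjl hx hy)
      unfold lower
      split_ifs with hxl
      · rw [hxl]; exact (lo_lt_hi i).le
      · exact le_rfl
    · rw [← hne k hkp] at hx
      by_cases hkp' : k + 1 = p
      · subst hkp'
        rw [← hlow, List.getElem?_map, Option.map_eq_some_iff] at hy
        obtain ⟨y, hy, rfl⟩ := hy
        have hxy := h7 j l x y hjl hx hy
        unfold lower
        split_ifs with hyl
        · subst hyl
          rcases hxy.eq_or_lt with rfl | hxy
          · -- an `i + 1` to the left would have an `i` above it, hence so would the right one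
            have hx' := hx
            rw [hne k (by omega)] at hx'
            obtain ⟨j', hj'⟩ := List.mem_iff_getElem?.1 (hprev k rfl (List.mem_of_getElem? hx'))
            rw [← hne k (by omega)] at hj'
            have hk' : k < w'.cols.length := by omega
            have hjj := lt_of_getElem?_lt (h2 _ hk').2 hj' hx (lo_lt_hi i)
            have hl := (List.getElem?_eq_some_iff.1 hy).1
            obtain ⟨z, hz⟩ : ∃ z, (w.col (k + 1))[l - (j - j')]? = some z := by
              rw [← Option.isSome_iff_exists, isSome_getElem?]
              omega
            have h8 := h7 j' _ _ z (by omega) hj' hz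
            have h9 := getElem?_lt (h2 _ hp).2 hz hy (by omega)
            refine absurd (List.mem_of_getElem? hz) ?_
            have : z = lo i := by
              have e1 := lo_val i
              have e2 := hi_val i
              rw [Fin.le_def] at h8
              rw [Fin.lt_def] at h9
              exact Fin.ext (by omega)
            rw [this]
            exact hmem.2
          · have e1 := lo_val i
            have e2 := hi_val i
            rw [Fin.lt_def] at hxy
            rw [Fin.le_def]
            omega
        · exact hxy
      · rw [← hne _ hkp'] at hy
        exact h7 j l x y hjl hx hy

theorem CArrow.skew_iff {i : Fin (n - 1)} {w w' : ColString n} (h : CArrow i w w') :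
    w ∈ Skew n ↔ w' ∈ Skew n := ⟨h.skew, h.skew'⟩

theorem CArrow.dskew_iff {i : Fin (n - 1)} {w w' : ColString n} (h : CArrow i w w') :
    w ∈ DSkew n ↔ w' ∈ DSkew n := by
  have h1 := h.exists_col.1
  simp only [DSkew, Set.mem_ofPred_eq, h.skew_iff, h1]

theorem CArrow.map_length {i : Fin (n - 1)} {w w' : ColString n} (h : CArrow i w w') :
    w'.cols.map List.length = w.cols.map List.length := by
  obtain ⟨a, c, b, h0, rfl, -⟩ := h
  simp [h0]

/-- The Kashiwara operators preserve Young tableaux, as they preserve the shape. -/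
theorem CArrow.young_iff {i : Fin (n - 1)} {w w' : ColString n} (h : CArrow i w w') :
    w ∈ Young n ↔ w' ∈ Young n := by
  have hlen : ∀ k, (w'.col k).length = (w.col k).length := by
    intro k
    have := congrArg (fun l => l[k]?) h.map_length
    simp only [List.getElem?_map] at this
    simp only [ColString.col, List.getD_eq_getElem?_getD]
    cases h1 : w'.cols[k]? <;> cases h2 : w.cols[k]? <;> simp_all
  obtain ⟨h1, h2, -⟩ := h.exists_col
  have hpos : ∀ k, w'.pos k = w.pos k := fun k => by rw [ColString.pos, ColString.pos, h1]
  simp only [Young, Set.mem_ofPred_eq, h.skew_iff, h2, hlen, hpos]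

theorem exists_carrow_of_read {i : Fin (n - 1)} {w : ColString n} (hw : w ∈ Skew n)
    {v : List (Fin n)} (h : WArrow i w.read v) : ∃ w', CArrow i w w' ∧ w'.read = v := by
  have h1 : wphi i w.read ≠ 0 := fun h0 => by
    have := word_f_eq_none.2 h0
    rw [word_f_iff.2 h] at this
    simp at this
  rw [read_eq_colRead, (signature_colRead i (skew_pairwise hw)).1] at h1
  obtain ⟨w', hw'⟩ := Option.ne_none_iff_exists'.1 (mt col_f_eq_none.1 h1)
  rw [col_f_iff] at hw'
  exact ⟨w', hw', (hw'.read (skew_pairwise hw)).right_unique h⟩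

theorem exists_carrow_of_read' {i : Fin (n - 1)} {w : ColString n} (hw : w ∈ Skew n)
    {v : List (Fin n)} (h : WArrow i v w.read) : ∃ w', CArrow i w' w ∧ w'.read = v := by
  have h1 : weps i w.read ≠ 0 := fun h0 => by
    have := word_e_eq_none.2 h0
    rw [word_e_iff.2 h] at this
    simp at this
  rw [read_eq_colRead, (signature_colRead i (skew_pairwise hw)).2] at h1
  obtain ⟨w', hw'⟩ := Option.ne_none_iff_exists'.1 (mt col_e_eq_none.1 h1)
  rw [col_e_iff] at hw'
  exact ⟨w', hw', (hw'.read (skew_pairwise (hw'.skew_iff.2 hw))).left_unique h⟩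

end Reading

section Uniqueness

variable {n : ℕ}

/-! ### Highest weight elements -/

/-- The column consisting of the letters `1, 2, …, m` for some `m`. -/
def IsInitial (s : List (Fin n)) : Prop := ∀ (k : ℕ) (x : Fin n), s[k]? = some x → x.1 = k

theorem IsInitial.ext {c d : List (Fin n)} (hc : IsInitial c) (hd : IsInitial d)
    (h : c.length = d.length) : c = d :=
  List.ext_getElem h fun k h1 h2 => Fin.ext <|
    (hc k _ (List.getElem?_eq_getElem h1)).trans (hd k _ (List.getElem?_eq_getElem h2)).symm

/-- The entry at position `k` of a column, counted from `0`, is at least the `k`-th letter. -/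
theorem index_le {s : List (Fin n)} (hs : s.Pairwise (· < ·)) {k : ℕ} {x : Fin n}
    (hx : s[k]? = some x) : k ≤ x.1 := by
  induction k generalizing x with
  | zero => exact Nat.zero_le _
  | succ k ih =>
    have hk := (List.getElem?_eq_some_iff.1 hx).1
    have h1 := ih (List.getElem?_eq_getElem (Nat.lt_of_succ_lt hk))
    have h2 := getElem?_lt hs (List.getElem?_eq_getElem (Nat.lt_of_succ_lt hk)) hx (by omega)
    rw [Fin.lt_def] at h2
    omega

theorem isInitial_of_closed {c : List (Fin n)} (hc : c.Pairwise (· < ·))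
    (h : ∀ i : Fin (n - 1), hi i ∈ c → lo i ∈ c) : IsInitial c := by
  intro k
  induction k using Nat.strong_induction_on with
  | _ k ih =>
    intro x hx
    have h1 := index_le hc hx
    by_contra hne
    obtain ⟨m, hm⟩ : ∃ m, x.1 = m + 1 := ⟨x.1 - 1, by omega⟩
    have hxn := x.2
    have hxi : x = hi ⟨m, by omega⟩ := Fin.ext hm
    have h2 := h ⟨m, by omega⟩ (hxi ▸ List.mem_of_getElem? hx)
    obtain ⟨k', hk'⟩ := List.mem_iff_getElem?.1 h2
    have h3 := lt_of_getElem?_lt hc hk' hx (by rw [Fin.lt_def, hm]; exact Nat.lt_succ_self m)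
    have h4 := ih k' h3 _ hk'
    rw [lo_val] at h4
    simp only at h4
    omega

theorem exists_pos_of_phi {s : List SignType} (h : phi s ≠ 0) : SignType.pos ∈ s := by
  obtain ⟨p, hp⟩ := Option.ne_none_iff_exists'.1 (mt rightmostPlus_eq_none.1 h)
  obtain ⟨a, b, rfl, -⟩ := rightmostPlus_eq_some.1 hp
  simp

/-- The columns of a Young tableau of highest weight are initial. -/
theorem isInitial_of_highest {cs : List (List (Fin n))} (h : Tab (· ≤ ·) cs)
    (h0 : ∀ i, eps (cs.map (colSign i)) = 0) : ∀ c ∈ cs, IsInitial c := by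
  induction cs with
  | nil => simp
  | cons c cs ih =>
    have h1 := tab_cons.1 h
    have h2 : ∀ i, eps (cs.map (colSign i)) = 0 ∧
        (colSign i c = SignType.neg → phi (cs.map (colSign i)) ≠ 0) := by
      intro i
      have := h0 i
      rw [List.map_cons, eps_cons] at this
      refine ⟨by omega, fun hc hp => ?_⟩
      rw [hc, hp] at this
      simp [eps_singleton] at this
    have h3 := ih h1.2.2 fun i => (h2 i).1
    have hc : c.Pairwise (· < ·) := h1.1.2.imp fun hab => not_le.1 hab
    intro d hd
    rcases List.mem_cons.1 hd with rfl | hd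
    · refine isInitial_of_closed hc fun i hhi => ?_
      by_contra hlo
      -- The sign `-` of the first column is cancelled by a column `d'` that contains `i`. Since `d'`
      -- is initial, this `i` lies in row `i`, so the first column contains it in the same row.
      obtain ⟨d', hd', hs⟩ := List.mem_map.1
        (exists_pos_of_phi ((h2 i).2 (colSign_eq_neg.2 ⟨hhi, hlo⟩)))
      have h4 := (colSign_eq_pos.1 hs).1
      obtain ⟨k, hk⟩ := List.mem_iff_getElem?.1 h4
      have h5 := h3 d' hd' k _ hk
      obtain ⟨e, es, rfl⟩ := List.exists_cons_of_ne_nil (List.ne_nil_of_mem hd')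
      have h6 : Dom (· ≤ ·) d e := h1.2.1 e rfl
      have h7 : d'.length ≤ e.length := by
        rcases List.mem_cons.1 hd' with rfl | hd'
        · exact le_rfl
        · exact (le_maxLength hd').trans h1.2.2.maxLength_le
      have h8 := (List.getElem?_eq_some_iff.1 hk).1
      obtain ⟨h9, h10⟩ := dom_iff.1 h6
      have h11 := List.getElem?_eq_getElem (h8.trans_le h7)
      have h12 := List.getElem?_eq_getElem ((h8.trans_le h7).trans_le h9)
      have h13 := h10 k _ _ h12 h11
      have h14 := h3 e List.mem_cons_self k _ h11
      have h15 := index_le hc h12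
      rw [Fin.le_def] at h13
      rw [lo_val] at h5
      refine hlo ?_
      have : lo i = d[k] := Fin.ext (by rw [lo_val]; omega)
      rw [this]
      exact List.getElem_mem _
    · exact h3 d hd

theorem length_le_of_initial {s c' : List (Fin n)} {cs cs' : List (List (Fin n))}
    (h' : Tab (· ≤ ·) (c' :: cs')) (hi : IsInitial s) (hi' : ∀ d ∈ c' :: cs', IsInitial d)
    (hm : ∀ x ∈ colRead (s :: cs), x ∈ colRead (c' :: cs')) : s.length ≤ c'.length := by
  by_contra hlt
  have h1 : s.length - 1 < s.length := by omega
  have h2 := hi _ _ (List.getElem?_eq_getElem h1)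
  have h3 := hm s[s.length - 1] (by simp)
  simp only [colRead, List.mem_flatten, List.mem_map] at h3
  obtain ⟨_, ⟨d, hd, rfl⟩, h4⟩ := h3
  obtain ⟨k, hk⟩ := List.mem_iff_getElem?.1 (List.mem_reverse.1 h4)
  have h5 := hi' d hd k _ hk
  have h6 := (List.getElem?_eq_some_iff.1 hk).1
  have h7 : d.length ≤ c'.length := by
    rcases List.mem_cons.1 hd with rfl | hd
    · exact le_rfl
    · exact (le_maxLength hd).trans h'.maxLength_le
  omega

/-- A tableau whose columns are initial is determined by its weight. -/
theorem eq_of_initial {cs cs' : List (List (Fin n))} (h : Tab (· ≤ ·) cs) (h' : Tab (· ≤ ·) cs')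
    (hi : ∀ d ∈ cs, IsInitial d) (hi' : ∀ d ∈ cs', IsInitial d)
    (hp : (colRead cs).Perm (colRead cs')) : cs = cs' := by
  induction cs generalizing cs' with
  | nil =>
    cases cs' with
    | nil => rfl
    | cons c' cs' =>
      have h1 := (tab_cons.1 h').1.1
      simp [h1] at hp
  | cons c cs ih =>
    cases cs' with
    | nil =>
      have h1 := (tab_cons.1 h).1.1
      simp [h1] at hp
    | cons c' cs' =>
      have h1 := length_le_of_initial h' (hi c List.mem_cons_self) hi' fun x => hp.mem_iff.1
      have h2 := length_le_of_initial h (hi' c' List.mem_cons_self) hi fun x => hp.mem_iff.2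
      obtain rfl := (hi c List.mem_cons_self).ext (hi' c' List.mem_cons_self) (le_antisymm h1 h2)
      rw [colRead_cons, colRead_cons, List.perm_append_left_iff] at hp
      rw [ih (tab_cons.1 h).2.2 (tab_cons.1 h').2.2 (fun d hd => hi d (List.mem_cons_of_mem _ hd))
        (fun d hd => hi' d (List.mem_cons_of_mem _ hd)) hp]

theorem WArrow.sum_eq {i : Fin (n - 1)} {w w' : List (Fin n)} (h : WArrow i w w') :
    (w'.map Fin.val).sum = (w.map Fin.val).sum + 1 := by
  obtain ⟨u, v, rfl, rfl, -⟩ := h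
  simp [lo_val, hi_val]
  omega

/-- A word is of highest weight, or some operator `e_i` can be applied to it. -/
theorem highest_or_exists_arrow (w : List (Fin n)) :
    (∀ i, weps i w = 0) ∨ ∃ i u, WArrow i u w := by
  by_cases h : ∀ i, weps i w = 0
  · exact .inl h
  · push Not at h
    obtain ⟨i, hi⟩ := h
    obtain ⟨u, hu⟩ := Option.ne_none_iff_exists'.1 (mt word_e_eq_none.1 hi)
    exact .inr ⟨i, u, word_e_iff.1 hu⟩

theorem young_skew {t : ColString n} (ht : t ∈ Young n) : t ∈ Skew n := ht.1

theorem Knuth.isInitial {w : List (Fin n)} {t : ColString n} (ht : t ∈ Young n)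
    (h : Knuth w t.read) (hw : ∀ i, weps i w = 0) : ∀ c ∈ t.cols, IsInitial c := by
  refine isInitial_of_highest (young_iff.1 ht).2 fun i => ?_
  rw [← (signature_colRead i (skew_pairwise (young_skew ht))).2, ← hw i]
  exact (h.sameCrystal i).2.1.symm

/-- A Knuth class contains the reading of at most one Young tableau. -/
theorem young_unique {t t' : ColString n} (ht : t ∈ Young n) (ht' : t' ∈ Young n)
    (h : Knuth t.read t'.read) : t = t' := by
  obtain ⟨m, hm⟩ : ∃ m, (t.read.map Fin.val).sum = m := ⟨_, rfl⟩
  induction m using Nat.strong_induction_on generalizing t t' with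
  | _ m ih =>
    rcases highest_or_exists_arrow t.read with h0 | ⟨i, u, hu⟩
    · have h1 := (Knuth.refl t.read).isInitial ht h0
      have h2 := h.isInitial ht' h0
      have h3 := eq_of_initial (young_iff.1 ht).2 (young_iff.1 ht').2 h1 h2 h.perm
      rw [(young_iff.1 ht).1, h3, ← (young_iff.1 ht').1]
    · obtain ⟨v, hv, huv⟩ := h.exists_arrow' hu
      obtain ⟨s, hs, rfl⟩ := exists_carrow_of_read' (young_skew ht) hu
      obtain ⟨s', hs', rfl⟩ := exists_carrow_of_read' (young_skew ht') hv
      have h1 := hu.sum_eq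
      obtain rfl := ih _ (by omega) (hs.young_iff.2 ht) (hs'.young_iff.2 ht') huv rfl
      exact Option.some_injective _ ((col_f_iff.2 hs).symm.trans (col_f_iff.2 hs'))

/-! ### Connected components of words -/

/-- Every word is Knuth equivalent to the reading of a Young tableau. -/
theorem exists_young (w : List (Fin n)) : ∃ t ∈ Young n, Knuth w t.read := by
  obtain ⟨t, ht⟩ := exists_isRectification (diag_mem w).1
  refine ⟨t, ht.1, ?_⟩
  have := ht.pl_read (diag_mem w).1
  rw [read_diag] at this
  exact (pl_eq_iff.1 this).symm

theorem WArrow.exists_young {i : Fin (n - 1)} {w w' : List (Fin n)} (h : WArrow i w w')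
    {t : ColString n} (ht : t ∈ Young n) (hwt : Knuth w t.read) :
    ∃ t' ∈ Young n, CArrow i t t' ∧ Knuth w' t'.read := by
  obtain ⟨v, hv, hwv⟩ := hwt.exists_arrow h
  obtain ⟨t', ht', rfl⟩ := exists_carrow_of_read (young_skew ht) hv
  exact ⟨t', ht'.young_iff.1 ht, ht', hwv⟩

/-- Words in the same connected component of the crystal graph. -/
def SameComponent : List (Fin n) → List (Fin n) → Prop :=
  Relation.EqvGen fun a b => ∃ i, (wordCrystal n).f i a = some b

theorem WArrow.sameComponent {i : Fin (n - 1)} {w w' : List (Fin n)} (h : WArrow i w w') :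
    SameComponent w w' := .rel _ _ ⟨i, word_f_iff.2 h⟩

/-- Arrows preserve the length, and the suffixes of the two ends of an arrow are equal or joined by an
arrow with the same label. -/
theorem SameComponent.length_tail {w w' : List (Fin n)} (h : SameComponent w w') :
    w.length = w'.length ∧ SameComponent w.tail w'.tail := by
  induction h with
  | rel a b h =>
    obtain ⟨i, h⟩ := h
    obtain ⟨u, v, rfl, rfl, h1, h2⟩ := word_f_iff.1 h
    refine ⟨by simp, ?_⟩
    cases u with
    | nil => exact .refl _
    | cons x u =>
      refine WArrow.sameComponent (i := i) ⟨u, v, rfl, rfl, ?_, h2⟩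
      rw [← List.singleton_append, weps_append] at h1
      omega
  | refl a => exact ⟨rfl, .refl _⟩
  | symm _ _ _ ih => exact ⟨ih.1.symm, ih.2.symm⟩
  | trans _ _ _ _ _ ih ih' => exact ⟨ih.1.trans ih'.1, ih.2.trans _ _ _ ih'.2⟩

/-- The shape of the Young tableau of a word is constant on connected components. -/
theorem SameComponent.shape {w w' : List (Fin n)} (h : SameComponent w w') {t t' : ColString n}
    (ht : t ∈ Young n) (ht' : t' ∈ Young n) (hw : Knuth w t.read) (hw' : Knuth w' t'.read) :
    t.cols.map List.length = t'.cols.map List.length := by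
  induction h generalizing t t' with
  | rel a b h =>
    obtain ⟨i, h⟩ := h
    obtain ⟨s, hs, h1, h2⟩ := (word_f_iff.1 h).exists_young ht hw
    obtain rfl := young_unique hs ht' (h2.symm.trans hw')
    exact h1.map_length.symm
  | refl a => rw [young_unique ht ht' (hw.symm.trans hw')]
  | symm _ _ _ ih => exact (ih ht' ht hw' hw).symm
  | trans _ b _ _ _ ih ih' =>
    obtain ⟨s, hs, h1⟩ := JeuDeTaquin.exists_young b
    exact (ih ht hs hw h1).trans (ih' hs ht' h1 hw')

/-- A connected component contains at most one word of highest weight. Removing the first letter sends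
a component into a component and preserves words of highest weight, so by induction two such words
agree except possibly in their first letters. These agree too, because the words have the same
weight: it is determined by the shape of their Young tableaux. -/
theorem SameComponent.eq_of_highest {u u' : List (Fin n)} (h : SameComponent u u')
    (hu : ∀ i, weps i u = 0) (hu' : ∀ i, weps i u' = 0) : u = u' := by
  induction u generalizing u' with
  | nil => exact (List.length_eq_zero_iff.1 h.length_tail.1.symm).symm
  | cons x u ih =>
    cases u' with
    | nil => exact absurd h.length_tail.1 (by simp)
    | cons x' u' =>
      have htail : ∀ {y : Fin n} {v : List (Fin n)}, (∀ i, weps i (y :: v) = 0) →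
          ∀ i, weps i v = 0 := fun {y v} hv i => by
        have := hv i
        rw [← List.singleton_append, weps_append] at this
        omega
      obtain rfl := ih h.length_tail.2 (htail hu) (htail hu')
      obtain ⟨t, ht, h1⟩ := JeuDeTaquin.exists_young (x :: u)
      obtain ⟨t', ht', h1'⟩ := JeuDeTaquin.exists_young (x' :: u)
      have h2 := h1.isInitial ht hu
      have h2' := h1'.isInitial ht' hu'
      have h3 := h.shape ht ht' h1 h1'
      have h4 : t.cols = t'.cols := by
        have hlen := congrArg List.length h3
        simp only [List.length_map] at hlen
        refine List.ext_getElem hlen fun k hk hk' => ?_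
        refine (h2 _ (List.getElem_mem hk)).ext (h2' _ (List.getElem_mem hk')) ?_
        have := List.getElem_of_eq h3 (i := k) (by simpa using hk)
        simpa using this
      have h5 : (x :: u).Perm (x' :: u) := by
        have := h1'.perm
        rw [read_eq_colRead, ← h4] at this
        exact h1.perm.trans this.symm
      have h6 := h5.count_eq x
      by_contra hne
      have hne' : x' ≠ x := fun h => hne (by rw [h])
      simp [hne'] at h6

/-- Knuth equivalent words in the same connected component are equal. -/
theorem SameComponent.eq_of_knuth {v v' : List (Fin n)} (h : SameComponent v v')
    (hk : Knuth v v') : v = v' := by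
  obtain ⟨m, hm⟩ : ∃ m, (v.map Fin.val).sum = m := ⟨_, rfl⟩
  induction m using Nat.strong_induction_on generalizing v v' with
  | _ m ih =>
    rcases highest_or_exists_arrow v with h0 | ⟨i, u, hu⟩
    · exact h.eq_of_highest h0 fun i => (hk.sameCrystal i).2.1 ▸ h0 i
    · obtain ⟨u', hu', huu⟩ := hk.exists_arrow' hu
      have h1 := hu.sum_eq
      have h2 : SameComponent u u' :=
        (hu.sameComponent.trans _ _ _ h).trans _ _ _ hu'.sameComponent.symm
      obtain rfl := ih _ (by omega) h2 huu rfl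
      exact hu.right_unique hu'

end Uniqueness

/-! ### Crystal isomorphisms -/

section Isomorphisms

variable {n : ℕ}

/-- A map which commutes with the operators `f_i` on a union `S` of components, through which arrows
can be lifted, and which separates the elements of each component, induces isomorphisms of
components. -/
theorem Crystal.isIso_of_lift {X : Type*} {C : Crystal n X} {S : Set X} {ψ : X → X}
    (hS : ∀ i a b, C.f i a = some b → (a ∈ S ↔ b ∈ S))
    (hf : ∀ i a b, a ∈ S → C.f i a = some b → C.f i (ψ a) = some (ψ b))
    (hlift : ∀ i a y, a ∈ S → C.f i (ψ a) = some y → ∃ b, C.f i a = some b)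
    (hlift' : ∀ i a y, a ∈ S → C.f i y = some (ψ a) → ∃ b, C.f i b = some a)
    (hfinj : ∀ i y y' z, C.f i y = some z → C.f i y' = some z → y = y')
    (hinj : ∀ a b, a ∈ S → b ∈ S → Relation.EqvGen (fun a b => ∃ i, C.f i a = some b) a b →
      ψ a = ψ b → a = b)
    (hwt : ∀ a ∈ S, C.wt (ψ a) = C.wt a) {u : X} (hu : u ∈ S) :
    C.component u ⊆ S ∧ C.IsIso u (ψ u) ψ := by
  set R : X → X → Prop := fun a b => ∃ i, C.f i a = some b with hR
  have hmem : ∀ a b, Relation.EqvGen R a b → (a ∈ S ↔ b ∈ S) := by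
    intro a b h
    induction h with
    | rel a b h => exact hS _ a b h.choose_spec
    | refl => exact Iff.rfl
    | symm _ _ _ ih => exact ih.symm
    | trans _ _ _ _ _ ih ih' => exact ih.trans ih'
  have hsub : C.component u ⊆ S := fun v hv => (hmem u v hv).1 hu
  have hmap : ∀ a b, Relation.EqvGen R a b → a ∈ S → Relation.EqvGen R (ψ a) (ψ b) := by
    intro a b h
    induction h with
    | rel a b h =>
      obtain ⟨i, h⟩ := h
      exact fun ha => .rel _ _ ⟨i, hf i a b ha h⟩
    | refl => exact fun _ => .refl _
    | symm a b h ih => exact fun hb => (ih ((hmem a b h).2 hb)).symm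
    | trans a b c h _ ih ih' => exact fun ha => (ih ha).trans _ _ _ (ih' ((hmem a b h).1 ha))
  have hpath : ∀ y y', Relation.EqvGen R y y' →
      (∀ a ∈ S, ψ a = y → ∃ b ∈ S, Relation.EqvGen R a b ∧ ψ b = y') ∧
      (∀ a ∈ S, ψ a = y' → ∃ b ∈ S, Relation.EqvGen R a b ∧ ψ b = y) := by
    intro y y' h
    induction h with
    | rel y y' h =>
      obtain ⟨i, h⟩ := h
      constructor
      · rintro a ha rfl
        obtain ⟨b, hb⟩ := hlift i a y' ha h
        exact ⟨b, (hS i a b hb).1 ha, .rel _ _ ⟨i, hb⟩,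
          Option.some_injective _ ((hf i a b ha hb).symm.trans h)⟩
      · rintro a ha rfl
        obtain ⟨b, hb⟩ := hlift' i a y ha h
        have hbS := (hS i b a hb).2 ha
        exact ⟨b, hbS, .symm _ _ (.rel _ _ ⟨i, hb⟩), hfinj i _ _ _ (hf i b a hbS hb) h⟩
    | refl y => exact ⟨fun a ha h => ⟨a, ha, .refl _, h⟩, fun a ha h => ⟨a, ha, .refl _, h⟩⟩
    | symm _ _ _ ih => exact ⟨ih.2, ih.1⟩
    | trans _ _ _ _ _ ih ih' =>
      constructor
      · intro a ha h
        obtain ⟨b, hb, h1, h2⟩ := ih.1 a ha h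
        obtain ⟨c, hc, h3, h4⟩ := ih'.1 b hb h2
        exact ⟨c, hc, h1.trans _ _ _ h3, h4⟩
      · intro a ha h
        obtain ⟨b, hb, h1, h2⟩ := ih'.2 a ha h
        obtain ⟨c, hc, h3, h4⟩ := ih.2 b hb h2
        exact ⟨c, hc, h1.trans _ _ _ h3, h4⟩
  refine ⟨hsub, ⟨⟨fun v hv => hmap u v hv hu, fun v hv v' hv' h => ?_, fun y hy => ?_⟩,
    fun v hv => hwt v (hsub hv), fun v hv v' _ i h => hf i v v' (hsub hv) h⟩⟩
  · exact hinj v v' (hsub hv) (hsub hv') ((Relation.EqvGen.symm _ _ hv).trans _ _ _ hv') h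
  · obtain ⟨b, -, h1, h2⟩ := (hpath _ _ hy).1 u hu rfl
    exact ⟨b, h1, h2⟩

theorem rect_spec {d : ColString n} (hd : d ∈ DSkew n) :
    IsRectification d (rect d) ∧ rect d ∈ Young n ∧ Knuth d.read (rect d).read := by
  have h := exists_isRectification hd.1
  have h1 : IsRectification d (rect d) := by
    rw [rect, dif_pos h]
    exact h.choose_spec
  exact ⟨h1, h1.1, (pl_eq_iff.1 (h1.pl_read hd.1)).symm⟩

theorem eq_rect {d t : ColString n} (hd : d ∈ DSkew n) (ht : t ∈ Young n)
    (h : Knuth d.read t.read) : t = rect d :=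
  young_unique ht (rect_spec hd).2.1 (h.symm.trans (rect_spec hd).2.2)

theorem isRectification_iff {d : ColString n} (hd : d ∈ DSkew n) (t : ColString n) :
    IsRectification d t ↔ t = rect d := by
  constructor
  · intro h
    exact eq_rect hd h.1 (pl_eq_iff.1 (h.pl_read hd.1)).symm
  · rintro rfl
    exact (rect_spec hd).1

theorem Yrow_isRight : (Yrow n).IsRight :=
  StringData.isRight_of_monoid pl rfl (fun _ _ => rfl) young_empty_mem rfl
    (fun x => by simp [Yrow, transpose, schensted, ColString.empty, ColString.ofCols,
      ColString.read])
    (fun _ hd x => (Yrow_ins_mem hd x).1) (fun _ hd x => (Yrow_ins_mem hd x).2)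
    (fun _ hd _ hd' h => young_unique hd hd' (pl_eq_iff.1 h))

theorem Ycol_isLeft : (Ycol n).IsLeft :=
  StringData.isLeft_of_monoid pl rfl (fun _ _ => rfl) young_empty_mem rfl
    (fun x => by simp [Ycol, schensted, ColString.empty, ColString.ofCols, ColString.read])
    (fun _ hd x => (Ycol_ins_mem hd x).1) (fun _ hd x => (Ycol_ins_mem hd x).2)
    (fun _ hd _ hd' h => young_unique hd hd' (pl_eq_iff.1 h))

theorem rect_empty : rect (ColString.empty : ColString n) = ColString.empty :=
  (eq_rect dskew_empty_mem young_empty_mem (.refl _)).symm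

theorem pl_rect {d : ColString n} (hd : d ∈ DSkew n) : pl (rect d).read = pl d.read :=
  (pl_eq_iff.2 (rect_spec hd).2.2).symm

theorem rect_isRightMorphism : StringData.IsRightMorphism (DSKrow n) (Yrow n) rect where
  source := DSKrow_isRight
  target := Yrow_isRight
  mapsTo _ hd := (rect_spec hd).2.1
  map_empty := rect_empty
  map_ins d hd x := by
    have hm : (DSKrow n).ins d x ∈ DSkew n := DSKrow_isRight.ins_mem d hd x
    refine (eq_rect hm (Yrow_ins_mem (rect_spec hd).2.1 x).1 (pl_eq_iff.1 ?_)).symm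
    rw [(Yrow_ins_mem (rect_spec hd).2.1 x).2, pl_rect hd]
    exact congrArg pl (colRead_topConcat d.cols x)
  cons_read d hd := by
    have key := fun u => StringData.map_insR (S := Yrow n) (φ := pl) rfl (fun _ _ => rfl)
      (fun _ hd x => (Yrow_ins_mem hd x).1) (fun _ hd x => (Yrow_ins_mem hd x).2)
      young_empty_mem u
    refine young_unique (key _).1 (key _).1 (pl_eq_iff.1 ?_)
    refine (key d.read).2.trans (Eq.trans ?_ (key (rect d).read).2.symm)
    rw [pl_rect hd]

theorem rect_isLeftMorphism : StringData.IsLeftMorphism (DSKcol n) (Ycol n) rect where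
  source := DSKcol_isLeft
  target := Ycol_isLeft
  mapsTo _ hd := (rect_spec hd).2.1
  map_empty := rect_empty
  map_ins d hd x := by
    have hm : (DSKcol n).ins d x ∈ DSkew n := DSKcol_isLeft.ins_mem d hd x
    refine (eq_rect hm (Ycol_ins_mem (rect_spec hd).2.1 x).1 (pl_eq_iff.1 ?_)).symm
    rw [(Ycol_ins_mem (rect_spec hd).2.1 x).2, pl_rect hd]
    exact congrArg pl (colRead_bottomConcat d.cols x)
  cons_read d hd := by
    have key := fun u => StringData.map_insL (S := Ycol n) (φ := pl) rfl (fun _ _ => rfl)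
      (fun _ hd x => (Ycol_ins_mem hd x).1) (fun _ hd x => (Ycol_ins_mem hd x).2)
      young_empty_mem u
    refine young_unique (key _).1 (key _).1 (pl_eq_iff.1 ?_)
    refine (key d.read).2.trans (Eq.trans ?_ (key (rect d).read).2.symm)
    rw [pl_rect hd]

theorem rect_carrow {i : Fin (n - 1)} {a b : ColString n} (ha : a ∈ DSkew n) (h : CArrow i a b) :
    CArrow i (rect a) (rect b) := by
  have hb := h.dskew_iff.1 ha
  obtain ⟨t, ht, h1, h2⟩ := (h.read (skew_pairwise ha.1)).exists_young (rect_spec ha).2.1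
    (rect_spec ha).2.2
  rwa [← eq_rect hb ht h2]

theorem SameComponent.of_component {a b : ColString n}
    (h : Relation.EqvGen (fun a b => ∃ i, (colCrystal n).f i a = some b) a b) :
    (a ∈ DSkew n ↔ b ∈ DSkew n) ∧ (a ∈ DSkew n → SameComponent a.read b.read) := by
  induction h with
  | rel a b h =>
    obtain ⟨i, h⟩ := h
    rw [col_f_iff] at h
    exact ⟨h.dskew_iff, fun ha => (h.read (skew_pairwise ha.1)).sameComponent⟩
  | refl => exact ⟨Iff.rfl, fun _ => .refl _⟩
  | symm a b _ ih => exact ⟨ih.1.symm, fun hb => (ih.2 (ih.1.2 hb)).symm⟩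
  | trans a b c _ _ ih ih' =>
    exact ⟨ih.1.trans ih'.1, fun ha => (ih.2 ha).trans _ _ _ (ih'.2 (ih.1.1 ha))⟩

theorem rect_isIso_columns {d : ColString n} (hd : d ∈ DSkew n) :
    (colCrystal n).component d ⊆ DSkew n ∧ (colCrystal n).IsIso d (rect d) rect := by
  refine Crystal.isIso_of_lift (S := DSkew n) ?_ ?_ ?_ ?_ ?_ ?_ ?_ hd
  · intro i a b h
    exact (col_f_iff.1 h).dskew_iff
  · intro i a b ha h
    exact col_f_iff.2 (rect_carrow ha (col_f_iff.1 h))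
  · intro i a y ha h
    have h1 := (col_f_iff.1 h).read (skew_pairwise (young_skew (rect_spec ha).2.1))
    obtain ⟨v, hv, -⟩ := (rect_spec ha).2.2.symm.exists_arrow h1
    obtain ⟨b, hb, -⟩ := exists_carrow_of_read ha.1 hv
    exact ⟨b, col_f_iff.2 hb⟩
  · intro i a y ha h
    have hy := (col_f_iff.1 h).young_iff.2 (rect_spec ha).2.1
    have h1 := (col_f_iff.1 h).read (skew_pairwise (young_skew hy))
    obtain ⟨v, hv, -⟩ := (rect_spec ha).2.2.symm.exists_arrow' h1
    obtain ⟨b, hb, -⟩ := exists_carrow_of_read' ha.1 hv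
    exact ⟨b, col_f_iff.2 hb⟩
  · intro i y y' z h h'
    rw [col_f_iff, ← col_e_iff] at h h'
    exact Option.some_injective _ (h.symm.trans h')
  · intro a b ha hb h hab
    have hk := (rect_spec ha).2.2
    rw [hab] at hk
    exact dskew_read_injOn ha hb
      (((SameComponent.of_component h).2 ha).eq_of_knuth (hk.trans (rect_spec hb).2.2.symm))
  · intro a ha
    funext x
    exact ((rect_spec ha).2.2.perm.count_eq x).symm

theorem rect_isIso_words {d : ColString n} (hd : d ∈ DSkew n) :
    (wordCrystal n).IsIso d.read (rect d).read (fun w => (rect (diag w)).read) := by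
  have hk : ∀ w : List (Fin n), Knuth w (rect (diag w)).read := fun w => by
    have := (rect_spec (diag_mem w)).2.2
    rwa [read_diag] at this
  have key := Crystal.isIso_of_lift (C := wordCrystal n) (S := Set.univ)
    (ψ := fun w => (rect (diag w)).read) ?_ ?_ ?_ ?_ ?_ ?_ ?_ (Set.mem_univ d.read)
  · have h := key.2
    simp only [diag_read hd] at h
    exact h
  · exact fun i a b _ => by simp
  · intro i a b _ h
    obtain ⟨t, ht, h1, h2⟩ := (word_f_iff.1 h).exists_young (rect_spec (diag_mem a)).2.1 (hk a)
    rw [young_unique ht (rect_spec (diag_mem b)).2.1 (h2.symm.trans (hk b))] at h1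
    exact word_f_iff.2 (h1.read (skew_pairwise (young_skew (rect_spec (diag_mem a)).2.1)))
  · intro i a y _ h
    obtain ⟨v, hv, -⟩ := (hk a).symm.exists_arrow (word_f_iff.1 h)
    exact ⟨v, word_f_iff.2 hv⟩
  · intro i a y _ h
    obtain ⟨v, hv, -⟩ := (hk a).symm.exists_arrow' (word_f_iff.1 h)
    exact ⟨v, word_f_iff.2 hv⟩
  · intro i y y' z h h'
    exact (word_f_iff.1 h).left_unique (word_f_iff.1 h')
  · intro a b _ _ h hab
    have h1 := hk a
    have hab' : (rect (diag a)).read = (rect (diag b)).read := hab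
    rw [hab'] at h1
    exact SameComponent.eq_of_knuth h (h1.trans (hk b).symm)
  · intro a _
    funext x
    exact ((hk a).perm.count_eq x).symm

end Isomorphisms

end JeuDeTaquin

/-- The rectification is a well-defined morphism from diagonal skew tableaux to Young tableaux, both
for the right and for the left string data structures, and it induces a crystal isomorphism from the
component of `d` onto the component of `rect d`, for every diagonal skew tableau `d`: both on strings
of columns, and on words through the south-west reading. -/
theorem mainTheorem5 (n : ℕ) :
    (∀ d ∈ DSkew n, ∀ t : ColString n, IsRectification d t ↔ t = rect d) ∧
    StringData.IsRightMorphism (DSKrow n) (Yrow n) rect ∧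
    StringData.IsLeftMorphism (DSKcol n) (Ycol n) rect ∧
    ∀ d ∈ DSkew n,
      (colCrystal n).component d ⊆ DSkew n ∧
      (colCrystal n).IsIso d (rect d) rect ∧
      (wordCrystal n).IsIso d.read (rect d).read (fun w => (rect (diag w)).read) :=
  ⟨fun _ hd t => isRectification_iff hd t, rect_isRightMorphism, rect_isLeftMorphism, fun _ hd =>
    ⟨(rect_isIso_columns hd).1, (rect_isIso_columns hd).2, rect_isIso_words hd⟩⟩
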